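/- Let $n\ge 3$ and let $m>n/2+1$ be an integer. Let $\tau,b,c,k\in\mathbb R$ and let $g:(0,\infty)\to[0,\infty)$ be a memory kernel such that: $g\in W^{1,1}(0,\infty)$; $0<\int_0^\infty g(s)\,ds<c^2$; there is $\zeta>0$ with $g'(s)\le-\zeta g(s)$ for all $s>0$; and $g''\ge 0$, in the sense that $g'$ is nondecreasing on $(0,\infty)$ (as is the case if $g'$ is locally absolutely continuous on $(0,\infty)$ with $g''\ge0$ almost everywhere). Put $c_g^2=c^2-\int_0^\infty g(s)\,ds$ and assume $b\ge\tau c^2>\tau c_g^2$. All functions are real-valued. Let $\dot H^{m}$ be the space of functions $\psi\in L^{2n/(n-2)}(\mathbb R^n)$ with $\nabla\psi,\dots,\nabla^{m}\psi\in L^2(\mathbb R^n)$, normed by $\|\nabla\psi\|_{H^{m-1}}$; let $\mathcal M^m$ be the space of functions $\eta:(0,\infty)\to\dot H^m$ with norm $\|\nabla\eta\|_{H^{m-1},-g'}^2=\int_0^\infty(-g'(s))\|\nabla\eta(s)\|_{H^{m-1}}^2\,ds<\infty$; and let $\mathcal H^{m-1}=\dot H^m\times H^m(\mathbb R^n)\times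 H^{m-1}(\mathbb R^n)\times\mathcal M^m$ with $$\|(\psi,v,w,\eta)\|_{\mathcal H^{m-1}}^2=\|\nabla\psi\|_{H^{m-1}}^2+\|v\|_{H^m}^2+\|w\|_{H^{m-1}}^2+\|\nabla\eta\|_{H^{m-1},-g'}^2 .$$ On $\mathcal H^{m-1}$ consider the operator $$\mathcal A(\psi,v,w,\eta)=\Big(v,\;w,\;-\tfrac1\tau w+\tfrac{c_g^2}\tau\Delta\psi+\tfrac b\tau\Delta v+\tfrac1\tau\int_0^\infty g(s)\Delta\eta(s)\,ds,\;v-\eta_s\Big),$$ whose domain consists of all $(\psi,v,w,\eta)\in\mathcal H^{m-1}$ with $w\in H^m$, $c_g^2\Delta\psi+b\Delta v+\int_0^\infty g(s)\Delta\eta(s)\,ds\in H^{m-1}$, $\eta_s\in\mathcal M^m$ and $\eta(0)=0$, and the nonlinearity $$\mathbb F(\Psi,\nabla\Psi)=\tfrac1\tau\big(0,\,0,\,2kvw+2\nabla\psi\cdot\nabla v,\,0\big),\qquad \Psi=(\psi,v,w,\eta).$$ Then $\mathcal A$ generates a $C_0$-semigroup $e^{t\mathcal A}$ on $\mathcal H^{m-1}$,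 and for every $\Psi_0\in\mathcal H^{m-1}$ there is a time $T=T(\|\Psi_0\|_{\mathcal H^{m-1}})>0$, depending (for fixed $n,m,\tau,b,c,k,g$) on $\Psi_0$ only through its norm, such that the system $\Psi_t=\mathcal A\Psi+\mathbb F(\Psi,\nabla\Psi)$, $\Psi(0)=\Psi_0$, has a unique mild solution $\Psi\in C([0,T];\mathcal H^{m-1})$; that is, there is exactly one such $\Psi$ with $\mathbb F(\Psi,\nabla\Psi)(t)\in\mathcal H^{m-1}$ and $$\Psi(t)=e^{t\mathcal A}\Psi_0+\int_0^te^{(t-r)\mathcal A}\,\mathbb F(\Psi,\nabla\Psi)(r)\,dr\qquad\text{for all }t\in[0,T].$$ -/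

import Mathlib

open MeasureTheory Filter Topology Set
open scoped ENNReal ContDiff

noncomputable section

namespace JMGT

/-! ### Weak derivatives on `ℝⁿ` -/

/-- Euclidean space `ℝⁿ`. -/
abbrev RN (n : ℕ) : Type := EuclideanSpace ℝ (Fin n)

/-- `L²(ℝⁿ)`, real valued. -/
abbrev L2 (n : ℕ) : Type := Lp ℝ 2 (volume : Measure (RN n))

/-- The classical partial derivative `∂ᵢ φ`. -/
def partialD {n : ℕ} (i : Fin n) (φ : RN n → ℝ) (x : RN n) : ℝ :=
  fderiv ℝ φ x (EuclideanSpace.single i 1)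

/-- `h ∈ L¹_loc` is the weak partial derivative `∂ᵢ f` of `f ∈ L¹_loc`. -/
def HasWeakPartial {n : ℕ} (i : Fin n) (f h : RN n → ℝ) : Prop :=
  LocallyIntegrable f volume ∧ LocallyIntegrable h volume ∧
    ∀ φ : RN n → ℝ, ContDiff ℝ ∞ φ → HasCompactSupport φ →
      ∫ x, f x * partialD i φ x = -∫ x, h x * φ x

/-- `h ∈ L¹_loc` is the weak divergence of the vector field `q ∈ L¹_loc`. -/
def HasWeakDiv {n : ℕ} (q : Fin n → RN n → ℝ) (h : RN n → ℝ) : Prop :=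
  (∀ i, LocallyIntegrable (q i) volume) ∧ LocallyIntegrable h volume ∧
    ∀ φ : RN n → ℝ, ContDiff ℝ ∞ φ → HasCompactSupport φ →
      ∫ x, ∑ i, q i x * partialD i φ x = -∫ x, h x * φ x

lemma integrable_mul_test {n : ℕ} {f φ : RN n → ℝ} (hf : LocallyIntegrable f volume)
    (hφ : Continuous φ) (hc : HasCompactSupport φ) :
    Integrable (fun x => f x * φ x) volume := by
  simpa only [smul_eq_mul] using hf.integrable_smul_right_of_hasCompactSupport hφ hc

lemma continuous_partialD {n : ℕ} (i : Fin n) {φ : RN n → ℝ} (hφ : ContDiff ℝ ∞ φ) :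
    Continuous (partialD i φ) :=
  (hφ.continuous_fderiv (by simp)).clm_apply continuous_const

lemma hasCompactSupport_partialD {n : ℕ} (i : Fin n) {φ : RN n → ℝ}
    (hc : HasCompactSupport φ) : HasCompactSupport (partialD i φ) :=
  hc.fderiv_apply (𝕜 := ℝ) (EuclideanSpace.single i 1)

lemma HasWeakPartial.congr {n : ℕ} {i : Fin n} {f f₁ h h₁ : RN n → ℝ}
    (H : HasWeakPartial i f h) (hf : f =ᵐ[volume] f₁) (hh : h =ᵐ[volume] h₁) :
    HasWeakPartial i f₁ h₁ := by
  refine ⟨H.1.congr hf, H.2.1.congr hh, fun φ h1 h2 => ?_⟩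
  have e := H.2.2 φ h1 h2
  have e1 : ∫ x, f x * partialD i φ x = ∫ x, f₁ x * partialD i φ x :=
    integral_congr_ae (hf.mul (EventuallyEq.refl _ (partialD i φ)))
  have e2 : ∫ x, h x * φ x = ∫ x, h₁ x * φ x :=
    integral_congr_ae (hh.mul (EventuallyEq.refl _ φ))
  rw [← e1, ← e2, e]

lemma HasWeakPartial.add {n : ℕ} {i : Fin n} {f f₁ h h₁ : RN n → ℝ}
    (H : HasWeakPartial i f h) (H₁ : HasWeakPartial i f₁ h₁) :
    HasWeakPartial i (f + f₁) (h + h₁) := by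
  refine ⟨H.1.add H₁.1, H.2.1.add H₁.2.1, fun φ hs hc => ?_⟩
  have cd := continuous_partialD i hs
  have sd := hasCompactSupport_partialD i hc
  simp only [Pi.add_apply, add_mul]
  rw [integral_add (integrable_mul_test H.1 cd sd) (integrable_mul_test H₁.1 cd sd),
    integral_add (integrable_mul_test H.2.1 hs.continuous hc)
      (integrable_mul_test H₁.2.1 hs.continuous hc), H.2.2 φ hs hc, H₁.2.2 φ hs hc]
  ring

lemma HasWeakPartial.smul {n : ℕ} {i : Fin n} {f h : RN n → ℝ} (a : ℝ)
    (H : HasWeakPartial i f h) : HasWeakPartial i (a • f) (a • h) := by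
  refine ⟨H.1.smul a, H.2.1.smul a, fun φ hs hc => ?_⟩
  simp only [Pi.smul_apply, smul_eq_mul, mul_assoc]
  rw [integral_const_mul, integral_const_mul, H.2.2 φ hs hc]
  ring

lemma HasWeakPartial.zero {n : ℕ} (i : Fin n) :
    HasWeakPartial i (0 : RN n → ℝ) (0 : RN n → ℝ) :=
  ⟨locallyIntegrable_zero, locallyIntegrable_zero, fun φ _ _ => by simp⟩

/-! ### The Sobolev space `H^s(ℝⁿ)` -/

/-- Index set of all iterated partial derivatives of order `κ ≤ s`: the entry `⟨κ, α⟩` stands for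
`∂_{α 0} ⋯ ∂_{α (κ-1)}`. -/
abbrev DIdx (n s : ℕ) : Type := (κ : Fin (s + 1)) × (Fin (κ : ℕ) → Fin n)

/-- The Hilbert space `H^s(ℝⁿ)`. A function `f` is represented by the family
`(∂_α f)` of all its weak partial derivatives of order at most `s`, each of them in `L²`; so
`‖f‖² = ∑_{κ ≤ s} ‖∇^κ f‖²_{L²}`. -/
def sobSubmodule (n s : ℕ) : Submodule ℝ (PiLp 2 (fun _ : DIdx n s => L2 n)) where
  carrier := {u | ∀ (κ : ℕ) (hκ : κ < s) (α : Fin κ → Fin n) (i : Fin n),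
    HasWeakPartial i (u ⟨⟨κ, by omega⟩, α⟩ : L2 n)
      (u ⟨⟨κ + 1, by omega⟩, Fin.cons i α⟩ : L2 n)}
  add_mem' := fun hu hv κ hκ α i => ((hu κ hκ α i).add (hv κ hκ α i)).congr
    (Lp.coeFn_add _ _).symm (Lp.coeFn_add _ _).symm
  zero_mem' := fun _ _ _ i => (HasWeakPartial.zero i).congr
    (Lp.coeFn_zero ℝ 2 volume).symm (Lp.coeFn_zero ℝ 2 volume).symm
  smul_mem' := fun a _ hu κ hκ α i => ((hu κ hκ α i).smul a).congr
    (Lp.coeFn_smul _ _).symm (Lp.coeFn_smul _ _).symm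

/-- The type of elements of `H^s(ℝⁿ)`. -/
def Sob (n s : ℕ) : Type := sobSubmodule n s

instance (n s : ℕ) : NormedAddCommGroup (Sob n s) :=
  inferInstanceAs (NormedAddCommGroup (sobSubmodule n s))

instance (n s : ℕ) : InnerProductSpace ℝ (Sob n s) :=
  inferInstanceAs (InnerProductSpace ℝ (sobSubmodule n s))

/-- The function underlying an element of `H^s(ℝⁿ)`. -/
def Sob.fn {n s : ℕ} (f : Sob n s) : L2 n := f.1 ⟨⟨0, by omega⟩, Fin.elim0⟩

/-- The first weak derivative `∂ᵢ f ∈ L²` of `f ∈ H^{s+1}(ℝⁿ)`. -/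
def Sob.d {n s : ℕ} (f : Sob n (s + 1)) (i : Fin n) : L2 n :=
  f.1 ⟨⟨1, by omega⟩, fun _ => i⟩

/-! ### The space `{ψ : ∇ψ, …, ∇^{s+1}ψ ∈ L²}` with the norm `‖∇ψ‖_{H^s}` -/

/-- The Sobolev exponent `2n/(n-2)`. -/
def critExp (n : ℕ) : ℝ≥0∞ := ENNReal.ofReal (2 * n / ((n : ℝ) - 2))

/-- The function `ψ ∈ L^{2n/(n-2)}` has the weak gradient `G`, all of whose components are
in `H^s`. -/
def IsPotential {n s : ℕ} (ψ : RN n → ℝ) (G : Fin n → Sob n s) : Prop :=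
  MemLp ψ (critExp n) volume ∧ ∀ i, HasWeakPartial i ψ (G i).fn

/-- The Hilbert space of functions `ψ` with `∇ψ, …, ∇^{s+1}ψ ∈ L²(ℝⁿ)` and
`‖ψ‖² = ‖∇ψ‖²_{H^s} = ∑ᵢ ‖∂ᵢψ‖²_{H^s}`. As this norm does not see constants, `ψ` is normalized by
`ψ ∈ L^{2n/(n-2)}`, and it is represented by its gradient, which for `n ≥ 3` determines it. -/
def homSubmodule (n s : ℕ) : Submodule ℝ (PiLp 2 (fun _ : Fin n => Sob n s)) where
  carrier := {G | ∃ ψ : RN n → ℝ, IsPotential ψ (fun i => G i)}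
  add_mem' := by
    rintro G H ⟨ψ, h1, h2⟩ ⟨χ, k1, k2⟩
    exact ⟨ψ + χ, h1.add k1, fun i => ((h2 i).add (k2 i)).congr (EventuallyEq.refl _ _)
      (Lp.coeFn_add _ _).symm⟩
  zero_mem' := ⟨0, MemLp.zero, fun i => (HasWeakPartial.zero i).congr (EventuallyEq.refl _ _)
    (Lp.coeFn_zero ℝ 2 volume).symm⟩
  smul_mem' := by
    rintro a G ⟨ψ, h1, h2⟩
    exact ⟨a • ψ, h1.const_smul a, fun i => ((h2 i).smul a).congr (EventuallyEq.refl _ _)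
      (Lp.coeFn_smul _ _).symm⟩

/-- The type of these functions `ψ`. -/
def Hom (n s : ℕ) : Type := homSubmodule n s

instance (n s : ℕ) : NormedAddCommGroup (Hom n s) :=
  inferInstanceAs (NormedAddCommGroup (homSubmodule n s))

instance (n s : ℕ) : InnerProductSpace ℝ (Hom n s) :=
  inferInstanceAs (InnerProductSpace ℝ (homSubmodule n s))

/-- The derivative `∂ᵢψ ∈ L²`. -/
def Hom.d {n s : ℕ} (ψ : Hom n s) (i : Fin n) : L2 n := (ψ.1 i).fn

/-- The element `ψ` of `Hom n s` is the function `f`. -/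
def Hom.Is {n s : ℕ} (ψ : Hom n s) (f : RN n → ℝ) : Prop := IsPotential f (fun i => ψ.1 i)

/-! ### The memory kernel -/

/-- The assumptions on the memory kernel `g` with derivative `dg` on `(0,∞)`. -/
structure IsMemoryKernel (c : ℝ) (g dg : ℝ → ℝ) : Prop where
  /-- `g ∈ W^{1,1}(0,∞)`, with weak derivative `dg`. -/
  integrable : IntegrableOn g (Ioi 0)
  integrable_deriv : IntegrableOn dg (Ioi 0)
  ftc : ∀ s t, 0 < s → s ≤ t → g t - g s = ∫ y in s..t, dg y
  nonneg : ∀ s, 0 < s → 0 ≤ g s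
  integral_pos : 0 < ∫ s in Ioi 0, g s
  integral_lt : ∫ s in Ioi 0, g s < c ^ 2
  decay : ∃ ζ : ℝ, 0 < ζ ∧ ∀ s, 0 < s → dg s ≤ -ζ * g s
  /-- `g'' ≥ 0`, i.e. `dg` is nondecreasing. This is the case if `dg` is locally absolutely
  continuous on `(0,∞)` with nonnegative derivative almost everywhere; it implies that `dg` is
  continuous outside a countable set. -/
  convex : MonotoneOn dg (Ioi 0)

/-- `c_g² = c² - ∫₀^∞ g`. -/
def cgSq (c : ℝ) (g : ℝ → ℝ) : ℝ := c ^ 2 - ∫ s in Ioi 0, g s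

/-- The measure `-g'(s) ds` on `(0,∞)`. -/
def histMeasure (dg : ℝ → ℝ) : Measure ℝ :=
  (volume.restrict (Ioi 0)).withDensity fun s => ENNReal.ofReal (-dg s)

/-- The history space `𝓜^{s+1} = {η : ∇η, …, ∇^{s+1}η ∈ L²_{-g'}((0,∞); L²)}` with the norm
`‖η‖² = ∫₀^∞ (-g'(r)) ‖∇η(r)‖²_{H^s} dr`. -/
abbrev Hist (n s : ℕ) (dg : ℝ → ℝ) : Type := Lp (Hom n s) 2 (histMeasure dg)

/-- `η ∈ D(𝕋)` with `∂ₛη = ξ ∈ 𝓜` and `η(0) = 0`, written as `η(r) = ∫₀^r ξ`. -/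
def HasHistDeriv {n s : ℕ} {dg : ℝ → ℝ} (η ξ : Hist n s dg) : Prop :=
  ∀ᵐ r ∂(histMeasure dg), IntervalIntegrable ξ volume 0 r ∧ η r = ∫ y in 0..r, ξ y

/-! ### The phase space and the operator -/

/-- The phase space `𝓗^s`, of vectors `(ψ, v, w, η)`, with the Hilbert norm
`‖∇ψ‖²_{H^s} + ‖v‖²_{H^{s+1}} + ‖w‖²_{H^s} + ‖∇η‖²_{H^s,-g'}`. -/
abbrev Phase (n s : ℕ) (dg : ℝ → ℝ) : Type :=
  WithLp 2 (Hom n s × WithLp 2 (Sob n (s + 1) × WithLp 2 (Sob n s × Hist n s dg)))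

variable {n s : ℕ} {dg : ℝ → ℝ}

def Phase.psi (Ψ : Phase n s dg) : Hom n s := Ψ.fst
def Phase.v (Ψ : Phase n s dg) : Sob n (s + 1) := Ψ.snd.fst
def Phase.w (Ψ : Phase n s dg) : Sob n s := Ψ.snd.snd.fst
def Phase.eta (Ψ : Phase n s dg) : Hist n s dg := Ψ.snd.snd.snd

/-- The vector `(0, 0, f, 0)`. -/
def Phase.ofW (f : Sob n s) : Phase n s dg :=
  WithLp.toLp 2 (0, WithLp.toLp 2 (0, WithLp.toLp 2 (f, 0)))

/-- `∫₀^∞ g(r) η(r) dr`. -/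
def memory (g : ℝ → ℝ) (η : Hist n s dg) : Hom n s := ∫ r in Ioi 0, g r • η r

/-- `Ψ ∈ D(𝒜)` and `𝒜Ψ = Φ`, where
`𝒜(ψ,v,w,η) = (v, w, -w/τ + (c_g²Δψ + bΔv + ∫₀^∞ g Δη)/τ, v - ∂ₛη)`. Here `D(𝒜)` consists of the
`(ψ,v,w,η) ∈ 𝓗^s` with `w ∈ H^{s+1}`, `c_g²Δψ + bΔv + ∫₀^∞ g Δη ∈ H^s` and `η ∈ D(𝕋)`. -/
def OpA (τ b c : ℝ) (g : ℝ → ℝ) (Ψ Φ : Phase n s dg) : Prop :=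
  Φ.psi.Is Ψ.v.fn ∧
  Φ.v.fn = Ψ.w.fn ∧
  (∃ h : Sob n s,
    HasWeakDiv (fun i x => cgSq c g * Ψ.psi.d i x + b * Ψ.v.d i x + (memory g Ψ.eta).d i x) h.fn ∧
    Φ.w = -(1 / τ) • Ψ.w + (1 / τ) • h) ∧
  ∃ (V : Hom n s) (ξ : Hist n s dg),
    V.Is Ψ.v.fn ∧ HasHistDeriv Ψ.eta ξ ∧ ∀ᵐ r ∂(histMeasure dg), Φ.eta r = V - ξ r

/-- `f ∈ H^s` is the third component `(2k v w + 2∇ψ·∇v)/τ` of the nonlinearity `𝔽(Ψ,∇Ψ)`, whose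
other components vanish. -/
def IsNonlinearity (τ k : ℝ) (Ψ : Phase n s dg) (f : Sob n s) : Prop :=
  f.fn =ᵐ[volume] fun x =>
    (1 / τ) * (2 * k * Ψ.v.fn x * Ψ.w.fn x + 2 * ∑ i, Ψ.psi.d i x * Ψ.v.d i x)

/-! ### Semigroups and mild solutions -/

/-- `(S t)_{t ≥ 0}` is a `C₀`-semigroup of bounded linear operators. -/
structure IsC0Semigroup {X : Type*} [NormedAddCommGroup X] [NormedSpace ℝ X]
    (S : ℝ → X →L[ℝ] X) : Prop where
  zero : S 0 = ContinuousLinearMap.id ℝ X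
  add : ∀ t r, 0 ≤ t → 0 ≤ r → S (t + r) = (S t).comp (S r)
  tendsto : ∀ x, Tendsto (fun t => S t x) (𝓝[>] 0) (𝓝 x)

/-- The operator with graph `A` is the infinitesimal generator of `S`. -/
def IsGenerator {X : Type*} [NormedAddCommGroup X] [NormedSpace ℝ X]
    (S : ℝ → X →L[ℝ] X) (A : X → X → Prop) : Prop :=
  ∀ x y, A x y ↔ Tendsto (fun t : ℝ => t⁻¹ • (S t x - x)) (𝓝[>] 0) (𝓝 y)

/-- `Ψ ∈ C([0,T]; 𝓗^s)` is a mild solution with initial value `Ψ₀`: for every `r` the nonlinearity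
`𝔽(Ψ(r),∇Ψ(r)) = (0,0,f(r),0)` belongs to `𝓗^s`, and
`Ψ(t) = S(t)Ψ₀ + ∫₀ᵗ S(t-r) 𝔽(Ψ,∇Ψ)(r) dr` for `t ∈ [0,T]`. -/
def IsMildSolution (τ k : ℝ) (S : ℝ → Phase n s dg →L[ℝ] Phase n s dg) (Ψ₀ : Phase n s dg)
    {T : ℝ} (Ψ : C(Icc (0 : ℝ) T, Phase n s dg)) : Prop :=
  ∃ f : ℝ → Sob n s,
    (∀ r : Icc (0 : ℝ) T, IsNonlinearity τ k (Ψ r) (f r)) ∧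
    ∀ t : Icc (0 : ℝ) T,
      IntervalIntegrable (fun r => S (t - r) (Phase.ofW (f r))) volume 0 t ∧
      Ψ t = S t Ψ₀ + ∫ r in (0 : ℝ)..t, S (t - r) (Phase.ofW (f r))

end JMGT

end

/-! The equation is semilinear and its nonlinearity loses no derivatives. Put `s = m - 1`, so that
`s > n/2` and `H^s` is an algebra (`Sob.exists_mul`). Since `∇ψ`, `∇v`, `v` and `w` all lie in
`H^s`, the map `𝔽` sends the phase space into itself, is quadratic and hence locally Lipschitz
(`exists_nonlinearity`). Once the semigroup is available, a contraction argument for Duhamel's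
formula on a short interval gives existence, a Grönwall argument gives uniqueness among all
continuous solutions, and the length of the interval is governed by `‖Ψ₀‖` alone
(`existsUnique_duhamel`, `exists_time`).

The semigroup comes from the Lumer–Phillips theorem in a Hilbert space
(`IsMaxDissipative.exists_semigroup`, by Yosida approximation), applied to `𝒜 - β` in an equivalent
norm. With `q = c_g²ψ + bv + ∫₀^∞ g η` the third equation is `τ w_t = -w + Δq`. In the energy `‖∇ψ‖²
+ ‖v‖² + bτ‖w‖² + ‖∇q‖² + ‖∇η‖²`, all norms in `H^s`, the dangerous terms are `-b⟨∇w,∇q⟩`, produced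
by `bτ⟨w,w_t⟩`, and `b⟨∇q,∇w⟩`, produced by `q_t`; they cancel. The history derivative is harmless:
`∫ g ∂ₛη = ∫ (-g') η` is bounded by the history norm, and `⟨η,∂ₛη⟩ ≥ 0` because `-g'` is
nonincreasing. What remains is bounded, so `𝒜 - β` is dissipative for some `β`
(`OpA.inner_energyL_le`). For the range condition, eliminating `ψ`, `w` and `η` from `(λ - 𝒜)Ψ = f`
leaves a scalar elliptic equation for `v` with positive coefficients (`OpA.surjective`,
`exists_elliptic`).

The function spaces are handled on the Fourier side, where weak derivatives become multiplication by
`2πi ξᵢ` (`HasWeakDiv.hat_eq`, `hasWeakDiv_reL`) and the `H^s` norm becomes a weighted `L²` norm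
(`Sob.norm_sq_eq`). The homogeneous space is represented by gradient fields. Its completeness rests
on `exists_potential`: a curl-free `L²` field is the gradient of a function in `L^{2n/(n-2)}`,
obtained by removing low frequencies and passing to the limit with the Gagliardo–Nirenberg–Sobolev
inequality. -/

noncomputable section

namespace JMGT

open scoped FourierTransform SchwartzMap LineDeriv

/-! ### The Fourier transform of real `L²` functions -/

/-- `L²(ℝⁿ)`, complex valued. -/
abbrev L2C (n : ℕ) : Type := Lp ℂ 2 (volume : Measure (RN n))

/-- The inclusion of real into complex `L²` functions. -/
def toC {n : ℕ} : L2 n →L[ℝ] L2C n := Complex.ofRealCLM.compLpL 2 volume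

/-- The real part of a complex `L²` function. -/
def reL {n : ℕ} : L2C n →L[ℝ] L2 n := Complex.reCLM.compLpL 2 volume

lemma coeFn_toC {n : ℕ} (f : L2 n) : toC f =ᵐ[volume] fun x => (f x : ℂ) :=
  Complex.ofRealCLM.coeFn_compLpL f

lemma coeFn_reL {n : ℕ} (f : L2C n) : reL f =ᵐ[volume] fun x => (f x).re :=
  Complex.reCLM.coeFn_compLpL f

lemma reL_toC {n : ℕ} (f : L2 n) : reL (toC f) = f := by
  apply Lp.ext
  filter_upwards [coeFn_reL (toC f), coeFn_toC f] with x h1 h2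
  rw [h1, h2, Complex.ofReal_re]

lemma norm_toC {n : ℕ} (f : L2 n) : ‖toC f‖ = ‖f‖ := by
  rw [Lp.norm_def, Lp.norm_def]
  congr 1
  apply eLpNorm_congr_norm_ae
  filter_upwards [coeFn_toC f] with x h
  rw [h, Complex.norm_real]

lemma norm_reL_le {n : ℕ} (f : L2C n) : ‖reL f‖ ≤ ‖f‖ := by
  refine Lp.norm_le_norm_of_ae_le ?_
  filter_upwards [coeFn_reL f] with x h
  rw [h]
  exact Complex.abs_re_le_norm _

/-- The Fourier transform of a real `L²` function. -/
def hat {n : ℕ} (f : L2 n) : L2C n := 𝓕 (toC f)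

lemma norm_hat {n : ℕ} (f : L2 n) : ‖hat f‖ = ‖f‖ := by
  rw [hat, Lp.norm_fourier_eq, norm_toC]

lemma hat_add {n : ℕ} (f g : L2 n) : hat (f + g) = hat f + hat g := by
  rw [hat, map_add, FourierTransform.fourier_add]; rfl

lemma hat_smul {n : ℕ} (a : ℝ) (f : L2 n) : hat (a • f) = (a : ℂ) • hat f := by
  have : toC (a • f) = (a : ℂ) • toC f := by
    rw [map_smul]
    apply Lp.ext
    filter_upwards [Lp.coeFn_smul a (toC f), Lp.coeFn_smul (a : ℂ) (toC f)] with x h1 h2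
    rw [h1, h2]; simp
  rw [hat, this, FourierTransform.fourier_smul]; rfl

lemma reL_fourierInv_hat {n : ℕ} (f : L2 n) : reL (𝓕⁻ (hat f)) = f := by
  rw [hat, FourierTransform.fourierInv_fourier_eq, reL_toC]

lemma hat_injective {n : ℕ} : Function.Injective (hat : L2 n → L2C n) := fun f g h => by
  rw [← reL_fourierInv_hat f, h, reL_fourierInv_hat]

/-- The symbol `2πi ξᵢ` of `∂ᵢ`. -/
def sym {n : ℕ} (i : Fin n) (ξ : RN n) : ℂ := 2 * Real.pi * Complex.I * (ξ i : ℂ)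

lemma continuous_sym {n : ℕ} (i : Fin n) : Continuous (sym i : RN n → ℂ) := by
  unfold sym; fun_prop

/-- The transform of the tempered distribution `z` is defined by duality, and it agrees with the
`L²` transform; evaluating it at `𝓕⁻ φ` gives the formula. -/
lemma integral_schwartz_mul {n : ℕ} (φ : 𝓢(RN n, ℂ)) (z : L2C n) :
    ∫ x, φ x * z x = ∫ ξ, (𝓕⁻ φ) ξ * (𝓕 z : L2C n) ξ := by
  have h := congrArg (fun T => T (𝓕⁻ φ)) (Lp.fourier_toTemperedDistribution_eq z)
  simp only [TemperedDistribution.fourier_apply, FourierTransform.fourier_fourierInv_eq,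
    Lp.toTemperedDistribution_apply, smul_eq_mul] at h
  exact h

lemma fourierInv_lineDeriv {n : ℕ} (φ : 𝓢(RN n, ℂ)) (i : Fin n) (ξ : RN n) :
    (𝓕⁻ (∂_{EuclideanSpace.single i (1 : ℝ)} φ)) ξ = -(sym i ξ * (𝓕⁻ φ) ξ) := by
  rw [SchwartzMap.fourierInv_lineDerivOp_eq]
  have : Function.HasTemperateGrowth
      fun x : RN n => inner ℝ x (EuclideanSpace.single i (1 : ℝ)) := by fun_prop
  rw [smul_apply, SchwartzMap.smulLeftCLM_apply_apply this]
  simp [sym, EuclideanSpace.inner_single_right]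
  ring

lemma integrable_schwartz_mul {n : ℕ} (φ : 𝓢(RN n, ℂ)) (z : L2C n) :
    Integrable fun x => φ x * z x :=
  (φ.memLp 2 volume).integrable_mul (Lp.memLp z)

lemma integrable_sym_schwartz_mul {n : ℕ} (φ : 𝓢(RN n, ℂ)) (z : L2C n) (i : Fin n) :
    Integrable fun ξ => (𝓕⁻ φ) ξ * (sym i ξ * z ξ) := by
  refine (integrable_schwartz_mul (𝓕⁻ (∂_{EuclideanSpace.single i (1 : ℝ)} φ)) z).neg.congr ?_
  filter_upwards with ξ
  simp only [Pi.neg_apply, fourierInv_lineDeriv]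
  ring

lemma integral_lineDeriv_mul {n : ℕ} (φ : 𝓢(RN n, ℂ)) (z : L2C n) (i : Fin n) :
    ∫ x, (∂_{EuclideanSpace.single i (1 : ℝ)} φ) x * z x =
      -∫ ξ, (𝓕⁻ φ) ξ * (sym i ξ * (𝓕 z : L2C n) ξ) := by
  rw [integral_schwartz_mul, ← integral_neg]
  congr 1 with ξ
  rw [fourierInv_lineDeriv]
  ring

lemma locallyIntegrable_lp {n : ℕ} {E : Type*} [NormedAddCommGroup E]
    (f : Lp E 2 (volume : Measure (RN n))) : LocallyIntegrable f volume :=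
  (Lp.memLp f).locallyIntegrable (by norm_num)

/-- The divergence relation tested with Schwartz functions, on the Fourier side. -/
lemma fourier_eq_of_forall_schwartz {n : ℕ} {q : Fin n → L2C n} {h : L2C n}
    (H : ∀ φ : 𝓢(RN n, ℂ), ∑ i, ∫ x, (∂_{EuclideanSpace.single i (1 : ℝ)} φ) x * q i x =
      -∫ x, φ x * h x) :
    (𝓕 h : L2C n) =ᵐ[volume] fun ξ => ∑ i, sym i ξ * (𝓕 (q i) : L2C n) ξ := by
  have li : ∀ i, LocallyIntegrable (fun ξ => sym i ξ * (𝓕 (q i) : L2C n) ξ) volume := fun i => by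
    simpa only [smul_eq_mul] using
      (locallyIntegrable_lp (𝓕 (q i) : L2C n)).continuous_smul (continuous_sym i)
  refine ae_eq_of_integral_contDiff_smul_eq (locallyIntegrable_lp _)
    (locallyIntegrable_finsetSum _ fun i _ => li i) fun g hg hc => ?_
  have hgC : ContDiff ℝ ∞ (fun x => (g x : ℂ)) := Complex.ofRealCLM.contDiff.comp hg
  have hcC : HasCompactSupport (fun x => (g x : ℂ)) := hc.comp_left Complex.ofReal_zero
  let G : 𝓢(RN n, ℂ) := hcC.toSchwartzMap hgC
  have e : 𝓕⁻ (𝓕 G) = G := FourierTransform.fourierInv_fourier_eq G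
  -- Testing with `𝓕 G` puts `𝓕⁻ (𝓕 G) = G` on the frequency side, an arbitrary compactly supported
  -- test function.
  have := H (𝓕 G)
  simp_rw [integral_lineDeriv_mul] at this
  rw [integral_schwartz_mul, Finset.sum_neg_distrib, neg_inj, ← integral_finsetSum _
    (fun i _ => integrable_sym_schwartz_mul _ _ i), e] at this
  have eg : ∀ x, G x = (g x : ℂ) := fun x => rfl
  simp only [eg, ← Finset.mul_sum] at this
  simpa only [Complex.real_smul] using this.symm

lemma sum_integral_of_fourier_eq {n : ℕ} {q : Fin n → L2C n} {h : L2C n}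
    (H : (𝓕 h : L2C n) =ᵐ[volume] fun ξ => ∑ i, sym i ξ * (𝓕 (q i) : L2C n) ξ)
    (φ : 𝓢(RN n, ℂ)) :
    ∑ i, ∫ x, (∂_{EuclideanSpace.single i (1 : ℝ)} φ) x * q i x = -∫ x, φ x * h x := by
  simp_rw [integral_lineDeriv_mul]
  rw [integral_schwartz_mul, Finset.sum_neg_distrib, neg_inj, ← integral_finsetSum _
    (fun i _ => integrable_sym_schwartz_mul _ _ i)]
  refine integral_congr_ae ?_
  filter_upwards [H] with ξ hξ
  rw [hξ, Finset.mul_sum]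

lemma exists_cutoff (n : ℕ) : ∃ χ : RN n → ℝ, ContDiff ℝ ∞ χ ∧ HasCompactSupport χ ∧
    (∀ x, |χ x| ≤ 1) ∧ (∀ x, ‖x‖ ≤ 1 → χ x = 1) ∧ ∃ C, ∀ x i, |partialD i χ x| ≤ C := by
  let B : ContDiffBump (0 : RN n) := ⟨1, 2, one_pos, one_lt_two⟩
  refine ⟨B, B.contDiff, B.hasCompactSupport, fun x => ?_, fun x hx => ?_, ?_⟩
  · rw [abs_of_nonneg B.nonneg]; exact B.le_one
  · exact B.one_of_mem_closedBall (by simpa using hx)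
  · have h : ∀ i, ∃ C, ∀ x, |partialD i B x| ≤ C := fun i =>
      (continuous_partialD i B.contDiff).bounded_above_of_compact_support
        (hasCompactSupport_partialD i B.hasCompactSupport)
    choose C hC using h
    exact ⟨∑ i, |C i|, fun x i => ((hC i x).trans (le_abs_self _)).trans
      (Finset.single_le_sum (f := fun i => |C i|) (fun _ _ => abs_nonneg _) (Finset.mem_univ i))⟩

lemma partialD_mul {n : ℕ} (i : Fin n) {a c : RN n → ℝ} {x : RN n}
    (ha : DifferentiableAt ℝ a x) (hc : DifferentiableAt ℝ c x) :
    partialD i (fun y => a y * c y) x = a x * partialD i c x + c x * partialD i a x := by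
  simp only [partialD]
  rw [fderiv_fun_mul ha hc]
  simp

lemma partialD_comp_smul {n : ℕ} (i : Fin n) {χ : RN n → ℝ} (hχ : Differentiable ℝ χ) (r : ℝ)
    (x : RN n) : partialD i (fun y => χ (r • y)) x = r * partialD i χ (r • x) := by
  simp only [partialD]
  have h : HasFDerivAt (fun y : RN n => χ (r • y))
      ((fderiv ℝ χ (r • x)).comp (r • ContinuousLinearMap.id ℝ (RN n))) x :=
    (hχ (r • x)).hasFDerivAt.comp x ((hasFDerivAt_id x).const_smul r)
  rw [h.fderiv]
  simp

/-- The weak divergence relation of `L²` functions extends to test functions which are smooth and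
belong to `H¹`. -/
lemma HasWeakDiv.integral_eq {n : ℕ} {q : Fin n → L2 n} {h : L2 n}
    (H : HasWeakDiv (fun i => q i) h) {a : RN n → ℝ} (ha : ContDiff ℝ ∞ a) (ha2 : MemLp a 2 volume)
    (hd2 : ∀ i, MemLp (partialD i a) 2 volume) :
    ∑ i, ∫ x, q i x * partialD i a x = -∫ x, h x * a x := by
  obtain ⟨χ, χs, χc, χ1, χe, C, hC⟩ := exists_cutoff n
  -- The test functions are `χ(r_k x) a(x)` with `r_k → 0`. The derivative falling on the cutoff
  -- carries a factor `r_k` and disappears in the limit; `r_k ≤ 1` makes the dominating function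
  -- independent of `k`.
  set r : ℕ → ℝ := fun k => ((k : ℝ) + 1)⁻¹ with hr
  have r0 : ∀ k, 0 < r k := fun k => by positivity
  have r1 : ∀ k, r k ≤ 1 := fun k => inv_le_one_of_one_le₀ (by simp)
  have rt : Tendsto r atTop (𝓝 0) := tendsto_inv_atTop_zero.comp
    (tendsto_natCast_atTop_atTop.atTop_add tendsto_const_nhds)
  have χd := χs.differentiable (by simp)
  have ad := ha.differentiable (by simp)
  have χk : ∀ k, ContDiff ℝ ∞ fun x => χ (r k • x) := fun k =>
    χs.comp (contDiff_const_smul (r k))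
  have ev : ∀ x : RN n, ∀ᶠ k in atTop, χ (r k • x) = 1 := fun x => by
    have : Tendsto (fun k => ‖r k • x‖) atTop (𝓝 0) := by
      simpa using (rt.smul_const x).norm
    filter_upwards [this.eventually (ge_mem_nhds (zero_lt_one))] with k hk using χe _ hk
  have key : ∀ k, ∫ x, ∑ i, q i x * partialD i (fun y => χ (r k • y) * a y) x =
      -∫ x, h x * (χ (r k • x) * a x) := fun k => by
    refine H.2.2 _ ((χk k).mul ha) ?_
    exact HasCompactSupport.mul_right
      (χc.comp_homeomorph (Homeomorph.smulOfNeZero (r k) (r0 k).ne'))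
  have hpd : ∀ k i x, partialD i (fun y => χ (r k • y) * a y) x =
      χ (r k • x) * partialD i a x + a x * (r k * partialD i χ (r k • x)) := fun k i x => by
    rw [partialD_mul i ((χk k).differentiable (by simp) x) (ad x), partialD_comp_smul i χd]
  have cd : ∀ i, Continuous (partialD i a) := fun i => continuous_partialD i ha
  have cχ : ∀ i, Continuous (partialD i χ) := fun i => continuous_partialD i χs
  have hqm : ∀ i, AEStronglyMeasurable (q i) volume := fun i => Lp.aestronglyMeasurable _
  have t1 : Tendsto (fun k => ∫ x, ∑ i, q i x * partialD i (fun y => χ (r k • y) * a y) x) atTop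
      (𝓝 (∫ x, ∑ i, q i x * partialD i a x)) := by
    refine tendsto_integral_of_dominated_convergence
      (fun x => ∑ i, |q i x| * (|partialD i a x| + |C| * |a x|)) (fun k => ?_) ?_ (fun k => ?_) ?_
    · refine Finset.aestronglyMeasurable_fun_sum _ fun i _ => (hqm i).mul ?_
      exact (continuous_partialD i ((χk k).mul ha)).aestronglyMeasurable
    · refine integrable_finsetSum _ fun i _ => ?_
      exact (Lp.memLp (q i)).abs.integrable_mul ((hd2 i).abs.add (ha2.abs.const_mul |C|))
    · filter_upwards with x
      refine (norm_sum_le _ _).trans (Finset.sum_le_sum fun i _ => ?_)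
      rw [norm_mul, Real.norm_eq_abs, hpd]
      refine mul_le_mul_of_nonneg_left ((abs_add_le _ _).trans (add_le_add ?_ ?_)) (abs_nonneg _)
      · rw [abs_mul]
        exact mul_le_of_le_one_left (abs_nonneg _) (χ1 _)
      · rw [abs_mul, abs_mul, mul_comm]
        refine mul_le_mul_of_nonneg_right ?_ (abs_nonneg _)
        rw [abs_of_pos (r0 k)]
        exact (mul_le_of_le_one_left (abs_nonneg _) (r1 k)).trans ((hC _ i).trans (le_abs_self _))
    · filter_upwards with x
      refine tendsto_finsetSum _ fun i _ => tendsto_const_nhds.mul ?_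
      simp only [hpd]
      have e1 : Tendsto (fun k => χ (r k • x) * partialD i a x) atTop (𝓝 (1 * partialD i a x)) :=
        (tendsto_const_nhds.congr' ((ev x).mono fun k hk => hk.symm)).mul_const _
      have e2 : Tendsto (fun k => r k * partialD i χ (r k • x)) atTop
          (𝓝 (0 * partialD i χ ((0 : ℝ) • x))) :=
        rt.mul (((cχ i).tendsto _).comp (rt.smul_const x))
      simpa using e1.add (e2.const_mul (a x))
  have t2 : Tendsto (fun k => -∫ x, h x * (χ (r k • x) * a x)) atTop (𝓝 (-∫ x, h x * a x)) := by
    refine (tendsto_integral_of_dominated_convergence (fun x => |h x| * |a x|) (fun k => ?_) ?_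
      (fun k => ?_) ?_).neg
    · exact (Lp.aestronglyMeasurable h).mul ((χk k).mul ha).continuous.aestronglyMeasurable
    · exact (Lp.memLp h).abs.integrable_mul ha2.abs
    · filter_upwards with x
      rw [norm_mul, norm_mul, Real.norm_eq_abs, Real.norm_eq_abs, Real.norm_eq_abs]
      exact mul_le_mul_of_nonneg_left (mul_le_of_le_one_left (abs_nonneg _) (χ1 _)) (abs_nonneg _)
    · filter_upwards with x
      have e1 : Tendsto (fun k => χ (r k • x) * a x) atTop (𝓝 (1 * a x)) :=
        (tendsto_const_nhds.congr' ((ev x).mono fun k hk => hk.symm)).mul_const _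
      simpa using e1.const_mul (h x)
  have hInt : ∀ i, Integrable fun x => q i x * partialD i a x := fun i =>
    (Lp.memLp (q i)).integrable_mul (hd2 i)
  rw [← integral_finsetSum _ fun i _ => hInt i]
  refine tendsto_nhds_unique t1 ?_
  simpa only [key] using t2

lemma partialD_re {n : ℕ} (φ : 𝓢(RN n, ℂ)) (i : Fin n) (x : RN n) :
    partialD i (fun y => (φ y).re) x = ((∂_{EuclideanSpace.single i (1 : ℝ)} φ) x).re := by
  rw [SchwartzMap.lineDerivOp_apply_eq_fderiv, partialD]
  have : HasFDerivAt (fun y => (φ y).re) (Complex.reCLM.comp (fderiv ℝ φ x)) x :=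
    Complex.reCLM.hasFDerivAt.comp x (φ.hasFDerivAt x)
  rw [this.fderiv]; rfl

lemma partialD_im {n : ℕ} (φ : 𝓢(RN n, ℂ)) (i : Fin n) (x : RN n) :
    partialD i (fun y => (φ y).im) x = ((∂_{EuclideanSpace.single i (1 : ℝ)} φ) x).im := by
  rw [SchwartzMap.lineDerivOp_apply_eq_fderiv, partialD]
  have : HasFDerivAt (fun y => (φ y).im) (Complex.imCLM.comp (fderiv ℝ φ x)) x :=
    Complex.imCLM.hasFDerivAt.comp x (φ.hasFDerivAt x)
  rw [this.fderiv]; rfl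

lemma integral_mul_toC {n : ℕ} (φ : 𝓢(RN n, ℂ)) (f : L2 n) :
    ∫ x, φ x * toC f x =
      ((∫ x, f x * (φ x).re : ℝ) : ℂ) + ((∫ x, f x * (φ x).im : ℝ) : ℂ) * Complex.I := by
  have i1 : Integrable fun x => f x * (φ x).re := (Lp.memLp f).integrable_mul (φ.memLp 2).re
  have i2 : Integrable fun x => f x * (φ x).im := (Lp.memLp f).integrable_mul (φ.memLp 2).im
  rw [← integral_complex_ofReal, ← integral_complex_ofReal, ← integral_mul_const,
    ← integral_add i1.ofReal (i2.ofReal.mul_const _)]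
  refine integral_congr_ae ?_
  filter_upwards [coeFn_toC f] with x hx
  rw [hx]
  apply Complex.ext <;> simp <;> ring

/-- The weak divergence on the Fourier side. -/
lemma HasWeakDiv.hat_eq {n : ℕ} {q : Fin n → L2 n} {h : L2 n}
    (H : HasWeakDiv (fun i => q i) h) :
    hat h =ᵐ[volume] fun ξ => ∑ i, sym i ξ * hat (q i) ξ := by
  refine fourier_eq_of_forall_schwartz (q := fun i => toC (q i)) fun φ => ?_
  simp_rw [integral_mul_toC]
  have h1 := H.integral_eq (a := fun x => (φ x).re) (Complex.reCLM.contDiff.comp φ.smooth')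
    (φ.memLp 2).re (fun i => by
      rw [funext (partialD_re φ i)]
      exact (SchwartzMap.memLp (∂_{EuclideanSpace.single i (1 : ℝ)} φ) 2 volume).re)
  have h2 := H.integral_eq (a := fun x => (φ x).im) (Complex.imCLM.contDiff.comp φ.smooth')
    (φ.memLp 2).im (fun i => by
      rw [funext (partialD_im φ i)]
      exact (SchwartzMap.memLp (∂_{EuclideanSpace.single i (1 : ℝ)} φ) 2 volume).im)
  simp only [partialD_re] at h1
  simp only [partialD_im] at h2
  rw [Finset.sum_add_distrib, ← Finset.sum_mul, ← Complex.ofReal_sum, ← Complex.ofReal_sum, h1, h2]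
  push_cast
  ring

/-- A complex divergence relation on the Fourier side gives a real weak divergence. -/
lemma hasWeakDiv_reL {n : ℕ} {q : Fin n → L2C n} {h : L2C n}
    (H : (𝓕 h : L2C n) =ᵐ[volume] fun ξ => ∑ i, sym i ξ * (𝓕 (q i) : L2C n) ξ) :
    HasWeakDiv (fun i => reL (q i)) (reL h) := by
  refine ⟨fun i => locallyIntegrable_lp _, locallyIntegrable_lp _, fun g hg hc => ?_⟩
  have hgC : ContDiff ℝ ∞ (fun x => (g x : ℂ)) := Complex.ofRealCLM.contDiff.comp hg
  have hcC : HasCompactSupport (fun x => (g x : ℂ)) := hc.comp_left Complex.ofReal_zero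
  let G : 𝓢(RN n, ℂ) := hcC.toSchwartzMap hgC
  have eg : ∀ x, G x = (g x : ℂ) := fun x => rfl
  have ed : ∀ i x, (∂_{EuclideanSpace.single i (1 : ℝ)} G) x = (partialD i g x : ℂ) := fun i x => by
    rw [SchwartzMap.lineDerivOp_apply_eq_fderiv, partialD]
    have : HasFDerivAt G (Complex.ofRealCLM.comp (fderiv ℝ g x)) x :=
      Complex.ofRealCLM.hasFDerivAt.comp x (hg.differentiable (by simp) x).hasFDerivAt
    rw [this.fderiv]; rfl
  have key := congrArg Complex.re (sum_integral_of_fourier_eq H G)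
  -- The test function is real, so taking real parts commutes with the pairing.
  have re_int : ∀ (φ : 𝓢(RN n, ℂ)) (a : RN n → ℝ) (z : L2C n), (∀ x, φ x = (a x : ℂ)) →
      (∫ x, φ x * z x).re = ∫ x, reL z x * a x := fun φ a z e => by
    rw [← RCLike.re_eq_complex_re, ← integral_re (integrable_schwartz_mul φ z)]
    refine integral_congr_ae ?_
    filter_upwards [coeFn_reL z] with x hx
    rw [hx, e]
    simp [mul_comm]
  rw [Complex.re_sum, Complex.neg_re, re_int G g h eg] at key
  rw [integral_finsetSum _ fun i _ => integrable_mul_test (locallyIntegrable_lp _)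
    (continuous_partialD i hg) (hasCompactSupport_partialD i hc), ← key]
  exact Finset.sum_congr rfl fun i _ => (re_int _ _ _ (ed i)).symm

/-- A partial derivative is the divergence of a field with one nonzero component, so the Fourier
description needs a proof only for divergences. -/
lemma hasWeakDiv_single_iff {n : ℕ} (i : Fin n) (f h : L2 n) :
    HasWeakDiv (fun j => (Pi.single i f : Fin n → L2 n) j) h ↔ HasWeakPartial i f h := by
  have e : ∀ φ : RN n → ℝ, ∫ x, ∑ j, (Pi.single i f : Fin n → L2 n) j x * partialD j φ x =
      ∫ x, f x * partialD i φ x := fun φ => by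
    refine integral_congr_ae ?_
    filter_upwards [Lp.coeFn_zero ℝ 2 (volume : Measure (RN n))] with x hx
    rw [Finset.sum_eq_single i]
    · simp
    · intro j _ hj
      rw [Pi.single_eq_of_ne hj, hx]; simp
    · simp
  constructor
  · exact fun H => ⟨locallyIntegrable_lp _, locallyIntegrable_lp _, fun φ h1 h2 => by
      rw [← e, H.2.2 φ h1 h2]⟩
  · exact fun H => ⟨fun _ => locallyIntegrable_lp _, locallyIntegrable_lp _, fun φ h1 h2 => by
      rw [e, H.2.2 φ h1 h2]⟩

/-- The weak partial derivative on the Fourier side. -/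
lemma HasWeakPartial.hat_eq {n : ℕ} {i : Fin n} {f h : L2 n} (H : HasWeakPartial i f h) :
    hat h =ᵐ[volume] fun ξ => sym i ξ * hat f ξ := by
  have h0 : hat (0 : L2 n) =ᵐ[volume] 0 := by
    rw [← zero_smul ℝ (0 : L2 n), hat_smul, Complex.ofReal_zero, zero_smul]
    exact Lp.coeFn_zero ℂ 2 volume
  filter_upwards [((hasWeakDiv_single_iff i f h).2 H).hat_eq, h0] with ξ hξ h0
  rw [hξ, Finset.sum_eq_single i]
  · simp
  · intro j _ hj
    rw [Pi.single_eq_of_ne hj, h0]; simp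
  · simp

/-- A complex derivative on the Fourier side gives a real weak derivative. -/
lemma hasWeakPartial_reL {n : ℕ} {i : Fin n} {f h : L2C n}
    (H : (𝓕 h : L2C n) =ᵐ[volume] fun ξ => sym i ξ * (𝓕 f : L2C n) ξ) :
    HasWeakPartial i (reL f) (reL h) := by
  rw [← hasWeakDiv_single_iff]
  have h0 : (𝓕 (0 : L2C n) : L2C n) =ᵐ[volume] 0 := by
    rw [← zero_smul ℂ (0 : L2C n), FourierTransform.fourier_smul, zero_smul]
    exact Lp.coeFn_zero ℂ 2 volume
  have := hasWeakDiv_reL (q := Pi.single i f) (h := h) (by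
    filter_upwards [H, h0] with ξ hξ h0
    rw [hξ, Finset.sum_eq_single i]
    · simp
    · intro j _ hj
      rw [Pi.single_eq_of_ne hj, h0]; simp
    · simp)
  convert! this using 3 with j
  by_cases hj : j = i
  · subst hj; simp
  · simp [Pi.single_eq_of_ne hj]

/-! ### The Sobolev spaces on the Fourier side -/

lemma Lp.norm_sq_eq_integral {α E : Type*} [MeasurableSpace α] {μ : Measure α}
    [NormedAddCommGroup E] (f : Lp E 2 μ) : ‖f‖ ^ 2 = ∫ x, ‖f x‖ ^ 2 ∂μ := by
  rw [Lp.norm_def, (Lp.memLp f).eLpNorm_eq_integral_rpow_norm two_ne_zero ENNReal.ofNat_ne_top,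
    ENNReal.toReal_ofReal (by positivity), ← Real.rpow_natCast, ← Real.rpow_mul (by positivity)]
  simp

lemma Lp.integrable_norm_sq {α E : Type*} [MeasurableSpace α] {μ : Measure α}
    [NormedAddCommGroup E] (f : Lp E 2 μ) : Integrable (fun x => ‖f x‖ ^ 2) μ :=
  (Lp.memLp f).integrable_norm_pow two_ne_zero

/-- The symbol of an iterated partial derivative. -/
def msym {n κ : ℕ} (α : Fin κ → Fin n) (ξ : RN n) : ℂ := ∏ j, sym (α j) ξ

lemma continuous_msym {n κ : ℕ} (α : Fin κ → Fin n) : Continuous (msym α) :=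
  continuous_finsetProd _ fun j _ => continuous_sym (α j)

lemma msym_cons {n κ : ℕ} (i : Fin n) (α : Fin κ → Fin n) (ξ : RN n) :
    msym (Fin.cons i α : Fin (κ + 1) → Fin n) ξ = sym i ξ * msym α ξ := by
  simp [msym, Fin.prod_univ_succ]

lemma norm_sym_sq {n : ℕ} (i : Fin n) (ξ : RN n) :
    ‖sym i ξ‖ ^ 2 = 4 * Real.pi ^ 2 * (ξ i) ^ 2 := by
  simp only [sym, norm_mul, Complex.norm_I, Complex.norm_real, mul_one, mul_pow, Real.norm_eq_abs,
    sq_abs, Complex.norm_ofNat]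
  norm_num

/-- `|2πξ|²`, the negative of the symbol of the Laplacian. -/
def lap {n : ℕ} (ξ : RN n) : ℝ := 4 * Real.pi ^ 2 * ‖ξ‖ ^ 2

lemma lap_nonneg {n : ℕ} (ξ : RN n) : 0 ≤ lap ξ := by unfold lap; positivity

lemma continuous_lap {n : ℕ} : Continuous (lap : RN n → ℝ) := by unfold lap; fun_prop

lemma sum_norm_sym_sq {n : ℕ} (ξ : RN n) : ∑ i, ‖sym i ξ‖ ^ 2 = lap ξ := by
  simp_rw [norm_sym_sq, lap, EuclideanSpace.norm_sq_eq, Finset.mul_sum, Real.norm_eq_abs, sq_abs]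

lemma sum_sym_sq {n : ℕ} (ξ : RN n) : ∑ i, sym i ξ * sym i ξ = -(lap ξ : ℂ) := by
  simp_rw [lap, EuclideanSpace.norm_sq_eq, Finset.mul_sum, Real.norm_eq_abs, sq_abs]
  push_cast
  rw [← Finset.sum_neg_distrib]
  refine Finset.sum_congr rfl fun i _ => ?_
  simp only [sym]
  linear_combination (4 * (Real.pi : ℂ) ^ 2 * (ξ i : ℂ) ^ 2) * Complex.I_sq

/-- The weight of the `H^s` norm on the Fourier side. -/
def weight {n : ℕ} (s : ℕ) (ξ : RN n) : ℝ := ∑ κ : Fin (s + 1), lap ξ ^ (κ : ℕ)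

lemma continuous_weight {n : ℕ} (s : ℕ) : Continuous (weight s : RN n → ℝ) :=
  continuous_finsetSum _ fun κ _ => continuous_lap.pow κ

lemma one_le_weight {n : ℕ} (s : ℕ) (ξ : RN n) : 1 ≤ weight s ξ := by
  rw [weight, Fin.sum_univ_succ]
  simp only [Fin.val_zero, pow_zero]
  linarith [Finset.sum_nonneg (s := Finset.univ) fun (i : Fin s) _ =>
    pow_nonneg (lap_nonneg ξ) (i.succ : ℕ)]

lemma weight_pos {n : ℕ} (s : ℕ) (ξ : RN n) : 0 < weight s ξ :=
  one_pos.trans_le (one_le_weight s ξ)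

lemma weight_succ {n : ℕ} (s : ℕ) (ξ : RN n) : weight (s + 1) ξ = 1 + lap ξ * weight s ξ := by
  rw [weight, Fin.sum_univ_succ, weight, Finset.mul_sum]
  simp [pow_succ']

lemma sum_norm_msym_sq {n s : ℕ} (ξ : RN n) :
    ∑ p : DIdx n s, ‖msym p.2 ξ‖ ^ 2 = weight s ξ := by
  rw [Fintype.sum_sigma, weight]
  refine Finset.sum_congr rfl fun κ _ => ?_
  rw [← sum_norm_sym_sq, Fintype.sum_pow]
  refine Finset.sum_congr rfl fun α _ => ?_
  rw [msym, norm_prod, Finset.prod_pow]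

/-- Induction on the order, peeling off the outermost derivative `α 0`, which is the one that the
weak derivative relations of `sobSubmodule` prepend. -/
lemma hat_coord_aux {n s : ℕ} (u : Sob n s) : ∀ (κ : ℕ) (hκ : κ < s + 1) (α : Fin κ → Fin n),
    hat (u.1 ⟨⟨κ, hκ⟩, α⟩) =ᵐ[volume] fun ξ => msym α ξ * hat u.fn ξ := by
  intro κ
  induction κ with
  | zero =>
    intro hκ α
    have : α = Fin.elim0 := Subsingleton.elim _ _
    subst this
    filter_upwards with ξ
    simp [msym, Sob.fn]
  | succ κ ih =>
    intro hκ α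
    have h := u.2 κ (by omega) (Fin.tail α) (α 0)
    rw [Fin.cons_self_tail] at h
    filter_upwards [h.hat_eq, ih (by omega) (Fin.tail α)] with ξ h1 h2
    rw [h1, h2, ← mul_assoc, ← msym_cons, Fin.cons_self_tail]

lemma Sob.hat_coord {n s : ℕ} (u : Sob n s) (p : DIdx n s) :
    hat (u.1 p) =ᵐ[volume] fun ξ => msym p.2 ξ * hat u.fn ξ :=
  hat_coord_aux u p.1 p.1.2 p.2

lemma Sob.ext_coord {n s : ℕ} {u v : Sob n s} (h : ∀ p, u.1 p = v.1 p) : u = v :=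
  Subtype.ext (PiLp.ext h)

/-- Every coordinate has transform `msym p.2` times the transform of the function, so the function
determines the whole family. -/
lemma Sob.ext_fn {n s : ℕ} {u v : Sob n s} (h : u.fn = v.fn) : u = v :=
  Sob.ext_coord fun p => hat_injective <| Lp.ext <| by
    filter_upwards [u.hat_coord p, v.hat_coord p] with ξ h1 h2
    rw [h1, h2, h]

lemma Sob.norm_sq_eq_sum {n s : ℕ} (u : Sob n s) : ‖u‖ ^ 2 = ∑ p, ‖u.1 p‖ ^ 2 :=
  PiLp.norm_sq_eq_of_L2 _ u.1

lemma Sob.norm_coord_sq {n s : ℕ} (u : Sob n s) (p : DIdx n s) :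
    ‖u.1 p‖ ^ 2 = ∫ ξ, ‖msym p.2 ξ‖ ^ 2 * ‖hat u.fn ξ‖ ^ 2 := by
  rw [← norm_hat, Lp.norm_sq_eq_integral]
  refine integral_congr_ae ?_
  filter_upwards [u.hat_coord p] with ξ h
  rw [h, norm_mul, mul_pow]

lemma Sob.integrable_coord {n s : ℕ} (u : Sob n s) (p : DIdx n s) :
    Integrable fun ξ => ‖msym p.2 ξ‖ ^ 2 * ‖hat u.fn ξ‖ ^ 2 := by
  refine (Lp.integrable_norm_sq (hat (u.1 p))).congr ?_
  filter_upwards [u.hat_coord p] with ξ h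
  rw [h, norm_mul, mul_pow]

lemma Sob.integrable_weight {n s : ℕ} (u : Sob n s) :
    Integrable fun ξ => weight s ξ * ‖hat u.fn ξ‖ ^ 2 := by
  simp_rw [← sum_norm_msym_sq, Finset.sum_mul]
  exact integrable_finsetSum _ fun p _ => u.integrable_coord p

/-- Plancherel's formula for the `H^s` norm. -/
lemma Sob.norm_sq_eq {n s : ℕ} (u : Sob n s) :
    ‖u‖ ^ 2 = ∫ ξ, weight s ξ * ‖hat u.fn ξ‖ ^ 2 := by
  simp_rw [← sum_norm_msym_sq, Finset.sum_mul]
  rw [integral_finsetSum _ fun p _ => u.integrable_coord p, u.norm_sq_eq_sum]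
  exact Finset.sum_congr rfl fun p _ => u.norm_coord_sq p

lemma memLp_mul_of_integrable {n : ℕ} {a : RN n → ℂ} (ha : Continuous a) {W : RN n → ℝ} {z : L2C n}
    (hW : ∀ ξ, ‖a ξ‖ ^ 2 ≤ W ξ) (hz : Integrable fun ξ => W ξ * ‖z ξ‖ ^ 2) :
    MemLp (fun ξ => a ξ * z ξ) 2 volume := by
  have hm : AEStronglyMeasurable (fun ξ => a ξ * z ξ) volume :=
    ha.aestronglyMeasurable.mul (Lp.aestronglyMeasurable z)
  rw [memLp_two_iff_integrable_sq_norm hm]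
  refine hz.mono' (hm.norm.pow 2) ?_
  filter_upwards with ξ
  rw [Real.norm_of_nonneg (by positivity), norm_mul, mul_pow]
  exact mul_le_mul_of_nonneg_right (hW ξ) (by positivity)

/-- A weighted `L²` function on the Fourier side defines an element of `H^s`. -/
lemma exists_sob {n s : ℕ} (z : L2C n) (hz : Integrable fun ξ => weight s ξ * ‖z ξ‖ ^ 2) :
    ∃ u : Sob n s, (∀ (p : DIdx n s) (m : L2C n), (m =ᵐ[volume] fun ξ => msym p.2 ξ * z ξ) →
      u.1 p = reL (𝓕⁻ m)) ∧ ‖u‖ ^ 2 ≤ ∫ ξ, weight s ξ * ‖z ξ‖ ^ 2 := by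
  have hle : ∀ (p : DIdx n s) ξ, ‖msym p.2 ξ‖ ^ 2 ≤ weight s ξ := fun p ξ => by
    rw [← sum_norm_msym_sq]
    exact Finset.single_le_sum (f := fun p : DIdx n s => ‖msym p.2 ξ‖ ^ 2)
      (fun _ _ => by positivity) (Finset.mem_univ p)
  have hm : ∀ p : DIdx n s, MemLp (fun ξ => msym p.2 ξ * z ξ) 2 volume := fun p =>
    memLp_mul_of_integrable (continuous_msym p.2) (hle p) hz
  -- `z` is not assumed Hermitian symmetric, so its inverse transform may be complex. Taking real
  -- parts preserves the derivative relations and does not increase norms, hence only an inequality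
  -- for `‖u‖`.
  let U : PiLp 2 (fun _ : DIdx n s => L2 n) := WithLp.toLp 2 fun p => reL (𝓕⁻ ((hm p).toLp))
  have hU : U ∈ sobSubmodule n s := by
    intro κ hκ α i
    refine hasWeakPartial_reL ?_
    rw [FourierTransform.fourier_fourierInv_eq, FourierTransform.fourier_fourierInv_eq]
    filter_upwards [(hm ⟨⟨κ, by omega⟩, α⟩).coeFn_toLp,
      (hm ⟨⟨κ + 1, by omega⟩, Fin.cons i α⟩).coeFn_toLp] with ξ h1 h2
    rw [h1, h2, msym_cons, mul_assoc]
  let u : Sob n s := ⟨U, hU⟩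
  refine ⟨u, fun p m h => ?_, ?_⟩
  · change reL (𝓕⁻ ((hm p).toLp)) = _
    congr 2
    exact Lp.ext ((hm p).coeFn_toLp.trans h.symm)
  · rw [Sob.norm_sq_eq_sum]
    have e : ∀ p, ‖(hm p).toLp‖ ^ 2 = ∫ ξ, ‖msym p.2 ξ‖ ^ 2 * ‖z ξ‖ ^ 2 := fun p => by
      rw [Lp.norm_sq_eq_integral]
      refine integral_congr_ae ?_
      filter_upwards [(hm p).coeFn_toLp] with ξ h
      rw [h, norm_mul, mul_pow]
    have i : ∀ p : DIdx n s, Integrable fun ξ => ‖msym p.2 ξ‖ ^ 2 * ‖z ξ‖ ^ 2 := fun p => by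
      simpa only [norm_mul, mul_pow] using (hm p).integrable_norm_pow two_ne_zero
    simp_rw [← sum_norm_msym_sq, Finset.sum_mul]
    rw [integral_finsetSum _ fun p _ => i p]
    refine Finset.sum_le_sum fun p _ => ?_
    rw [← e]
    have : ‖reL (𝓕⁻ ((hm p).toLp))‖ ≤ ‖(hm p).toLp‖ := by
      refine (norm_reL_le _).trans ?_
      exact ((Lp.fourierTransformₗᵢ (RN n) ℂ).symm.norm_map _).le
    change ‖reL (𝓕⁻ ((hm p).toLp))‖ ^ 2 ≤ _
    gcongr

/-! ### Completeness -/

/-- The integral is the `L²` inner product with `φ`. -/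
lemma continuous_integral_mul {n : ℕ} {φ : RN n → ℝ} (hφ : MemLp φ 2 volume) :
    Continuous fun f : L2 n => ∫ x, f x * φ x := by
  have : (fun f : L2 n => ∫ x, f x * φ x) = fun f => inner ℝ (hφ.toLp φ) f := by
    ext f
    rw [L2.inner_def]
    refine integral_congr_ae ?_
    filter_upwards [hφ.coeFn_toLp] with x hx
    rw [hx]; simp
  rw [this]
  fun_prop

lemma memLp_of_test {n : ℕ} {φ : RN n → ℝ} (h : Continuous φ) (hc : HasCompactSupport φ)
    (p : ℝ≥0∞) : MemLp φ p volume := h.memLp_of_hasCompactSupport hc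

/-- For each fixed test function the defining identity is a closed condition on the pair. This is
what makes `H^s` complete. -/
lemma isClosed_hasWeakPartial {n : ℕ} (i : Fin n) :
    IsClosed {p : L2 n × L2 n | HasWeakPartial i p.1 p.2} := by
  have : {p : L2 n × L2 n | HasWeakPartial i p.1 p.2} =
      ⋂ (φ : RN n → ℝ) (_ : ContDiff ℝ ∞ φ) (_ : HasCompactSupport φ),
        {p | ∫ x, p.1 x * partialD i φ x = -∫ x, p.2 x * φ x} := by
    ext p
    simp only [mem_ofPred_eq, mem_iInter]
    exact ⟨fun H => H.2.2, fun H => ⟨locallyIntegrable_lp _, locallyIntegrable_lp _, H⟩⟩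
  rw [this]
  refine isClosed_iInter fun φ => isClosed_iInter fun hs => isClosed_iInter fun hc => ?_
  refine isClosed_eq ((continuous_integral_mul (memLp_of_test (continuous_partialD i hs)
    (hasCompactSupport_partialD i hc) 2)).comp continuous_fst)
    ((continuous_integral_mul (memLp_of_test hs.continuous hc 2)).comp continuous_snd).neg

lemma isClosed_sobSubmodule (n s : ℕ) : 
    IsClosed (sobSubmodule n s : Set (PiLp 2 (fun _ : DIdx n s => L2 n))) := by
  have : (sobSubmodule n s : Set (PiLp 2 (fun _ : DIdx n s => L2 n))) =
      ⋂ (κ : ℕ) (hκ : κ < s) (α : Fin κ → Fin n) (i : Fin n),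
        {u | HasWeakPartial i (u ⟨⟨κ, by omega⟩, α⟩ : L2 n)
          (u ⟨⟨κ + 1, by omega⟩, Fin.cons i α⟩ : L2 n)} := by
    ext u
    simp only [mem_iInter]
    rfl
  rw [this]
  refine isClosed_iInter fun κ => isClosed_iInter fun hκ => isClosed_iInter fun α =>
    isClosed_iInter fun i => ?_
  exact (isClosed_hasWeakPartial i).preimage
    (f := fun u : PiLp 2 (fun _ : DIdx n s => L2 n) =>
      ((u ⟨⟨κ, by omega⟩, α⟩ : L2 n), (u ⟨⟨κ + 1, by omega⟩, Fin.cons i α⟩ : L2 n)))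
    (by fun_prop)

instance (n s : ℕ) : CompleteSpace (Sob n s) :=
  (isClosed_sobSubmodule n s).completeSpace_coe

/-! ### Restriction, derivatives and the inner product -/

/-- Linear maps of `H^s` into `L²`: the coordinates. -/
def Sob.fnL (n s : ℕ) : Sob n s →L[ℝ] L2 n :=
  LinearMap.mkContinuous ⟨⟨Sob.fn, fun _ _ => rfl⟩, fun _ _ => rfl⟩ 1 fun u => by
    rw [one_mul]
    exact PiLp.norm_apply_le u.1 _

@[simp] lemma Sob.fnL_apply {n s : ℕ} (u : Sob n s) : Sob.fnL n s u = u.fn := rfl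

lemma Sob.fn_add {n s : ℕ} (u v : Sob n s) : (u + v).fn = u.fn + v.fn := rfl

lemma Sob.fn_sub {n s : ℕ} (u v : Sob n s) : (u - v).fn = u.fn - v.fn := rfl

lemma Sob.fn_zero {n s : ℕ} : (0 : Sob n s).fn = 0 := rfl

lemma Sob.norm_fn_le {n s : ℕ} (u : Sob n s) : ‖u.fn‖ ≤ ‖u‖ := PiLp.norm_apply_le u.1 _

lemma Fin.cons_snoc_comm {n κ : ℕ} (j i : Fin n) (α : Fin κ → Fin n) :
    (Fin.cons j (Fin.snoc α i : Fin (κ + 1) → Fin n) : Fin (κ + 1 + 1) → Fin n) =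
      Fin.snoc (Fin.cons j α : Fin (κ + 1) → Fin n) i :=
  Fin.cons_snoc_eq_snoc_cons _ _ _

/-- The derivative `∂ᵢ : H^{s+1} → H^s` as a linear map. -/
def sobDLin {n s : ℕ} (i : Fin n) : Sob n (s + 1) →ₗ[ℝ] Sob n s where
  toFun u := ⟨WithLp.toLp 2 fun p : DIdx n s =>
      -- The index `i` is appended at the end, so `∂ᵢ` acts innermost and prepending further
      -- derivatives still matches the relations satisfied by `u`.
      u.1 ⟨⟨p.1 + 1, by omega⟩, (Fin.snoc p.2 i : Fin ((p.1 : ℕ) + 1) → Fin n)⟩, by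
    intro κ hκ α j
    have := u.2 (κ + 1) (by omega) (Fin.snoc α i : Fin (κ + 1) → Fin n) j
    rw [Fin.cons_snoc_comm] at this
    exact this⟩
  map_add' _ _ := rfl
  map_smul' _ _ := rfl

lemma sobDLin_fn {n s : ℕ} (i : Fin n) (u : Sob n (s + 1)) : (sobDLin i u).fn = u.d i := by
  have h : (Fin.snoc Fin.elim0 i : Fin (0 + 1) → Fin n) = fun _ => i := by
    ext j; fin_cases j; rfl
  exact congrArg (fun β : Fin 1 → Fin n => u.1 ⟨⟨1, by omega⟩, β⟩) h

lemma Sob.hasWeakPartial {n s : ℕ} (u : Sob n (s + 1)) (i : Fin n) :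
    HasWeakPartial i u.fn (u.d i) := by
  have h : (Fin.cons i Fin.elim0 : Fin (0 + 1) → Fin n) = fun _ => i := by
    ext j; fin_cases j; rfl
  have := u.2 0 (by omega) Fin.elim0 i
  rwa [h] at this

lemma Sob.hat_d {n s : ℕ} (u : Sob n (s + 1)) (i : Fin n) :
    hat (u.d i) =ᵐ[volume] fun ξ => sym i ξ * hat u.fn ξ :=
  (u.hasWeakPartial i).hat_eq

lemma norm_sobDLin_sq {n s : ℕ} (u : Sob n (s + 1)) (i : Fin n) :
    ‖sobDLin i u‖ ^ 2 = ∫ ξ, weight s ξ * (‖sym i ξ‖ ^ 2 * ‖hat u.fn ξ‖ ^ 2) := by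
  rw [Sob.norm_sq_eq, sobDLin_fn]
  refine integral_congr_ae ?_
  filter_upwards [u.hat_d i] with ξ h
  rw [h, norm_mul, mul_pow]

lemma integrable_sobDLin {n s : ℕ} (u : Sob n (s + 1)) (i : Fin n) :
    Integrable fun ξ => weight s ξ * (‖sym i ξ‖ ^ 2 * ‖hat u.fn ξ‖ ^ 2) := by
  refine (sobDLin i u).integrable_weight.congr ?_
  rw [sobDLin_fn]
  filter_upwards [u.hat_d i] with ξ h
  rw [h, norm_mul, mul_pow]

/-- `‖u‖²_{H^{s+1}} = ‖u‖²_{L²} + ‖∇u‖²_{H^s}`. -/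
lemma Sob.norm_sq_succ {n s : ℕ} (u : Sob n (s + 1)) :
    ‖u‖ ^ 2 = ‖u.fn‖ ^ 2 + ∑ i, ‖sobDLin i u‖ ^ 2 := by
  simp_rw [norm_sobDLin_sq]
  rw [← norm_hat, Lp.norm_sq_eq_integral, ← integral_finsetSum _ fun i _ => integrable_sobDLin u i,
    ← integral_add (Lp.integrable_norm_sq _)
      (integrable_finsetSum _ fun i _ => integrable_sobDLin u i), Sob.norm_sq_eq]
  congr 1 with ξ
  rw [weight_succ, ← sum_norm_sym_sq, ← Finset.mul_sum, ← Finset.sum_mul]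
  ring

/-- The derivative `∂ᵢ : H^{s+1} → H^s`. -/
def sobD {n s : ℕ} (i : Fin n) : Sob n (s + 1) →L[ℝ] Sob n s :=
  LinearMap.mkContinuous (sobDLin i) 1 fun u => by
    rw [one_mul]
    refine le_of_sq_le_sq ?_ (norm_nonneg _)
    rw [Sob.norm_sq_succ u]
    have := Finset.single_le_sum (f := fun i => ‖sobDLin i u‖ ^ 2) (fun _ _ => by positivity)
      (Finset.mem_univ i)
    nlinarith [sq_nonneg ‖u.fn‖]

lemma sobD_fn {n s : ℕ} (i : Fin n) (u : Sob n (s + 1)) : (sobD i u).fn = u.d i := sobDLin_fn i u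

/-- The inclusion `H^{s+1} → H^s`. -/
def sobRes (n s : ℕ) : Sob n (s + 1) →L[ℝ] Sob n s :=
  LinearMap.mkContinuous
    { toFun := fun u => ⟨WithLp.toLp 2 fun p : DIdx n s => u.1 ⟨⟨p.1, by omega⟩, p.2⟩,
        fun κ hκ α j => u.2 κ (by omega) α j⟩
      map_add' := fun _ _ => rfl
      map_smul' := fun _ _ => rfl } 1 fun u => by
    rw [one_mul]
    refine le_of_sq_le_sq ?_ (norm_nonneg _)
    rw [Sob.norm_sq_eq, Sob.norm_sq_eq u]
    refine integral_mono (Sob.integrable_weight _) u.integrable_weight fun ξ => ?_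
    refine mul_le_mul_of_nonneg_right ?_ (by positivity)
    simp only [weight]
    rw [Fin.sum_univ_castSucc (n := s + 1)]
    simpa using pow_nonneg (lap_nonneg ξ) (s + 1)

lemma sobRes_fn {n s : ℕ} (u : Sob n (s + 1)) : (sobRes n s u).fn = u.fn := rfl

lemma norm_sobRes_le {n s : ℕ} (u : Sob n (s + 1)) : ‖sobRes n s u‖ ≤ ‖u‖ := by
  simpa using LinearMap.mkContinuous_norm_le _ zero_le_one _ |> (sobRes n s).le_of_opNorm_le <| u

lemma norm_sobD_le {n s : ℕ} (i : Fin n) (u : Sob n (s + 1)) : ‖sobD i u‖ ≤ ‖u‖ := by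
  simpa using LinearMap.mkContinuous_norm_le _ zero_le_one _ |> (sobD i).le_of_opNorm_le <| u

lemma Sob.inner_eq_sum {n s : ℕ} (u v : Sob n s) : inner ℝ u v = ∑ p, inner ℝ (u.1 p) (v.1 p) :=
  PiLp.inner_apply u.1 v.1

/-- Parseval's identity for the complexifications, whose complex inner product is the real one. -/
lemma inner_eq_re_integral_hat {n : ℕ} (f g : L2 n) :
    inner ℝ f g = (∫ ξ, hat g ξ * starRingEnd ℂ (hat f ξ)).re := by
  have h1 : (inner ℂ (hat f) (hat g)) = ∫ ξ, hat g ξ * starRingEnd ℂ (hat f ξ) := by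
    rw [L2.inner_def]; rfl
  rw [← h1, hat, hat, Lp.inner_fourier_eq, L2.inner_def, L2.inner_def]
  have : ∫ x, inner ℂ (toC f x) (toC g x) = ∫ x, ((inner ℝ (f x) (g x) : ℝ) : ℂ) := by
    refine integral_congr_ae ?_
    filter_upwards [coeFn_toC f, coeFn_toC g] with x h1 h2
    rw [h1, h2]; simp
  rw [this, integral_complex_ofReal, Complex.ofReal_re]

/-! ### Weighted Cauchy–Schwarz and Young inequalities -/

/-- Cauchy–Schwarz after splitting `a b = a^{1/2} · a^{1/2} b`. -/
lemma lintegral_mul_sq_le {α : Type*} [MeasurableSpace α] (μ : Measure α) {a b : α → ℝ≥0∞}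
    (ha : AEMeasurable a μ) (hb : AEMeasurable b μ) :
    (∫⁻ x, a x * b x ∂μ) ^ 2 ≤ (∫⁻ x, a x ∂μ) * ∫⁻ x, a x * b x ^ 2 ∂μ := by
  have h2 : ∀ t : ℝ≥0∞, (t ^ (1 / 2 : ℝ)) ^ (2 : ℝ) = t := fun t => by
    rw [← ENNReal.rpow_mul]; norm_num
  have h := ENNReal.lintegral_mul_le_Lp_mul_Lq μ Real.HolderConjugate.two_two
    (f := fun x => a x ^ (1 / 2 : ℝ)) (g := fun x => a x ^ (1 / 2 : ℝ) * b x)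
    (ha.pow_const _) ((ha.pow_const _).mul hb)
  have e1 : ∀ x, ((fun x => a x ^ (1 / 2 : ℝ)) * fun x => a x ^ (1 / 2 : ℝ) * b x) x =
      a x * b x := fun x => by
    rw [Pi.mul_apply, ← mul_assoc, ← ENNReal.rpow_add_of_nonneg _ _ (by norm_num) (by norm_num)]
    norm_num
  simp_rw [e1, ENNReal.mul_rpow_of_nonneg _ _ zero_le_two, h2] at h
  calc (∫⁻ x, a x * b x ∂μ) ^ 2
      ≤ ((∫⁻ x, a x ∂μ) ^ (1 / 2 : ℝ) * (∫⁻ x, a x * b x ^ (2 : ℝ) ∂μ) ^ (1 / 2 : ℝ)) ^ 2 := by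
        gcongr
    _ = _ := by
        rw [mul_pow, ← ENNReal.rpow_natCast, ← ENNReal.rpow_natCast]
        simp only [Nat.cast_ofNat, h2, ENNReal.rpow_ofNat]

/-- Young's inequality `L¹ * L² ⊆ L²`. -/
lemma lintegral_conv_sq_le {n : ℕ} {a b : RN n → ℝ≥0∞} (ha : Measurable a) (hb : Measurable b) :
    ∫⁻ ξ, (∫⁻ η, a (ξ - η) * b η) ^ 2 ≤ (∫⁻ ξ, a ξ) ^ 2 * ∫⁻ ξ, b ξ ^ 2 := by
  calc ∫⁻ ξ, (∫⁻ η, a (ξ - η) * b η) ^ 2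
      ≤ ∫⁻ ξ, (∫⁻ η, a η) * ∫⁻ η, a (ξ - η) * b η ^ 2 := by
        refine lintegral_mono fun ξ => ?_
        have := lintegral_mul_sq_le volume (a := fun η => a (ξ - η)) (b := b)
          (ha.comp (measurable_const.sub measurable_id)).aemeasurable hb.aemeasurable
        rwa [lintegral_sub_left_eq_self a ξ] at this
    _ = (∫⁻ η, a η) * ∫⁻ ξ, ∫⁻ η, a (ξ - η) * b η ^ 2 :=
        lintegral_const_mul _ (Measurable.lintegral_prod_right'
          (f := fun p : RN n × RN n => a (p.1 - p.2) * b p.2 ^ 2) (by fun_prop))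
    _ = (∫⁻ η, a η) * ∫⁻ η, ∫⁻ ξ, a (ξ - η) * b η ^ 2 := by
        rw [lintegral_lintegral_swap
          (f := fun ξ η : RN n => a (ξ - η) * b η ^ 2) (Measurable.aemeasurable (by
            simp only [Function.uncurry_def]; fun_prop))]
    _ = (∫⁻ ξ, a ξ) ^ 2 * ∫⁻ ξ, b ξ ^ 2 := by
        have : ∀ η, ∫⁻ ξ, a (ξ - η) * b η ^ 2 = (∫⁻ ξ, a ξ) * b η ^ 2 := fun η => by
          rw [lintegral_mul_const _ (by fun_prop), lintegral_sub_right_eq_self a η]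
        simp_rw [this]
        rw [lintegral_const_mul _ (by fun_prop), sq, mul_assoc]

/-! ### The weight -/

lemma lap_le {n : ℕ} (ξ η : RN n) : lap ξ ≤ 2 * (lap (ξ - η) + lap η) := by
  have h : ‖ξ‖ ≤ ‖ξ - η‖ + ‖η‖ := by simpa using norm_add_le (ξ - η) η
  have : ‖ξ‖ ^ 2 ≤ 2 * (‖ξ - η‖ ^ 2 + ‖η‖ ^ 2) := by
    nlinarith [sq_nonneg (‖ξ - η‖ - ‖η‖), norm_nonneg ξ]
  unfold lap
  nlinarith [sq_nonneg Real.pi]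

lemma weight_le {n : ℕ} (s : ℕ) (ξ η : RN n) :
    weight s ξ ≤ 4 ^ s * (weight s (ξ - η) + weight s η) := by
  unfold weight
  rw [← Finset.sum_add_distrib, Finset.mul_sum]
  refine Finset.sum_le_sum fun κ _ => ?_
  have hκ : (κ : ℕ) ≤ s := by omega
  have h0 := lap_nonneg (ξ - η)
  have h1 := lap_nonneg η
  have p0 := pow_nonneg h0 (κ : ℕ)
  have p1 := pow_nonneg h1 (κ : ℕ)
  calc lap ξ ^ (κ : ℕ) ≤ (4 * max (lap (ξ - η)) (lap η)) ^ (κ : ℕ) := by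
        refine pow_le_pow_left₀ (lap_nonneg ξ) ((lap_le ξ η).trans ?_) _
        linarith [le_max_left (lap (ξ - η)) (lap η), le_max_right (lap (ξ - η)) (lap η)]
    _ = 4 ^ (κ : ℕ) * max (lap (ξ - η)) (lap η) ^ (κ : ℕ) := mul_pow _ _ _
    _ ≤ 4 ^ s * (lap (ξ - η) ^ (κ : ℕ) + lap η ^ (κ : ℕ)) := by
        refine mul_le_mul (pow_le_pow_right₀ (by norm_num) hκ) ?_ (by positivity) (by positivity)
        rcases max_cases (lap (ξ - η)) (lap η) with h | h <;> rw [h.1] <;> linarith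

/-- This allows the weight in front of a convolution to be moved onto one factor at a time. -/
lemma sqrt_weight_le {n : ℕ} (s : ℕ) (ξ η : RN n) :
    √(weight s ξ) ≤ 2 ^ s * (√(weight s (ξ - η)) + √(weight s η)) := by
  rw [Real.sqrt_le_left (by positivity), mul_pow, ← pow_mul, mul_comm s 2, pow_mul]
  norm_num
  refine (weight_le s ξ η).trans ?_
  have h1 := Real.sq_sqrt (weight_pos s (ξ - η)).le
  have h2 := Real.sq_sqrt (weight_pos s η).le
  have : 0 ≤ √(weight s (ξ - η)) * √(weight s η) := by positivity
  refine mul_le_mul_of_nonneg_left ?_ (by positivity)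
  nlinarith

lemma one_add_norm_sq_pow_le_weight {n : ℕ} (s : ℕ) (ξ : RN n) :
    (1 + ‖ξ‖ ^ 2) ^ s ≤ 2 ^ s * weight s ξ := by
  rw [add_comm, add_pow, weight, Finset.mul_sum, ← Fin.sum_univ_eq_sum_range
    (fun m => (‖ξ‖ ^ 2) ^ m * 1 ^ (s - m) * (s.choose m : ℝ))]
  refine Finset.sum_le_sum fun κ _ => ?_
  rw [one_pow, mul_one, mul_comm]
  refine mul_le_mul ?_ ?_ (by positivity) (by positivity)
  · exact_mod_cast Nat.choose_le_two_pow s κ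
  · refine pow_le_pow_left₀ (by positivity) ?_ _
    unfold lap
    have : 1 ≤ Real.pi ^ 2 := by nlinarith [Real.pi_gt_three]
    nlinarith [sq_nonneg ‖ξ‖]

/-- The role of `s > n/2`: the weight dominates a multiple of `(1 + ‖ξ‖²)^s`, whose inverse is
integrable exactly in this range. -/
lemma integrable_inv_weight {n s : ℕ} (hs : n < 2 * s) :
    Integrable fun ξ : RN n => (weight s ξ)⁻¹ := by
  have h : ((Module.finrank ℝ (RN n) : ℕ) : ℝ) < 2 * s := by
    rw [finrank_euclideanSpace_fin]; exact_mod_cast hs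
  refine ((integrable_rpow_neg_one_add_norm_sq (μ := volume) h).const_mul (2 ^ s)).mono'
    ((continuous_weight s).inv₀ fun ξ => (weight_pos s ξ).ne').aestronglyMeasurable ?_
  filter_upwards with ξ
  have hw := weight_pos s ξ
  rw [Real.norm_of_nonneg (by positivity), show (-(2 * (s : ℝ)) / 2) = -(s : ℝ) by ring,
    Real.rpow_neg (by positivity), Real.rpow_natCast, ← div_eq_mul_inv, inv_eq_one_div,
    div_le_div_iff₀ hw (by positivity), one_mul]
  exact one_add_norm_sq_pow_le_weight s ξ

/-! ### Fourier inversion -/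

/-- Fubini's theorem for the Fourier kernel. The inverse transform differs from the transform by a
reflection, which is absorbed by substituting `-ξ`. -/
lemma integral_fourierInv_schwartz_mul {n : ℕ} (φ : 𝓢(RN n, ℂ)) {z : RN n → ℂ}
    (hz : Integrable z) : ∫ ξ, (𝓕⁻ φ) ξ * z ξ = ∫ x, φ x * (𝓕⁻ z) x := by
  have h := VectorFourier.integral_fourierIntegral_smul_eq_flip (μ := (volume : Measure (RN n)))
    (ν := (volume : Measure (RN n))) (L := innerₗ (RN n)) Real.continuous_fourierChar
    (by exact continuous_inner) φ.integrable hz.comp_neg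
  rw [Real.fourierInv_eq_fourier_comp_neg]
  rw [flip_innerₗ] at h
  simp only [smul_eq_mul] at h
  refine Eq.trans ?_ h
  rw [← integral_neg_eq_self]
  congr 1 with ξ
  rw [SchwartzMap.fourierInv_coe, Real.fourierInv_eq_fourier_neg, neg_neg]
  rfl

/-- On `L¹ ∩ L²` the inverse Fourier transform of `L²` is given by the integral. -/
lemma coeFn_fourierInv {n : ℕ} {z : L2C n} (hz : Integrable z) :
    (𝓕⁻ z : L2C n) =ᵐ[volume] 𝓕⁻ (z : RN n → ℂ) := by
  have hc : Continuous (𝓕⁻ (z : RN n → ℂ)) := by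
    rw [Real.fourierInv_eq_fourier_comp_neg]
    exact VectorFourier.fourierIntegral_continuous Real.continuous_fourierChar
      (by exact continuous_inner) hz.comp_neg
  refine ae_eq_of_integral_contDiff_smul_eq (locallyIntegrable_lp _) hc.locallyIntegrable
    fun g hg hgc => ?_
  have hgC : ContDiff ℝ ∞ (fun x => (g x : ℂ)) := Complex.ofRealCLM.contDiff.comp hg
  have hcC : HasCompactSupport (fun x => (g x : ℂ)) := hgc.comp_left Complex.ofReal_zero
  let G : 𝓢(RN n, ℂ) := hcC.toSchwartzMap hgC
  have eg : ∀ x, G x = (g x : ℂ) := fun x => rfl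
  have h1 := integral_schwartz_mul G (𝓕⁻ z : L2C n)
  rw [FourierTransform.fourier_fourierInv_eq, integral_fourierInv_schwartz_mul G hz] at h1
  simpa only [eg, Complex.real_smul] using h1

/-! ### `H^s` is an algebra for `s > n/2` -/

lemma Sob.lintegral_weight {n s : ℕ} (f : Sob n s) :
    ∫⁻ ξ, (ENNReal.ofReal √(weight s ξ) * ‖hat f.fn ξ‖ₑ) ^ 2 = ENNReal.ofReal (‖f‖ ^ 2) := by
  rw [f.norm_sq_eq, ofReal_integral_eq_lintegral_ofReal f.integrable_weight
    (Eventually.of_forall fun ξ => mul_nonneg (weight_pos s ξ).le (by positivity))]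
  congr 1 with ξ
  rw [mul_pow, ← ENNReal.ofReal_pow (by positivity), Real.sq_sqrt (weight_pos s ξ).le,
    ENNReal.ofReal_mul (weight_pos s ξ).le, ENNReal.ofReal_pow (by positivity), ofReal_norm]

lemma measurable_enorm_hat {n : ℕ} (f : L2 n) : Measurable fun ξ => ‖hat f ξ‖ₑ :=
  (Lp.stronglyMeasurable (hat f)).enorm

lemma measurable_sqrt_weight {n : ℕ} (s : ℕ) :
    Measurable fun ξ : RN n => ENNReal.ofReal √(weight s ξ) :=
  (Real.continuous_sqrt.comp (continuous_weight s)).measurable.ennreal_ofReal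

/-- Cauchy–Schwarz against the integrable function `weight⁻¹`: the Sobolev embedding on the Fourier
side, saying that the transform is in `L¹`. -/
lemma Sob.lintegral_hat_sq_le {n s : ℕ} (hs : n < 2 * s) (f : Sob n s) :
    (∫⁻ ξ, ‖hat f.fn ξ‖ₑ) ^ 2 ≤
      ENNReal.ofReal ((∫ ξ : RN n, (weight s ξ)⁻¹) * ‖f‖ ^ 2) := by
  have hw : ∀ ξ : RN n, ENNReal.ofReal (weight s ξ)⁻¹ * ENNReal.ofReal (weight s ξ) = 1 := fun ξ => by
    rw [← ENNReal.ofReal_mul (inv_nonneg.2 (weight_pos s ξ).le),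
      inv_mul_cancel₀ (weight_pos s ξ).ne', ENNReal.ofReal_one]
  have hm : Measurable fun ξ : RN n => ENNReal.ofReal (weight s ξ) :=
    (continuous_weight s).measurable.ennreal_ofReal
  have hmi : Measurable fun ξ : RN n => ENNReal.ofReal (weight s ξ)⁻¹ :=
    (continuous_weight s).measurable.inv.ennreal_ofReal
  have h := lintegral_mul_sq_le volume (a := fun ξ : RN n => ENNReal.ofReal (weight s ξ)⁻¹)
    (b := fun ξ => ENNReal.ofReal (weight s ξ) * ‖hat f.fn ξ‖ₑ) hmi.aemeasurable
    (hm.mul (measurable_enorm_hat _)).aemeasurable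
  have e1 : ∀ ξ, ENNReal.ofReal (weight s ξ)⁻¹ * (ENNReal.ofReal (weight s ξ) * ‖hat f.fn ξ‖ₑ) =
      ‖hat f.fn ξ‖ₑ := fun ξ => by rw [← mul_assoc, hw, one_mul]
  have e2 : ∀ ξ, ENNReal.ofReal (weight s ξ)⁻¹ *
      (ENNReal.ofReal (weight s ξ) * ‖hat f.fn ξ‖ₑ) ^ 2 =
      (ENNReal.ofReal √(weight s ξ) * ‖hat f.fn ξ‖ₑ) ^ 2 := fun ξ => by
    rw [mul_pow, mul_pow, ← ENNReal.ofReal_pow (Real.sqrt_nonneg _),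
      Real.sq_sqrt (weight_pos s ξ).le, ← mul_assoc, sq (ENNReal.ofReal (weight s ξ)), ← mul_assoc, hw, one_mul]
  simp_rw [e1, e2] at h
  rw [f.lintegral_weight, ← ofReal_integral_eq_lintegral_ofReal (integrable_inv_weight hs)
    (Eventually.of_forall fun ξ => inv_nonneg.2 (weight_pos s ξ).le),
    ← ENNReal.ofReal_mul (integral_nonneg fun ξ => inv_nonneg.2 (weight_pos s ξ).le)] at h
  exact h

lemma Sob.integrable_hat {n s : ℕ} (hs : n < 2 * s) (f : Sob n s) : Integrable (hat f.fn) := by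
  refine ⟨Lp.aestronglyMeasurable _, ?_⟩
  rw [hasFiniteIntegral_iff_enorm]
  have := (f.lintegral_hat_sq_le hs).trans_lt ENNReal.ofReal_lt_top
  exact lt_of_not_ge fun h => by
    rw [top_le_iff] at h
    rw [h] at this
    simp at this

lemma Sob.coeFn_eq_fourierInv {n s : ℕ} (hs : n < 2 * s) (f : Sob n s) :
    ∀ᵐ x, (f.fn x : ℂ) = 𝓕⁻ (hat f.fn : RN n → ℂ) x := by
  filter_upwards [coeFn_fourierInv (f.integrable_hat hs), coeFn_toC f.fn] with x h1 h2
  rw [← h1, ← h2, hat, FourierTransform.fourierInv_fourier_eq]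

open scoped Convolution in
/-- The product of two elements of `H^s`, `s > n/2`. -/
theorem Sob.exists_mul (n s : ℕ) (hs : n < 2 * s) : ∃ C : ℝ, ∀ f h : Sob n s, ∃ p : Sob n s,
    (p.fn =ᵐ[volume] fun x => f.fn x * h.fn x) ∧ ‖p‖ ≤ C * ‖f‖ * ‖h‖ := by
  set K : ℝ := ∫ ξ : RN n, (weight s ξ)⁻¹ with hK
  have K0 : 0 ≤ K := integral_nonneg fun ξ => inv_nonneg.2 (weight_pos s ξ).le
  -- A factor `2^s` comes from splitting the weight. The remaining `2` comes from `(A + B)² ≤ 2(A² +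
  -- B²)` together with the equal bounds for `A` and `B`; `√K` is the `L¹` bound of a transform.
  refine ⟨2 ^ (s + 1) * √K, fun f h => ?_⟩
  set F := hat f.fn
  set H := hat h.fn
  -- The candidate for the transform of the product is the convolution of the transforms.
  set P : RN n → ℂ := (F : RN n → ℂ) ⋆[ContinuousLinearMap.mul ℂ ℂ, volume] (H : RN n → ℂ) with hP
  have iF := f.integrable_hat hs
  have iH := h.integrable_hat hs
  have iP : Integrable P := iF.integrable_convolution _ iH
  set w : RN n → ℝ≥0∞ := fun ξ => ENNReal.ofReal √(weight s ξ) with hwdef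
  have mw : Measurable w := measurable_sqrt_weight s
  have mF : Measurable fun ξ => ‖F ξ‖ₑ := measurable_enorm_hat _
  have mH : Measurable fun ξ => ‖H ξ‖ₑ := measurable_enorm_hat _
  -- In `A` the weight rests on the first factor, in `B` on the second. Both are convolutions of an
  -- `L¹` function with an `L²` function, so Young's inequality applies.
  set A : RN n → ℝ≥0∞ := fun ξ => ∫⁻ η, ‖H (ξ - η)‖ₑ * (w η * ‖F η‖ₑ) with hA
  set B : RN n → ℝ≥0∞ := fun ξ => ∫⁻ η, ‖F (ξ - η)‖ₑ * (w η * ‖H η‖ₑ) with hB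
  have B' : ∀ ξ, B ξ = ∫⁻ η, ‖F η‖ₑ * (w (ξ - η) * ‖H (ξ - η)‖ₑ) := fun ξ => by
    rw [← lintegral_sub_left_eq_self _ ξ]
    simp [hB]
  have mA : Measurable A := Measurable.lintegral_prod_right'
    (f := fun p : RN n × RN n => ‖H (p.1 - p.2)‖ₑ * (w p.2 * ‖F p.2‖ₑ)) (by fun_prop)
  have bound : ∀ ξ, w ξ * ‖P ξ‖ₑ ≤ 2 ^ s * (A ξ + B ξ) := fun ξ => by
    have h1 : ‖P ξ‖ₑ ≤ ∫⁻ η, ‖F η‖ₑ * ‖H (ξ - η)‖ₑ := by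
      rw [hP, convolution_def]
      refine (enorm_integral_le_lintegral_enorm _).trans_eq ?_
      simp
    calc w ξ * ‖P ξ‖ₑ ≤ w ξ * ∫⁻ η, ‖F η‖ₑ * ‖H (ξ - η)‖ₑ := by gcongr
      _ = ∫⁻ η, w ξ * (‖F η‖ₑ * ‖H (ξ - η)‖ₑ) := by
          rw [lintegral_const_mul _ (by fun_prop)]
      _ ≤ ∫⁻ η, 2 ^ s * (‖H (ξ - η)‖ₑ * (w η * ‖F η‖ₑ) +
            ‖F η‖ₑ * (w (ξ - η) * ‖H (ξ - η)‖ₑ)) := by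
          refine lintegral_mono fun η => ?_
          have hw : w ξ ≤ 2 ^ s * (w (ξ - η) + w η) := by
            simp only [hwdef]
            rw [← ENNReal.ofReal_add (by positivity) (by positivity),
              show (2 : ℝ≥0∞) ^ s = ENNReal.ofReal (2 ^ s) by
                rw [ENNReal.ofReal_pow (by norm_num)]; simp,
              ← ENNReal.ofReal_mul (by positivity)]
            exact ENNReal.ofReal_le_ofReal (sqrt_weight_le s ξ η)
          calc w ξ * (‖F η‖ₑ * ‖H (ξ - η)‖ₑ)
              ≤ 2 ^ s * (w (ξ - η) + w η) * (‖F η‖ₑ * ‖H (ξ - η)‖ₑ) := by gcongr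
            _ = _ := by ring
      _ = 2 ^ s * (A ξ + B ξ) := by
          rw [lintegral_const_mul _ (by fun_prop), lintegral_add_left (by fun_prop), B']
  have hAB : ∫⁻ ξ, (A ξ) ^ 2 ≤ ENNReal.ofReal (K * ‖f‖ ^ 2 * ‖h‖ ^ 2) ∧
      ∫⁻ ξ, (B ξ) ^ 2 ≤ ENNReal.ofReal (K * ‖f‖ ^ 2 * ‖h‖ ^ 2) := by
    constructor
    · refine (lintegral_conv_sq_le mH (mw.mul mF)).trans ?_
      simp only [Pi.mul_apply]
      rw [f.lintegral_weight]
      grw [h.lintegral_hat_sq_le hs]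
      rw [← ENNReal.ofReal_mul (by positivity)]
      exact ENNReal.ofReal_le_ofReal (by rw [← hK]; nlinarith)
    · refine (lintegral_conv_sq_le mF (mw.mul mH)).trans ?_
      simp only [Pi.mul_apply]
      rw [h.lintegral_weight]
      grw [f.lintegral_hat_sq_le hs]
      rw [← ENNReal.ofReal_mul (by positivity)]
  have total : ∫⁻ ξ, (w ξ * ‖P ξ‖ₑ) ^ 2 ≤
      ENNReal.ofReal ((2 ^ (s + 1) * √K * ‖f‖ * ‖h‖) ^ 2) := by
    calc ∫⁻ ξ, (w ξ * ‖P ξ‖ₑ) ^ 2 ≤ ∫⁻ ξ, (2 ^ s) ^ 2 * (2 * (A ξ ^ 2 + B ξ ^ 2)) := by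
          refine lintegral_mono fun ξ => ?_
          calc (w ξ * ‖P ξ‖ₑ) ^ 2 ≤ (2 ^ s * (A ξ + B ξ)) ^ 2 := pow_le_pow_left' (bound ξ) 2
            _ = (2 ^ s) ^ 2 * (A ξ + B ξ) ^ 2 := mul_pow _ _ _
            _ ≤ _ := by
              gcongr
              have := ENNReal.rpow_add_le_mul_rpow_add_rpow (A ξ) (B ξ) (p := 2) (by norm_num)
              norm_num at this
              exact this
      _ = (2 ^ s) ^ 2 * (2 * ((∫⁻ ξ, A ξ ^ 2) + ∫⁻ ξ, B ξ ^ 2)) := by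
          rw [lintegral_const_mul' _ _ (by finiteness), lintegral_const_mul' _ _ (by finiteness),
            lintegral_add_left (mA.pow_const 2)]
      _ ≤ (2 ^ s) ^ 2 * (2 * (ENNReal.ofReal (K * ‖f‖ ^ 2 * ‖h‖ ^ 2) +
            ENNReal.ofReal (K * ‖f‖ ^ 2 * ‖h‖ ^ 2))) := by
          gcongr
          exacts [hAB.1, hAB.2]
      _ = ENNReal.ofReal ((2 ^ (s + 1) * √K * ‖f‖ * ‖h‖) ^ 2) := by
          have h2 : (2 : ℝ≥0∞) = ENNReal.ofReal 2 := by simp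
          rw [h2, ← ENNReal.ofReal_pow (by norm_num), ← ENNReal.ofReal_pow (by positivity),
            ← ENNReal.ofReal_add (by positivity) (by positivity),
            ← ENNReal.ofReal_mul (by norm_num), ← ENNReal.ofReal_mul (by positivity)]
          congr 1
          rw [mul_pow, mul_pow, mul_pow, Real.sq_sqrt K0]
          ring
  have ew : ∀ ξ, (w ξ * ‖P ξ‖ₑ) ^ 2 = ENNReal.ofReal (weight s ξ * ‖P ξ‖ ^ 2) := fun ξ => by
    simp only [hwdef]
    rw [mul_pow, ← ENNReal.ofReal_pow (by positivity), Real.sq_sqrt (weight_pos s ξ).le,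
      ENNReal.ofReal_mul (weight_pos s ξ).le, ENNReal.ofReal_pow (by positivity), ofReal_norm]
  simp_rw [ew] at total
  have nn : ∀ ξ, 0 ≤ weight s ξ * ‖P ξ‖ ^ 2 := fun ξ =>
    mul_nonneg (weight_pos s ξ).le (by positivity)
  have mP := iP.aestronglyMeasurable
  have iW : Integrable fun ξ => weight s ξ * ‖P ξ‖ ^ 2 := by
    refine ⟨(continuous_weight s).aestronglyMeasurable.mul (mP.norm.pow 2), ?_⟩
    rw [hasFiniteIntegral_iff_ofReal (Eventually.of_forall nn)]
    exact total.trans_lt ENNReal.ofReal_lt_top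
  have mem : MemLp P 2 volume := by
    rw [memLp_two_iff_integrable_sq_norm mP]
    refine iW.mono' (mP.norm.pow 2) ?_
    filter_upwards with ξ
    rw [Real.norm_of_nonneg (by positivity)]
    nlinarith [one_le_weight s ξ, sq_nonneg ‖P ξ‖]
  set z : L2C n := mem.toLp P
  have ez : z =ᵐ[volume] P := mem.coeFn_toLp
  have iWz : Integrable fun ξ => weight s ξ * ‖z ξ‖ ^ 2 := by
    refine iW.congr ?_
    filter_upwards [ez] with ξ h
    rw [h]
  obtain ⟨u, hu, hun⟩ := exists_sob z iWz
  refine ⟨u, ?_, ?_⟩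
  · have e1 : u.fn = reL (𝓕⁻ z) := hu _ z (by filter_upwards with ξ; simp [msym])
    rw [e1]
    filter_upwards [coeFn_reL (𝓕⁻ z), coeFn_fourierInv (iP.congr ez.symm),
      f.coeFn_eq_fourierInv hs, h.coeFn_eq_fourierInv hs] with x h1 h2 h3 h4
    rw [h1, h2, Real.fourierInv_congr_ae ez, Real.fourierInv_eq_fourier_neg, hP,
      Real.fourier_mul_convolution_eq iF iH, ← Real.fourierInv_eq_fourier_neg,
      ← Real.fourierInv_eq_fourier_neg, ← h3, ← h4, ← Complex.ofReal_mul, Complex.ofReal_re]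
  · refine le_of_sq_le_sq (hun.trans ?_) (by positivity)
    have e : ∫ ξ, weight s ξ * ‖z ξ‖ ^ 2 = ∫ ξ, weight s ξ * ‖P ξ‖ ^ 2 := by
      refine integral_congr_ae ?_
      filter_upwards [ez] with ξ h
      rw [h]
    rw [e, integral_eq_lintegral_of_nonneg_ae (Eventually.of_forall nn) iW.aestronglyMeasurable]
    exact ENNReal.toReal_le_of_le_ofReal (by positivity) total

/-! ### Test functions are dense in `H¹` -/

lemma hasWeakPartial_test {n : ℕ} (i : Fin n) {φ : RN n → ℝ} (hφ : ContDiff ℝ ∞ φ) :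
    HasWeakPartial i φ (partialD i φ) := by
  have cφ := hφ.continuous
  have cd := continuous_partialD i hφ
  refine ⟨cφ.locallyIntegrable, cd.locallyIntegrable, fun χ hχ hχc => ?_⟩
  exact integral_mul_fderiv_eq_neg_fderiv_mul_of_integrable
    (integrable_mul_test cd.locallyIntegrable hχ.continuous hχc)
    (integrable_mul_test cφ.locallyIntegrable (continuous_partialD i hχ)
      (hasCompactSupport_partialD i hχc))
    (integrable_mul_test cφ.locallyIntegrable hχ.continuous hχc)
    (fun x _ => hφ.differentiable (by simp) x) (fun x _ => hχ.differentiable (by simp) x)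

lemma exists_sob_one {n : ℕ} (f : L2 n) (d : Fin n → L2 n) (h : ∀ i, HasWeakPartial i f (d i)) :
    ∃ u : Sob n 1, u.fn = f ∧ ∀ i, u.d i = d i := by
  let U : PiLp 2 (fun _ : DIdx n 1 => L2 n) := WithLp.toLp 2 fun p =>
    match p with
    | ⟨⟨0, _⟩, _⟩ => f
    | ⟨⟨1, _⟩, α⟩ => d (α 0)
  have hU : U ∈ sobSubmodule n 1 := by
    intro κ hκ α i
    obtain rfl : κ = 0 := by omega
    exact h i
  exact ⟨⟨U, hU⟩, rfl, fun i => rfl⟩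

lemma Sob.norm_sq_zero {n : ℕ} (u : Sob n 0) : ‖u‖ ^ 2 = ‖u.fn‖ ^ 2 := by
  rw [Sob.norm_sq_eq, ← norm_hat, Lp.norm_sq_eq_integral]
  simp [weight]

lemma inner_eq_of_norm_sq {E F : Type*} [NormedAddCommGroup E] [InnerProductSpace ℝ E]
    [NormedAddCommGroup F] [InnerProductSpace ℝ F] (T : E →ₗ[ℝ] F)
    (h : ∀ u, ‖u‖ ^ 2 = ‖T u‖ ^ 2) (u v : E) : inner ℝ u v = inner ℝ (T u) (T v) := by
  have e := h (u + v)
  rw [map_add, norm_add_sq_real, norm_add_sq_real, h u, h v] at e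
  linarith

lemma Sob.inner_zero_eq {n : ℕ} (u v : Sob n 0) : inner ℝ u v = inner ℝ u.fn v.fn :=
  inner_eq_of_norm_sq (Sob.fnL n 0).toLinearMap Sob.norm_sq_zero u v

lemma Sob.inner_succ {n s : ℕ} (u v : Sob n (s + 1)) :
    inner ℝ u v = inner ℝ u.fn v.fn + ∑ i, inner ℝ (sobD i u) (sobD i v) := by
  have e := (u + v).norm_sq_succ
  rw [norm_add_sq_real, u.norm_sq_succ, v.norm_sq_succ, Sob.fn_add, norm_add_sq_real] at e
  simp_rw [map_add, norm_add_sq_real, Finset.sum_add_distrib, ← Finset.mul_sum] at e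
  change inner ℝ u v = inner ℝ u.fn v.fn + ∑ i, inner ℝ (sobDLin i u) (sobDLin i v)
  linarith

lemma Sob.inner_one {n : ℕ} (u v : Sob n 1) :
    inner ℝ u v = inner ℝ u.fn v.fn + ∑ i, inner ℝ (u.d i) (v.d i) := by
  rw [Sob.inner_succ]
  simp_rw [Sob.inner_zero_eq, sobD_fn]

lemma HasWeakPartial.d_unique {n : ℕ} {i : Fin n} {f h h' : RN n → ℝ} (H : HasWeakPartial i f h)
    (H' : HasWeakPartial i f h') : h =ᵐ[volume] h' := by
  refine ae_eq_of_integral_contDiff_smul_eq H.2.1 H'.2.1 fun φ h1 h2 => ?_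
  simp_rw [smul_eq_mul, mul_comm (φ _)]
  linarith [H.2.2 φ h1 h2, H'.2.2 φ h1 h2]

/-- The elements of `H¹` given by test functions. -/
def testSubmodule (n : ℕ) : Submodule ℝ (Sob n 1) where
  carrier := {u | ∃ φ : RN n → ℝ, ContDiff ℝ ∞ φ ∧ HasCompactSupport φ ∧ u.fn =ᵐ[volume] φ}
  add_mem' := by
    rintro u v ⟨φ, h1, h2, h3⟩ ⟨χ, k1, k2, k3⟩
    exact ⟨φ + χ, h1.add k1, h2.add k2, (Lp.coeFn_add _ _).trans (h3.add k3)⟩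
  zero_mem' := ⟨0, contDiff_const, HasCompactSupport.zero, Lp.coeFn_zero _ _ _⟩
  smul_mem' := by
    rintro a u ⟨φ, h1, h2, h3⟩
    exact ⟨a • φ, contDiff_const.smul h1, h2.smul_left (f := fun _ => a),
      (Lp.coeFn_smul _ _).trans (h3.const_smul a)⟩

lemma L2.inner_eq_integral {n : ℕ} {f g : L2 n} {φ : RN n → ℝ} (h : g =ᵐ[volume] φ) :
    inner ℝ f g = ∫ x, f x * φ x := by
  rw [L2.inner_def]
  refine integral_congr_ae ?_
  filter_upwards [h] with x hx
  rw [hx]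
  simp [mul_comm]

/-- If `u ∈ H¹` is orthogonal to all test functions, then `div ∇u = u` weakly. On the Fourier side
this reads `(1 + |2πξ|²) û = 0`, so `u = 0`. -/
lemma dense_testSubmodule (n : ℕ) : (testSubmodule n).topologicalClosure = ⊤ := by
  rw [Submodule.topologicalClosure_eq_top_iff, Submodule.eq_bot_iff]
  intro u hu
  rw [Submodule.mem_orthogonal'] at hu
  have hdiv : HasWeakDiv (fun i => u.d i) u.fn := by
    refine ⟨fun i => locallyIntegrable_lp _, locallyIntegrable_lp _, fun φ hs hc => ?_⟩
    have m0 := memLp_of_test hs.continuous hc 2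
    have m1 := fun i => memLp_of_test (continuous_partialD i hs) (hasCompactSupport_partialD i hc) 2
    obtain ⟨v, v0, v1⟩ := exists_sob_one (m0.toLp φ) (fun i => (m1 i).toLp _) fun i =>
      (hasWeakPartial_test i hs).congr m0.coeFn_toLp.symm (m1 i).coeFn_toLp.symm
    have h0 := hu v ⟨φ, hs, hc, by rw [v0]; exact m0.coeFn_toLp⟩
    rw [Sob.inner_one, v0] at h0
    simp_rw [v1] at h0
    rw [L2.inner_eq_integral m0.coeFn_toLp] at h0
    simp_rw [fun i => L2.inner_eq_integral (f := u.d i) (m1 i).coeFn_toLp] at h0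
    rw [integral_finsetSum _ fun i _ => integrable_mul_test (locallyIntegrable_lp _)
      (continuous_partialD i hs) (hasCompactSupport_partialD i hc)]
    linarith
  have hz : hat u.fn =ᵐ[volume] 0 := by
    have hd : ∀ᵐ ξ, ∀ i, hat (u.d i) ξ = sym i ξ * hat u.fn ξ := ae_all_iff.2 fun i => u.hat_d i
    filter_upwards [hdiv.hat_eq, hd] with ξ h1 h2
    simp_rw [h2, ← mul_assoc] at h1
    rw [← Finset.sum_mul, sum_sym_sq] at h1
    have h3 : (((1 + lap ξ : ℝ)) : ℂ) * hat u.fn ξ = 0 := by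
      push_cast; linear_combination h1
    have h4 : ((1 + lap ξ : ℝ) : ℂ) ≠ 0 := by
      exact_mod_cast (by linarith [lap_nonneg ξ] : (0 : ℝ) < 1 + lap ξ).ne'
    exact (mul_eq_zero.1 h3).resolve_left h4
  refine Sob.ext_fn ?_
  have : hat u.fn = 0 := Lp.ext (hz.trans (Lp.coeFn_zero ℂ 2 volume).symm)
  rw [← norm_eq_zero, norm_hat, norm_eq_zero] at this
  rw [this]; rfl

/-! ### The Gagliardo–Nirenberg–Sobolev inequality on `H¹` -/

lemma norm_fderiv_le_sum {n : ℕ} (φ : RN n → ℝ) (x : RN n) :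
    ‖fderiv ℝ φ x‖ ≤ ∑ i, |partialD i φ x| := by
  refine ContinuousLinearMap.opNorm_le_bound _ (Finset.sum_nonneg fun i _ => abs_nonneg _)
    fun y => ?_
  have hy : y = ∑ i, y i • EuclideanSpace.single i (1 : ℝ) := by
    ext j; simp [Finset.sum_apply, Pi.single_apply]
  conv_lhs => rw [hy, map_sum]
  rw [Finset.sum_mul]
  refine (norm_sum_le _ _).trans (Finset.sum_le_sum fun i _ => ?_)
  rw [map_smul, norm_smul, mul_comm]
  exact mul_le_mul_of_nonneg_left (PiLp.norm_apply_le y i) (abs_nonneg _)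

lemma one_le_critExp {n : ℕ} (hn : 3 ≤ n) : 1 ≤ critExp n := by
  have : (3 : ℝ) ≤ n := by exact_mod_cast hn
  rw [critExp, ← ENNReal.ofReal_one]
  refine ENNReal.ofReal_le_ofReal ?_
  rw [le_div_iff₀ (by linarith)]
  linarith

lemma critExp_inv {n : ℕ} (hn : 3 ≤ n) :
    ((2 * n / ((n : ℝ) - 2)).toNNReal : ℝ)⁻¹ =
      ((2 : NNReal) : ℝ)⁻¹ - (Module.finrank ℝ (RN n) : ℝ)⁻¹ := by
  have h : (3 : ℝ) ≤ n := by exact_mod_cast hn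
  have h2 : (0 : ℝ) < n - 2 := by linarith
  rw [Real.coe_toNNReal _ (by positivity), finrank_euclideanSpace_fin]
  simp only [NNReal.coe_ofNat]
  field_simp

/-- The inequality is known for smooth compactly supported functions. An element of `H¹` is the
limit of such functions; a subsequence converges almost everywhere, Fatou's lemma passes to the
limit on the left, and the gradients converge in `L²` on the right. -/
theorem gagliardo_nirenberg {n : ℕ} (hn : 3 ≤ n) : ∃ C : NNReal, ∀ (f : L2 n) (d : Fin n → L2 n),
    (∀ i, HasWeakPartial i f (d i)) → eLpNorm f (critExp n) volume ≤ C * ∑ i, ‖d i‖ₑ := by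
  refine ⟨SNormLESNormFDerivOfEqConst ℝ (volume : Measure (RN n)) ((2 : NNReal) : ℝ), fun f d hd => ?_⟩
  set C := SNormLESNormFDerivOfEqConst ℝ (volume : Measure (RN n)) ((2 : NNReal) : ℝ)
  obtain ⟨u, rfl, hud⟩ := exists_sob_one f d hd
  have hu : u ∈ closure (testSubmodule n : Set (Sob n 1)) := by
    have : u ∈ (testSubmodule n).topologicalClosure := by rw [dense_testSubmodule]; trivial
    exact this
  obtain ⟨v, hv, hvu⟩ := mem_closure_iff_seq_limit.1 hu
  have bound : ∀ k, eLpNorm (v k).fn (critExp n) volume ≤ C * ∑ i, ‖(v k).d i‖ₑ := fun k => by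
    obtain ⟨φ, h1, h2, h3⟩ := hv k
    have e : ∀ i, (v k).d i =ᵐ[volume] partialD i φ := fun i =>
      ((v k).hasWeakPartial i).d_unique ((hasWeakPartial_test i h1).congr h3.symm
        (EventuallyEq.refl _ _))
    rw [eLpNorm_congr_ae h3]
    refine (eLpNorm_le_eLpNorm_fderiv_of_eq (p := 2) (p' := (2 * n / ((n : ℝ) - 2)).toNNReal) _
      (h1.of_le (by simp)) h2 one_le_two
      (by rw [finrank_euclideanSpace_fin]; omega) (critExp_inv hn)).trans ?_
    gcongr
    calc eLpNorm (fderiv ℝ φ) 2 volume ≤ eLpNorm (∑ i, fun x => |partialD i φ x|) 2 volume := by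
          refine eLpNorm_mono_real fun x => ?_
          rw [Finset.sum_apply]
          exact norm_fderiv_le_sum φ x
      _ ≤ ∑ i, eLpNorm (fun x => |partialD i φ x|) 2 volume :=
          eLpNorm_sum_le (fun i _ => (continuous_partialD i h1).abs.aestronglyMeasurable)
            one_le_two
      _ = ∑ i, ‖(v k).d i‖ₑ := by
          refine Finset.sum_congr rfl fun i _ => ?_
          rw [Lp.enorm_def, eLpNorm_congr_ae (e i)]
          exact eLpNorm_norm (partialD i φ)
  have cfn : Tendsto (fun k => (v k).fn) atTop (𝓝 u.fn) :=
    ((Sob.fnL n 1).continuous.tendsto u).comp hvu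
  have cd : ∀ i, Tendsto (fun k => (v k).d i) atTop (𝓝 (d i)) := fun i => by
    have := (((Sob.fnL n 0).comp (sobD i)).continuous.tendsto u).comp hvu
    simp only [Function.comp_def, ContinuousLinearMap.comp_apply, Sob.fnL_apply, sobD_fn] at this
    rwa [hud] at this
  obtain ⟨ns, hns, hae⟩ := (tendstoInMeasure_of_tendsto_Lp cfn).exists_seq_tendsto_ae
  refine (Lp.eLpNorm_lim_le_liminf_eLpNorm (fun k => Lp.aestronglyMeasurable (v (ns k)).fn) _
    hae).trans ?_
  have lim : Tendsto (fun k => (C : ℝ≥0∞) * ∑ i, ‖(v (ns k)).d i‖ₑ) atTop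
      (𝓝 (C * ∑ i, ‖d i‖ₑ)) := by
    refine ENNReal.Tendsto.const_mul (tendsto_finsetSum _ fun i _ => ?_) (Or.inr (by simp))
    exact (continuous_enorm.tendsto _).comp ((cd i).comp hns.tendsto_atTop)
  rw [← lim.liminf_eq]
  exact liminf_le_liminf (Eventually.of_forall fun k => bound (ns k))

lemma memLp_critExp {n : ℕ} (hn : 3 ≤ n) {f : L2 n} {d : Fin n → L2 n}
    (hd : ∀ i, HasWeakPartial i f (d i)) : MemLp f (critExp n) volume := by
  obtain ⟨C, hC⟩ := gagliardo_nirenberg hn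
  exact ⟨Lp.aestronglyMeasurable f, (hC f d hd).trans_lt
    (ENNReal.mul_lt_top (by simp) (ENNReal.sum_lt_top.2 fun i _ => by simp))⟩

/-! ### Curl-free fields are gradients -/

/-- The weak form of `∂ⱼ f = ∂ᵢ g`. -/
def CurlFree {n : ℕ} (i j : Fin n) (f g : L2 n) : Prop :=
  ∀ φ : RN n → ℝ, ContDiff ℝ ∞ φ → HasCompactSupport φ →
    ∫ x, f x * partialD j φ x = ∫ x, g x * partialD i φ x

lemma contDiff_partialD {n : ℕ} (i : Fin n) {φ : RN n → ℝ} (hφ : ContDiff ℝ ∞ φ) :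
    ContDiff ℝ ∞ (partialD i φ) :=
  (hφ.fderiv_right (m := ∞) (by simp)).clm_apply contDiff_const

lemma partialD_comm {n : ℕ} (i j : Fin n) {φ : RN n → ℝ} (hφ : ContDiff ℝ ∞ φ) :
    partialD i (partialD j φ) = partialD j (partialD i φ) := by
  ext x
  have hd : DifferentiableAt ℝ (fderiv ℝ φ) x :=
    (hφ.fderiv_right (m := ∞) (by simp)).differentiable (by simp) x
  have e : ∀ i j : Fin n, partialD i (partialD j φ) x =
      fderiv ℝ (fderiv ℝ φ) x (EuclideanSpace.single i 1) (EuclideanSpace.single j 1) := by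
    intro i j
    have : HasFDerivAt (partialD j φ) _ x := hd.hasFDerivAt.clm_apply (hasFDerivAt_const _ x)
    rw [partialD, this.fderiv]
    simp
  rw [e, e]
  have hs : IsSymmSndFDerivAt ℝ φ x := hφ.contDiffAt.isSymmSndFDerivAt (by
    rw [minSmoothness_of_isRCLikeNormedField]; 
    change (((2 : ℕ∞) : WithTop ℕ∞)) ≤ ((⊤ : ℕ∞) : WithTop ℕ∞)
    exact WithTop.coe_le_coe.2 le_top)
  exact hs _ _

/-- Second derivatives of test functions commute, and both integrals equal minus the pairing of `ψ`
with the same mixed derivative. -/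
lemma curlFree_of_potential {n : ℕ} {i j : Fin n} {ψ : RN n → ℝ} {f g : L2 n}
    (hf : HasWeakPartial i ψ f) (hg : HasWeakPartial j ψ g) : CurlFree i j f g := by
  intro φ h1 h2
  have e1 := hf.2.2 _ (contDiff_partialD j h1) (hasCompactSupport_partialD j h2)
  have e2 := hg.2.2 _ (contDiff_partialD i h1) (hasCompactSupport_partialD i h2)
  rw [partialD_comm i j h1] at e1
  linarith

/-- The curl condition says that the field with `f` in slot `j` and `-g` in slot `i`, summed if the
slots coincide, has zero divergence; its Fourier form is then known. -/
lemma CurlFree.hat_eq {n : ℕ} {i j : Fin n} {f g : L2 n} (H : CurlFree i j f g) :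
    ∀ᵐ ξ, sym j ξ * hat f ξ = sym i ξ * hat g ξ := by
  have hw : HasWeakDiv (fun l => ((Pi.single j f - Pi.single i g : Fin n → L2 n) l : L2 n))
      (0 : L2 n) := by
    refine ⟨fun l => locallyIntegrable_lp _, locallyIntegrable_lp _, fun φ h1 h2 => ?_⟩
    have z : ∫ x, (0 : L2 n) x * φ x = 0 := by
      refine integral_eq_zero_of_ae ?_
      filter_upwards [Lp.coeFn_zero ℝ 2 (volume : Measure (RN n))] with x hx
      rw [hx]; simp
    have e := H φ h1 h2
    have it : ∀ (l : Fin n) (h : L2 n), Integrable fun x => h x * partialD l φ x := fun l h =>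
      integrable_mul_test (locallyIntegrable_lp _) (continuous_partialD l h1)
        (hasCompactSupport_partialD l h2)
    have sg : ∀ (k : Fin n) (h : L2 n),
        ∑ l, ∫ x, (Pi.single k h : Fin n → L2 n) l x * partialD l φ x =
        ∫ x, h x * partialD k φ x := fun k h => by
      rw [Finset.sum_eq_single k]
      · simp
      · intro l _ hl
        rw [Pi.single_eq_of_ne hl]
        refine integral_eq_zero_of_ae ?_
        filter_upwards [Lp.coeFn_zero ℝ 2 (volume : Measure (RN n))] with x hx
        rw [hx]; simp
      · simp
    rw [z, neg_zero, integral_finsetSum _ fun l _ => it l _]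
    have : ∀ l, ∫ x, ((Pi.single j f - Pi.single i g : Fin n → L2 n) l : L2 n) x * partialD l φ x =
        (∫ x, (Pi.single j f : Fin n → L2 n) l x * partialD l φ x) -
        ∫ x, (Pi.single i g : Fin n → L2 n) l x * partialD l φ x := fun l => by
      rw [← integral_sub (it l _) (it l _)]
      refine integral_congr_ae ?_
      rw [Pi.sub_apply]
      filter_upwards [Lp.coeFn_sub ((Pi.single j f : Fin n → L2 n) l)
        ((Pi.single i g : Fin n → L2 n) l)] with x hx
      rw [hx, Pi.sub_apply, sub_mul]
    simp_rw [this]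
    rw [Finset.sum_sub_distrib, sg, sg, e, sub_self]
  have h0 : hat (0 : L2 n) = 0 := by rw [← norm_eq_zero, norm_hat, norm_zero]
  have key := hw.hat_eq
  have hs : ∀ l, hat ((Pi.single j f - Pi.single i g : Fin n → L2 n) l) =
      hat ((Pi.single j f : Fin n → L2 n) l) - hat ((Pi.single i g : Fin n → L2 n) l) := fun l => by
    rw [Pi.sub_apply, sub_eq_add_neg, hat_add, ← neg_one_smul ℝ, hat_smul]
    simp [sub_eq_add_neg]
  simp_rw [hs] at key
  rw [h0] at key
  have hsub : ∀ᵐ ξ, ∀ l, (hat ((Pi.single j f : Fin n → L2 n) l) -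
      hat ((Pi.single i g : Fin n → L2 n) l) : L2C n) ξ =
      hat ((Pi.single j f : Fin n → L2 n) l) ξ - hat ((Pi.single i g : Fin n → L2 n) l) ξ :=
    ae_all_iff.2 fun l => Lp.coeFn_sub _ _
  filter_upwards [key, hsub, Lp.coeFn_zero ℂ 2 (volume : Measure (RN n))] with ξ k1 k2 k3
  have sg : ∀ (k : Fin n) (h : L2 n), ∑ l, sym l ξ * hat ((Pi.single k h : Fin n → L2 n) l) ξ =
      sym k ξ * hat h ξ := fun k h => by
    rw [Finset.sum_eq_single k]
    · simp
    · intro l _ hl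
      rw [Pi.single_eq_of_ne hl, h0, k3]; simp
    · simp
  simp_rw [k2, mul_sub] at k1
  rw [Finset.sum_sub_distrib, sg, sg, k3] at k1
  simpa [sub_eq_zero] using k1.symm

/-- Hölder's inequality with the conjugate exponent. This version is needed for limits in
`L^{2n/(n-2)}`. -/
lemma continuous_integral_mul_test {n : ℕ} {p : ℝ≥0∞} [Fact (1 ≤ p)] {φ : RN n → ℝ}
    (hφ : Continuous φ) (hc : HasCompactSupport φ) :
    Continuous fun f : Lp ℝ p (volume : Measure (RN n)) => ∫ x, f x * φ x := by
  have m := memLp_of_test hφ hc p.conjExponent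
  have : Fact (1 ≤ p.conjExponent) := ⟨by simp [ENNReal.conjExponent]⟩
  have e : (fun f : Lp ℝ p (volume : Measure (RN n)) => ∫ x, f x * φ x) = fun f =>
      (ContinuousLinearMap.mul ℝ ℝ).lpPairing volume p p.conjExponent f (m.toLp φ) := by
    ext f
    rw [ContinuousLinearMap.lpPairing_eq_integral]
    refine integral_congr_ae ?_
    filter_upwards [m.coeFn_toLp] with x hx
    rw [hx]; rfl
  rw [e]
  fun_prop

lemma norm_sym_le {n : ℕ} (i : Fin n) (ξ : RN n) : ‖sym i ξ‖ ^ 2 ≤ lap ξ := by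
  rw [← sum_norm_sym_sq]
  exact Finset.single_le_sum (f := fun i => ‖sym i ξ‖ ^ 2) (fun _ _ => by positivity)
    (Finset.mem_univ i)

lemma measurable_sym {n : ℕ} (i : Fin n) : Measurable (sym i : RN n → ℂ) :=
  (continuous_sym i).measurable

lemma sum_norm_sq_le {ι : Type*} [Fintype ι] (a c : ι → ℂ) :
    ‖∑ i, a i * c i‖ ^ 2 ≤ (∑ i, ‖a i‖ ^ 2) * ∑ i, ‖c i‖ ^ 2 := by
  calc ‖∑ i, a i * c i‖ ^ 2 ≤ (∑ i, ‖a i‖ * ‖c i‖) ^ 2 := by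
        gcongr
        exact (norm_sum_le _ _).trans_eq (by simp)
    _ ≤ _ := Finset.sum_mul_sq_le_sq_mul_sq _ _ _

/-- The approximate potential of a field: low frequencies are cut off. -/
lemma exists_sob_of_curlFree {n : ℕ} (G : Fin n → L2 n)
    (H : ∀ i j, CurlFree i j (G i) (G j)) {ε : ℝ} (hε : 0 < ε) :
    ∃ u : Sob n 1, ∀ (i : Fin n) (m : L2C n),
      (m =ᵐ[volume] {ξ | ε < lap ξ}.indicator (hat (G i))) → u.d i = reL (𝓕⁻ m) := by
  set S : Set (RN n) := {ξ | ε < lap ξ} with hS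
  have mS : MeasurableSet S := (isOpen_lt continuous_const continuous_lap).measurableSet
  -- A potential should satisfy `sym i * Z = Ĝᵢ`. Multiplying by `sym i`, summing and using `∑ (sym
  -- i)² = -lap` forces this `Z`; the curl condition makes it a solution. Division by `lap` is safe
  -- because frequencies with `lap ≤ ε` are removed.
  set Z : RN n → ℂ := S.indicator fun ξ => -(∑ j, sym j ξ * hat (G j) ξ) / (lap ξ : ℂ) with hZ
  have mZ : AEStronglyMeasurable Z volume := by
    refine AEStronglyMeasurable.indicator ?_ mS
    refine Measurable.aestronglyMeasurable ?_
    refine Measurable.div (Measurable.neg (Finset.measurable_fun_sum _ fun j _ =>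
      (measurable_sym j).mul (Lp.stronglyMeasurable _).measurable)) ?_
    exact Complex.measurable_ofReal.comp continuous_lap.measurable
  have bZ : ∀ ξ, (1 + lap ξ) * ‖Z ξ‖ ^ 2 ≤ (ε⁻¹ + 1) * ∑ j, ‖hat (G j) ξ‖ ^ 2 := fun ξ => by
    have nn : 0 ≤ ∑ j, ‖hat (G j) ξ‖ ^ 2 := Finset.sum_nonneg fun _ _ => by positivity
    by_cases hξ : ξ ∈ S
    · have hl : ε < lap ξ := hξ
      have l0 : 0 < lap ξ := hε.trans hl
      rw [hZ, indicator_of_mem hξ, norm_div, norm_neg, div_pow, Complex.norm_real,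
        Real.norm_of_nonneg l0.le]
      have h1 := sum_norm_sq_le (fun j => sym j ξ) (fun j => hat (G j) ξ)
      rw [sum_norm_sym_sq] at h1
      have h2 : (1 + lap ξ) / lap ξ ≤ ε⁻¹ + 1 := by
        rw [add_div, div_self l0.ne', one_div]
        gcongr
      calc (1 + lap ξ) * (‖∑ j, sym j ξ * hat (G j) ξ‖ ^ 2 / lap ξ ^ 2)
          ≤ (1 + lap ξ) * ((lap ξ * ∑ j, ‖hat (G j) ξ‖ ^ 2) / lap ξ ^ 2) := by gcongr
        _ = (1 + lap ξ) / lap ξ * ∑ j, ‖hat (G j) ξ‖ ^ 2 := by field_simp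
        _ ≤ _ := by gcongr
    · rw [hZ, indicator_of_notMem hξ]
      simp only [norm_zero]
      have : 0 ≤ ε⁻¹ := by positivity
      nlinarith
  have iS : Integrable fun ξ => (ε⁻¹ + 1) * ∑ j, ‖hat (G j) ξ‖ ^ 2 :=
    (integrable_finsetSum _ fun j _ => Lp.integrable_norm_sq (hat (G j))).const_mul _
  have iW : Integrable fun ξ => (1 + lap ξ) * ‖Z ξ‖ ^ 2 := by
    refine iS.mono' ((continuous_const.add continuous_lap).aestronglyMeasurable.mul
      (mZ.norm.pow 2)) ?_
    filter_upwards with ξ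
    rw [Real.norm_of_nonneg (mul_nonneg (by linarith [lap_nonneg ξ]) (by positivity))]
    exact bZ ξ
  have mem : MemLp Z 2 volume := by
    rw [memLp_two_iff_integrable_sq_norm mZ]
    refine iW.mono' (mZ.norm.pow 2) ?_
    filter_upwards with ξ
    rw [Real.norm_of_nonneg (by positivity)]
    nlinarith [lap_nonneg ξ, sq_nonneg ‖Z ξ‖]
  have hz := mem.coeFn_toLp
  obtain ⟨u, hu, -⟩ := exists_sob (s := 1) (mem.toLp Z) (by
    refine iW.congr ?_
    filter_upwards [hz] with ξ h
    rw [h]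
    simp [weight, Fin.sum_univ_two])
  refine ⟨u, fun i m hm => ?_⟩
  refine hu ⟨1, fun _ => i⟩ m ?_
  have hc : ∀ᵐ ξ, ∀ j, sym j ξ * hat (G i) ξ = sym i ξ * hat (G j) ξ :=
    ae_all_iff.2 fun j => (H i j).hat_eq
  filter_upwards [hm, hz, hc] with ξ h1 h2 h3
  rw [h1, h2, hZ]
  have hms : msym (fun _ : Fin ((1 : Fin (1 + 1)) : ℕ) => i) ξ = sym i ξ := by
    change ∏ _j : Fin 1, sym i ξ = _
    simp
  rw [hms]
  by_cases hξ : ξ ∈ S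
  · have hl : ε < lap ξ := hξ
    have l0 : (lap ξ : ℂ) ≠ 0 := by exact_mod_cast (hε.trans hl).ne'
    rw [indicator_of_mem hξ, indicator_of_mem hξ, mul_div_assoc', eq_div_iff l0, mul_neg,
      Finset.mul_sum]
    have : ∀ j, sym i ξ * (sym j ξ * hat (G j) ξ) = sym j ξ * sym j ξ * hat (G i) ξ := fun j => by
      rw [mul_assoc, h3 j]; ring
    simp_rw [this]
    rw [← Finset.sum_mul, sum_sym_sq]
    ring
  · rw [indicator_of_notMem hξ, indicator_of_notMem hξ, mul_zero]

/-- The excluded frequency sets shrink to `{0}`, a null set, and `‖f‖²` dominates the squared error.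
-/
lemma tendsto_indicator_hat {n : ℕ} (hn : 3 ≤ n) (f : L2C n) (m : ℕ → L2C n)
    (hm : ∀ k : ℕ, m k =ᵐ[volume] {ξ | ((k : ℝ) + 1)⁻¹ < lap ξ}.indicator f) :
    Tendsto m atTop (𝓝 f) := by
  have : Nonempty (Fin n) := ⟨⟨0, by omega⟩⟩
  rw [tendsto_iff_norm_sub_tendsto_zero]
  have hsq : Tendsto (fun k => ‖m k - f‖ ^ 2) atTop (𝓝 0) := by
    simp_rw [Lp.norm_sq_eq_integral]
    rw [← integral_zero (RN n) ℝ]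
    refine tendsto_integral_of_dominated_convergence (fun ξ => ‖f ξ‖ ^ 2)
      (fun k => (Lp.aestronglyMeasurable _).norm.pow 2) (Lp.integrable_norm_sq f) (fun k => ?_) ?_
    · filter_upwards [Lp.coeFn_sub (m k) f, hm k] with ξ h1 h2
      rw [h1, Pi.sub_apply, h2, Real.norm_of_nonneg (by positivity)]
      by_cases hξ : ξ ∈ {ξ : RN n | ((k : ℝ) + 1)⁻¹ < lap ξ}
      · rw [indicator_of_mem hξ]; simp
      · rw [indicator_of_notMem hξ]; simp
    · have h0 : ∀ᵐ ξ : RN n, ξ ≠ 0 := by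
        rw [ae_iff]; simp
      filter_upwards [ae_all_iff.2 fun k => Lp.coeFn_sub (m k) f, ae_all_iff.2 hm, h0]
        with ξ h1 h2 h3
      have hl : 0 < lap ξ := by
        have := norm_pos_iff.2 h3
        unfold lap; positivity
      have t : Tendsto (fun k : ℕ => ((k : ℝ) + 1)⁻¹) atTop (𝓝 0) := tendsto_inv_atTop_zero.comp
        (tendsto_natCast_atTop_atTop.atTop_add tendsto_const_nhds)
      refine tendsto_const_nhds.congr' ?_
      filter_upwards [t.eventually (gt_mem_nhds hl)] with k hk
      have hξ : ξ ∈ {ξ : RN n | ((k : ℝ) + 1)⁻¹ < lap ξ} := hk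
      rw [h1, Pi.sub_apply, h2, indicator_of_mem hξ]; simp
  have := (Real.continuous_sqrt.tendsto 0).comp hsq
  simpa [Function.comp_def] using this

/-- The approximate potentials `u k` lie in `H¹` and their gradients converge to `G` in `L²`. The
Sobolev inequality applied to differences makes them Cauchy in `L^{2n/(n-2)}`. Their `L²` norms need
not stay bounded, so the limit is taken in the critical space, where the weak derivative identities
survive. -/
theorem exists_potential {n : ℕ} (hn : 3 ≤ n) (G : Fin n → L2 n)
    (H : ∀ i j, CurlFree i j (G i) (G j)) :
    ∃ ψ : RN n → ℝ, MemLp ψ (critExp n) volume ∧ ∀ i, HasWeakPartial i ψ (G i) := by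
  have hp : Fact (1 ≤ critExp n) := ⟨one_le_critExp hn⟩
  choose u hu using fun k : ℕ => exists_sob_of_curlFree G H (ε := ((k : ℝ) + 1)⁻¹) (by positivity)
  have mS : ∀ k : ℕ, MeasurableSet {ξ : RN n | ((k : ℝ) + 1)⁻¹ < lap ξ} := fun k =>
    (isOpen_lt continuous_const continuous_lap).measurableSet
  have cd : ∀ i, Tendsto (fun k => (u k).d i) atTop (𝓝 (G i)) := fun i => by
    have hm : ∀ k : ℕ, MemLp ({ξ | ((k : ℝ) + 1)⁻¹ < lap ξ}.indicator (hat (G i))) 2 volume :=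
      fun k => (Lp.memLp (hat (G i))).indicator (mS k)
    have t := tendsto_indicator_hat hn (hat (G i)) (fun k => (hm k).toLp)
      (fun k => (hm k).coeFn_toLp)
    have e : ∀ k, (u k).d i = reL (𝓕⁻ ((hm k).toLp)) := fun k => hu k i _ (hm k).coeFn_toLp
    simp_rw [e]
    have c : Continuous fun z : L2C n => reL (𝓕⁻ z) :=
      reL.continuous.comp (Lp.fourierTransformₗᵢ (RN n) ℂ).symm.continuous
    have := (c.tendsto _).comp t
    rwa [reL_fourierInv_hat] at this
  obtain ⟨C, hC⟩ := gagliardo_nirenberg hn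
  have mem : ∀ k, MemLp (u k).fn (critExp n) volume := fun k =>
    memLp_critExp hn fun i => (u k).hasWeakPartial i
  set Q : ℕ → Lp ℝ (critExp n) (volume : Measure (RN n)) := fun k => (mem k).toLp _ with hQ
  have hdist : ∀ k l, edist (Q k) (Q l) ≤ C * ∑ i, edist ((u k).d i) ((u l).d i) := fun k l => by
    rw [Lp.edist_toLp_toLp]
    have h1 := hC (u k - u l).fn (fun i => (u k - u l).d i) fun i => (u k - u l).hasWeakPartial i
    rw [Sob.fn_sub, eLpNorm_congr_ae (Lp.coeFn_sub _ _)] at h1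
    refine h1.trans_eq ?_
    congr 1
    refine Finset.sum_congr rfl fun i _ => ?_
    rw [edist_eq_enorm_sub]; rfl
  have hcau : CauchySeq Q := by
    have hd : ∀ i, CauchySeq fun k => (u k).d i := fun i => (cd i).cauchySeq
    rw [EMetric.cauchySeq_iff]
    intro ε hε
    -- The increments of `C` and `n` avoid division by zero and make the final inequality strict.
    have hδ : 0 < ε / ((C + 1) * (n + 1)) := by
      refine ENNReal.div_pos hε.ne' (by finiteness)
    have : ∀ i, ∃ N, ∀ k, N ≤ k → ∀ l, N ≤ l →
        edist ((u k).d i) ((u l).d i) < ε / ((C + 1) * (n + 1)) := fun i => by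
      obtain ⟨N, hN⟩ := EMetric.cauchySeq_iff.1 (hd i) _ hδ
      exact ⟨N, fun k hk l hl => hN k hk l hl⟩
    choose N hN using this
    refine ⟨Finset.univ.sup N, fun k hk l hl => ?_⟩
    rcases eq_or_ne ε ⊤ with rfl | hεt
    · exact edist_lt_top _ _
    refine (hdist k l).trans_lt ?_
    calc (C : ℝ≥0∞) * ∑ i, edist ((u k).d i) ((u l).d i)
        ≤ C * ∑ _i : Fin n, ε / ((C + 1) * (n + 1)) := by
          gcongr with i
          exact (hN i k ((Finset.le_sup (Finset.mem_univ i)).trans hk) l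
            ((Finset.le_sup (Finset.mem_univ i)).trans hl)).le
      _ = C * n * (ε / ((C + 1) * (n + 1))) := by simp [mul_assoc]
      _ < (C + 1) * (n + 1) * (ε / ((C + 1) * (n + 1))) := by
          refine ENNReal.mul_lt_mul_left hδ.ne' (ENNReal.div_ne_top hεt (by simp)) ?_
          exact_mod_cast (by nlinarith [C.2, (Nat.cast_nonneg n : (0 : NNReal) ≤ n)] :
            (C : NNReal) * n < (C + 1) * (n + 1))
      _ = ε := ENNReal.mul_div_cancel (by simp) (by finiteness)
  obtain ⟨ψ, hψ⟩ := cauchySeq_tendsto_of_complete hcau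
  refine ⟨ψ, Lp.memLp ψ, fun i => ⟨(Lp.memLp ψ).locallyIntegrable hp.out,
    locallyIntegrable_lp _, fun φ h1 h2 => ?_⟩⟩
  have t1 := ((continuous_integral_mul_test (p := critExp n) (continuous_partialD i h1)
    (hasCompactSupport_partialD i h2)).tendsto ψ).comp hψ
  have t2 := (((continuous_integral_mul_test (p := 2) h1.continuous h2).tendsto (G i)).comp
    (cd i)).neg
  refine tendsto_nhds_unique t1 (t2.congr fun k => ?_)
  have := ((u k).hasWeakPartial i).2.2 φ h1 h2
  simp only [Function.comp_apply]
  rw [← this]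
  refine integral_congr_ae ?_
  filter_upwards [(mem k).coeFn_toLp] with x hx
  rw [hx]

/-! ### The space `Hom` -/

/-- The right-hand side mentions no potential and consists of identities continuous in `G`.
Closedness, and with it completeness of `Hom`, follows. -/
lemma mem_homSubmodule_iff {n s : ℕ} (hn : 3 ≤ n) (G : PiLp 2 (fun _ : Fin n => Sob n s)) :
    G ∈ homSubmodule n s ↔ ∀ i j, CurlFree i j (G i).fn (G j).fn := by
  constructor
  · rintro ⟨ψ, -, h⟩ i j
    exact curlFree_of_potential (h i) (h j)
  · intro h
    obtain ⟨ψ, h1, h2⟩ := exists_potential hn (fun i => (G i).fn) h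
    exact ⟨ψ, h1, h2⟩

lemma isClosed_homSubmodule {n s : ℕ} (hn : 3 ≤ n) :
    IsClosed (homSubmodule n s : Set (PiLp 2 (fun _ : Fin n => Sob n s))) := by
  have e : (homSubmodule n s : Set (PiLp 2 (fun _ : Fin n => Sob n s))) =
      ⋂ (i : Fin n) (j : Fin n) (φ : RN n → ℝ) (_ : ContDiff ℝ ∞ φ) (_ : HasCompactSupport φ),
        {G | ∫ x, (G i).fn x * partialD j φ x = ∫ x, (G j).fn x * partialD i φ x} := by
    ext G
    simp only [mem_iInter]
    exact mem_homSubmodule_iff hn G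
  rw [e]
  refine isClosed_iInter fun i => isClosed_iInter fun j => isClosed_iInter fun φ =>
    isClosed_iInter fun h1 => isClosed_iInter fun h2 => ?_
  have c : ∀ i j : Fin n, Continuous fun G : PiLp 2 (fun _ : Fin n => Sob n s) =>
      ∫ x, (G i).fn x * partialD j φ x := fun i j =>
    (continuous_integral_mul (memLp_of_test (continuous_partialD j h1)
      (hasCompactSupport_partialD j h2) 2)).comp
      ((Sob.fnL n s).continuous.comp (PiLp.continuous_apply 2 _ i))
  exact isClosed_eq (c i j) (c j i)

lemma completeSpace_hom {n s : ℕ} (hn : 3 ≤ n) : CompleteSpace (Hom n s) :=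
  (isClosed_homSubmodule hn).completeSpace_coe

lemma Hom.norm_sq_eq {n s : ℕ} (ψ : Hom n s) : ‖ψ‖ ^ 2 = ∑ i, ‖ψ.1 i‖ ^ 2 :=
  PiLp.norm_sq_eq_of_L2 _ ψ.1

lemma Hom.inner_eq {n s : ℕ} (ψ χ : Hom n s) : inner ℝ ψ χ = ∑ i, inner ℝ (ψ.1 i) (χ.1 i) :=
  PiLp.inner_apply ψ.1 χ.1

lemma Hom.ext_d {n s : ℕ} {ψ χ : Hom n s} (h : ∀ i, ψ.d i = χ.d i) : ψ = χ :=
  Subtype.ext (PiLp.ext fun i => Sob.ext_fn (h i))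

lemma Hom.Is.unique {n s : ℕ} {ψ χ : Hom n s} {f : RN n → ℝ} (h : ψ.Is f) (h' : χ.Is f) : ψ = χ :=
  Hom.ext_d fun i => Lp.ext ((h.2 i).d_unique (h'.2 i))

/-- An element of `H^{s+1}` as an element of `Hom n s`. -/
def grad {n : ℕ} (hn : 3 ≤ n) (s : ℕ) : Sob n (s + 1) →L[ℝ] Hom n s :=
  LinearMap.mkContinuous
    { toFun := fun v => ⟨WithLp.toLp 2 fun i => sobD i v, v.fn,
        memLp_critExp hn fun i => v.hasWeakPartial i, fun i => by
          change HasWeakPartial i v.fn (sobD i v).fn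
          rw [sobD_fn]
          exact v.hasWeakPartial i⟩
      map_add' := fun u v => Subtype.ext <| PiLp.ext fun i => (sobD i).map_add u v
      map_smul' := fun a v => Subtype.ext <| PiLp.ext fun i => (sobD i).map_smul a v } 1 fun v => by
    rw [one_mul]
    refine le_of_sq_le_sq ?_ (norm_nonneg _)
    rw [v.norm_sq_succ, Hom.norm_sq_eq]
    exact le_add_of_nonneg_left (by positivity)

lemma grad_is {n : ℕ} (hn : 3 ≤ n) {s : ℕ} (v : Sob n (s + 1)) : (grad hn s v).Is v.fn :=
  ⟨memLp_critExp hn fun i => v.hasWeakPartial i, fun i => by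
    change HasWeakPartial i v.fn (sobD i v).fn
    rw [sobD_fn]; exact v.hasWeakPartial i⟩

lemma norm_sq_grad {n : ℕ} (hn : 3 ≤ n) {s : ℕ} (v : Sob n (s + 1)) :
    ‖v‖ ^ 2 = ‖v.fn‖ ^ 2 + ‖grad hn s v‖ ^ 2 := by
  rw [v.norm_sq_succ, Hom.norm_sq_eq]; rfl

/-! ### Integration by parts and an elliptic equation -/

lemma HasWeakDiv.congr {n : ℕ} {q q₁ : Fin n → RN n → ℝ} {h h₁ : RN n → ℝ}
    (H : HasWeakDiv q h) (hq : ∀ i, q i =ᵐ[volume] q₁ i) (hh : h =ᵐ[volume] h₁) :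
    HasWeakDiv q₁ h₁ := by
  refine ⟨fun i => (H.1 i).congr (hq i), H.2.1.congr hh, fun φ h1 h2 => ?_⟩
  have e1 : ∫ x, ∑ i, q₁ i x * partialD i φ x = ∫ x, ∑ i, q i x * partialD i φ x := by
    refine integral_congr_ae ?_
    filter_upwards [ae_all_iff.2 hq] with x hx
    simp_rw [hx]
  have e2 : ∫ x, h₁ x * φ x = ∫ x, h x * φ x :=
    integral_congr_ae (hh.symm.mul (EventuallyEq.refl _ φ))
  rw [e1, e2, H.2.2 φ h1 h2]

lemma HasWeakDiv.unique {n : ℕ} {q : Fin n → RN n → ℝ} {h h' : RN n → ℝ} (H : HasWeakDiv q h)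
    (H' : HasWeakDiv q h') : h =ᵐ[volume] h' := by
  refine ae_eq_of_integral_contDiff_smul_eq H.2.1 H'.2.1 fun φ h1 h2 => ?_
  simp_rw [smul_eq_mul, mul_comm (φ _)]
  linarith [H.2.2 φ h1 h2, H'.2.2 φ h1 h2]

lemma Sob.coord_inner_ae {n s : ℕ} (u v : Sob n s) (p : DIdx n s) :
    (fun ξ => hat (v.1 p) ξ * starRingEnd ℂ (hat (u.1 p) ξ)) =ᵐ[volume] fun ξ =>
      ((‖msym p.2 ξ‖ ^ 2 : ℝ) : ℂ) * (hat v.fn ξ * starRingEnd ℂ (hat u.fn ξ)) := by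
  filter_upwards [u.hat_coord p, v.hat_coord p] with ξ h1 h2
  rw [h1, h2, map_mul, ← Complex.normSq_eq_norm_sq, ← Complex.mul_conj]
  ring

lemma integrable_mul_conj {n : ℕ} (f g : L2C n) :
    Integrable fun ξ => g ξ * starRingEnd ℂ (f ξ) := by
  have := L2.integrable_inner (𝕜 := ℂ) f g
  exact this

lemma Sob.integrable_inner {n s : ℕ} (u v : Sob n s) :
    Integrable fun ξ => (weight s ξ : ℂ) * (hat v.fn ξ * starRingEnd ℂ (hat u.fn ξ)) := by
  simp_rw [← sum_norm_msym_sq, Complex.ofReal_sum, Finset.sum_mul]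
  exact integrable_finsetSum _ fun p _ =>
    (integrable_mul_conj (hat (u.1 p)) (hat (v.1 p))).congr (u.coord_inner_ae v p)

lemma Sob.inner_eq_re_integral {n s : ℕ} (u v : Sob n s) : inner ℝ u v =
    (∫ ξ, (weight s ξ : ℂ) * (hat v.fn ξ * starRingEnd ℂ (hat u.fn ξ))).re := by
  simp_rw [← sum_norm_msym_sq, Complex.ofReal_sum, Finset.sum_mul]
  rw [integral_finsetSum _ fun p _ => (integrable_mul_conj (hat (u.1 p)) (hat (v.1 p))).congr
    (u.coord_inner_ae v p), Complex.re_sum, Sob.inner_eq_sum]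
  refine Finset.sum_congr rfl fun p _ => ?_
  rw [inner_eq_re_integral_hat, integral_congr_ae (u.coord_inner_ae v p)]

lemma conj_sym {n : ℕ} (i : Fin n) (ξ : RN n) : starRingEnd ℂ (sym i ξ) = -sym i ξ := by
  have : starRingEnd ℂ (2 : ℂ) = 2 := Complex.conj_ofNat 2
  simp [sym, this]

/-- Integration by parts in `H^s`. -/
theorem inner_div_eq {n s : ℕ} (w : Sob n (s + 1)) (q : Fin n → Sob n s) (h : Sob n s)
    (H : HasWeakDiv (fun i => (q i).fn) h.fn) :
    inner ℝ (sobRes n s w) h = -∑ i, inner ℝ (sobD i w) (q i) := by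
  simp_rw [Sob.inner_eq_re_integral]
  rw [← Complex.re_sum, ← Complex.neg_re, ← integral_finsetSum _ fun i _ =>
    (sobD i w).integrable_inner (q i), ← integral_neg]
  congr 1
  refine integral_congr_ae ?_
  have hd : ∀ᵐ ξ, ∀ i, hat (sobD i w).fn ξ = sym i ξ * hat w.fn ξ := ae_all_iff.2 fun i => by
    rw [sobD_fn]; exact w.hat_d i
  filter_upwards [H.hat_eq, hd] with ξ h1 h2
  rw [h1, sobRes_fn]
  simp_rw [h2, map_mul, conj_sym]
  rw [Finset.sum_mul, Finset.mul_sum, ← Finset.sum_neg_distrib]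
  refine Finset.sum_congr rfl fun i _ => ?_
  ring

/-- The elliptic equation `αv - κΔv = div F + h` has a solution in `H^{s+1}`. -/
theorem exists_elliptic {n s : ℕ} {α κ : ℝ} (hα : 0 < α) (hκ : 0 < κ) (F : Fin n → Sob n s)
    (h : Sob n s) : ∃ v : Sob n (s + 1),
      HasWeakDiv (fun i x => κ * v.d i x + (F i).fn x) (α • v.fn - h.fn : L2 n) := by
  set D : RN n → ℝ := fun ξ => α + κ * lap ξ with hD
  have D0 : ∀ ξ, 0 < D ξ := fun ξ => by
    have := mul_nonneg hκ.le (lap_nonneg ξ); simp only [hD]; linarith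
  have cD : Continuous D := continuous_const.add (continuous_const.mul continuous_lap)
  -- Taking transforms in `αv - κΔv = div F + h` gives `D v̂ = N`. The numerator grows by at most
  -- one power of `|ξ|`, while the denominator is quadratic, so one derivative is gained.
  set N : RN n → ℂ := fun ξ => hat h.fn ξ + ∑ j, sym j ξ * hat (F j).fn ξ with hN
  set Z : RN n → ℂ := fun ξ => N ξ / (D ξ : ℂ) with hZ
  have mZ : AEStronglyMeasurable Z volume := by
    refine Measurable.aestronglyMeasurable ?_
    refine Measurable.div ((Lp.stronglyMeasurable _).measurable.add
      (Finset.measurable_fun_sum _ fun j _ =>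
      (measurable_sym j).mul (Lp.stronglyMeasurable _).measurable)) ?_
    exact Complex.measurable_ofReal.comp cD.measurable
  -- Expanding `(α⁻¹ + κ⁻¹)(α + κ lap)` produces `1 + lap` plus nonnegative terms, so `1 + lap ≤ K
  -- D`.
  set K : ℝ := α⁻¹ + κ⁻¹ with hK
  have K0 : 0 < K := by positivity
  have hKD : ∀ ξ, (1 + lap ξ) ≤ K * D ξ := fun ξ => by
    have := lap_nonneg ξ
    simp only [hK, hD]
    have e : (α⁻¹ + κ⁻¹) * (α + κ * lap ξ) =
        1 + lap ξ + (α⁻¹ * (κ * lap ξ) + κ⁻¹ * α) := by field_simp; ring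
    rw [e]
    have : 0 ≤ α⁻¹ * (κ * lap ξ) + κ⁻¹ * α := by positivity
    linarith
  have bZ : ∀ ξ, weight (s + 1) ξ * ‖Z ξ‖ ^ 2 ≤ 2 * K ^ 2 *
      (weight s ξ * ‖hat h.fn ξ‖ ^ 2 + ∑ j, weight s ξ * ‖hat (F j).fn ξ‖ ^ 2) := fun ξ => by
    have l0 := lap_nonneg ξ
    have w1 := one_le_weight s ξ
    set Y : ℝ := ‖hat h.fn ξ‖ ^ 2 + ∑ j, ‖hat (F j).fn ξ‖ ^ 2 with hY
    have hY1 : 0 ≤ ∑ j, ‖hat (F j).fn ξ‖ ^ 2 := Finset.sum_nonneg fun _ _ => by positivity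
    have Y0 : 0 ≤ Y := by positivity
    have hNb : ‖N ξ‖ ^ 2 ≤ 2 * (1 + lap ξ) * Y := by
      have h1 := sum_norm_sq_le (fun j => sym j ξ) (fun j => hat (F j).fn ξ)
      rw [sum_norm_sym_sq] at h1
      have h2 : ‖N ξ‖ ≤ ‖hat h.fn ξ‖ + ‖∑ j, sym j ξ * hat (F j).fn ξ‖ := norm_add_le _ _
      have h3 : ‖N ξ‖ ^ 2 ≤ 2 * (‖hat h.fn ξ‖ ^ 2 + ‖∑ j, sym j ξ * hat (F j).fn ξ‖ ^ 2) :=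
        (pow_le_pow_left₀ (norm_nonneg _) h2 2).trans (add_sq_le)
      nlinarith [sq_nonneg ‖hat h.fn ξ‖]
    have hw : weight (s + 1) ξ ≤ (1 + lap ξ) * weight s ξ := by
      rw [weight_succ]; nlinarith
    have hZn : ‖Z ξ‖ ^ 2 = ‖N ξ‖ ^ 2 / D ξ ^ 2 := by
      rw [hZ, norm_div, div_pow, Complex.norm_real, Real.norm_of_nonneg (D0 ξ).le]
    rw [hZn, ← Finset.mul_sum, ← mul_add, ← hY]
    calc weight (s + 1) ξ * (‖N ξ‖ ^ 2 / D ξ ^ 2)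
        ≤ ((1 + lap ξ) * weight s ξ) * ((2 * (1 + lap ξ) * Y) / D ξ ^ 2) := by gcongr
      _ = 2 * ((1 + lap ξ) ^ 2 / D ξ ^ 2) * (weight s ξ * Y) := by ring
      _ ≤ 2 * K ^ 2 * (weight s ξ * Y) := by
          have : (1 + lap ξ) ^ 2 / D ξ ^ 2 ≤ K ^ 2 := by
            rw [div_le_iff₀ (by have := D0 ξ; positivity), ← mul_pow]
            exact pow_le_pow_left₀ (by positivity) (hKD ξ) 2
          have : 0 ≤ weight s ξ * Y := mul_nonneg (weight_pos s ξ).le Y0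
          gcongr
  have iW : Integrable fun ξ => weight (s + 1) ξ * ‖Z ξ‖ ^ 2 := by
    refine ((h.integrable_weight.add (integrable_finsetSum Finset.univ fun j _ =>
      (F j).integrable_weight)).const_mul (2 * K ^ 2)).mono'
      ((continuous_weight _).aestronglyMeasurable.mul (mZ.norm.pow 2)) ?_
    filter_upwards with ξ
    rw [Real.norm_of_nonneg (mul_nonneg (weight_pos _ ξ).le (by positivity))]
    simpa using bZ ξ
  have mem : MemLp Z 2 volume := by
    rw [memLp_two_iff_integrable_sq_norm mZ]
    refine iW.mono' (mZ.norm.pow 2) ?_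
    filter_upwards with ξ
    rw [Real.norm_of_nonneg (by positivity)]
    nlinarith [one_le_weight (s + 1) ξ, sq_nonneg ‖Z ξ‖]
  have hz := mem.coeFn_toLp
  set z : L2C n := mem.toLp Z with hzdef
  have iz : Integrable fun ξ => weight (s + 1) ξ * ‖z ξ‖ ^ 2 := by
    refine iW.congr ?_
    filter_upwards [hz] with ξ h
    rw [h]
  obtain ⟨v, hv, -⟩ := exists_sob z iz
  have mm : ∀ i, MemLp (fun ξ => sym i ξ * z ξ) 2 volume := fun i =>
    memLp_mul_of_integrable (continuous_sym i) (fun ξ => (norm_sym_le i ξ).trans (by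
      rw [weight_succ]; nlinarith [lap_nonneg ξ, one_le_weight s ξ])) iz
  have v0 : v.fn = reL (𝓕⁻ z) := hv _ z (by filter_upwards with ξ; simp [msym])
  have vd : ∀ i, v.d i = reL (𝓕⁻ ((mm i).toLp)) := fun i => by
    refine hv ⟨⟨1, by omega⟩, fun _ => i⟩ _ ?_
    have hms : ∀ ξ, msym (fun _ : Fin 1 => i) ξ = sym i ξ := fun ξ => by simp [msym]
    filter_upwards [(mm i).coeFn_toLp] with ξ h
    rw [h]
    exact congrArg (· * z ξ) (hms ξ).symm
  refine ⟨v, ?_⟩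
  have key := hasWeakDiv_reL (q := fun i => 𝓕⁻ ((κ : ℂ) • (mm i).toLp + hat (F i).fn))
    (h := 𝓕⁻ ((α : ℂ) • z - hat h.fn)) (by
      simp_rw [FourierTransform.fourier_fourierInv_eq]
      have a1 := ae_all_iff.2 fun i => (Lp.coeFn_add ((κ : ℂ) • (mm i).toLp) (hat (F i).fn))
      have a2 := ae_all_iff.2 fun i => (Lp.coeFn_smul (κ : ℂ) ((mm i).toLp))
      have a3 := ae_all_iff.2 fun i => (mm i).coeFn_toLp
      filter_upwards [Lp.coeFn_sub ((α : ℂ) • z) (hat h.fn), Lp.coeFn_smul (α : ℂ) z, hz,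
        a1, a2, a3] with ξ h1 h2 h3 h4 h5 h6
      rw [h1, Pi.sub_apply, h2, Pi.smul_apply]
      simp_rw [h4, Pi.add_apply, h5, Pi.smul_apply, h6, smul_eq_mul, mul_add]
      rw [Finset.sum_add_distrib]
      have e1 : ∑ i, sym i ξ * ((κ : ℂ) * (sym i ξ * z ξ)) = -(κ * lap ξ * z ξ : ℂ) := by
        have : ∀ i, sym i ξ * ((κ : ℂ) * (sym i ξ * z ξ)) =
          (sym i ξ * sym i ξ) * (κ * z ξ) := fun i => by ring
        simp_rw [this]
        rw [← Finset.sum_mul, sum_sym_sq]; ring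
      have hDz : (D ξ : ℂ) * z ξ = N ξ := by
        rw [h3, hZ]
        field_simp [show (D ξ : ℂ) ≠ 0 by exact_mod_cast (D0 ξ).ne']
      rw [e1]
      simp only [hD, hN] at hDz
      push_cast at hDz
      linear_combination hDz)
  have rsm : ∀ (a : ℝ) (y : L2C n), reL ((a : ℂ) • y) = a • reL y := fun a y => by
    rw [← map_smul]
    congr 1
  refine key.congr (fun i => ?_) ?_
  · have : reL (𝓕⁻ ((κ : ℂ) • (mm i).toLp + hat (F i).fn)) = κ • v.d i + (F i).fn := by
      rw [FourierTransform.fourierInv_add, FourierTransform.fourierInv_smul, map_add, rsm, vd,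
        reL_fourierInv_hat]
    simp only [this]
    filter_upwards [Lp.coeFn_add (κ • v.d i) (F i).fn, Lp.coeFn_smul κ (v.d i)] with x h1 h2
    rw [h1, Pi.add_apply, h2]; simp
  · have : reL (𝓕⁻ ((α : ℂ) • z - hat h.fn)) = α • v.fn - h.fn := by
      have : (𝓕⁻ ((α : ℂ) • z - hat h.fn) : L2C n) = (α : ℂ) • 𝓕⁻ z - 𝓕⁻ (hat h.fn) := by
        rw [sub_eq_add_neg, ← neg_one_smul ℂ, FourierTransform.fourierInv_add,
          FourierTransform.fourierInv_smul, FourierTransform.fourierInv_smul, neg_one_smul,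
          ← sub_eq_add_neg]
      rw [this, map_sub, rsm, v0, reL_fourierInv_hat]
    rw [this]

/-! ### The memory kernel and its measure -/

section Kernel

variable {c : ℝ} {g dg : ℝ → ℝ}

lemma IsMemoryKernel.deriv_nonpos (hg : IsMemoryKernel c g dg) {s : ℝ} (hs : 0 < s) :
    dg s ≤ 0 := by
  obtain ⟨ζ, hζ, h⟩ := hg.decay
  nlinarith [h s hs, hg.nonneg s hs]

/-- By convexity the set where `g' < 0` is an initial interval of `(0,∞)`. Hence almost every
statement for the history measure at `r` also controls Lebesgue almost all earlier times. -/
lemma IsMemoryKernel.deriv_neg_mono (hg : IsMemoryKernel c g dg) {r y : ℝ} (hr : dg r < 0)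
    (hy : 0 < y) (hyr : y ≤ r) : dg y < 0 :=
  (hg.convex (mem_Ioi.2 hy) (mem_Ioi.2 (hy.trans_le hyr)) hyr).trans_lt hr

lemma IsMemoryKernel.aemeasurable (hg : IsMemoryKernel c g dg) :
    AEMeasurable (fun s => ENNReal.ofReal (-dg s)) (volume.restrict (Ioi 0)) :=
  hg.integrable_deriv.aestronglyMeasurable.aemeasurable.neg.ennreal_ofReal

lemma IsMemoryKernel.isFiniteMeasure (hg : IsMemoryKernel c g dg) :
    IsFiniteMeasure (histMeasure dg) :=
  isFiniteMeasure_withDensity_ofReal hg.integrable_deriv.neg.2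

lemma IsMemoryKernel.ae_hist_iff (hg : IsMemoryKernel c g dg) {P : ℝ → Prop} :
    (∀ᵐ r ∂(histMeasure dg), P r) ↔ ∀ᵐ r, 0 < r → dg r < 0 → P r := by
  rw [histMeasure, ae_withDensity_iff' hg.aemeasurable, ae_restrict_iff' measurableSet_Ioi]
  refine eventually_congr (Eventually.of_forall fun r => ?_)
  refine forall_congr' fun _ => ?_
  rw [ne_eq, ENNReal.ofReal_eq_zero, not_le, neg_pos]

lemma IsMemoryKernel.ae_good (hg : IsMemoryKernel c g dg) :
    ∀ᵐ r ∂(histMeasure dg), 0 < r ∧ dg r < 0 :=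
  hg.ae_hist_iff.2 (Eventually.of_forall fun _ h1 h2 => ⟨h1, h2⟩)

/-- `g` has a limit at infinity because `g'` is integrable, and the limit is zero because `g` itself
is integrable. -/
lemma IsMemoryKernel.tail (hg : IsMemoryKernel c g dg) {y : ℝ} (hy : 0 < y) :
    ∫ s in Ioi y, -dg s = g y := by
  have hi : IntegrableOn dg (Ioi y) := hg.integrable_deriv.mono_set (Ioi_subset_Ioi hy.le)
  have t : Tendsto (fun t => g t) atTop (𝓝 (g y + ∫ s in Ioi y, dg s)) := by
    refine ((intervalIntegral_tendsto_integral_Ioi y hi tendsto_id).const_add (g y)).congr' ?_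
    filter_upwards [eventually_ge_atTop y] with t ht
    rw [id, ← hg.ftc y t hy ht]; ring
  have h0 : g y + ∫ s in Ioi y, dg s = 0 := by
    by_contra hne
    set L := g y + ∫ s in Ioi y, dg s
    have hL : 0 ≤ L := ge_of_tendsto t (by
      filter_upwards [eventually_gt_atTop 0] with s hs using hg.nonneg s hs)
    have hL' : 0 < L := lt_of_le_of_ne hL (Ne.symm hne)
    obtain ⟨N, hN⟩ := (eventually_atTop.1 ((t.eventually (lt_mem_nhds (half_lt_self hL'))).and
      (eventually_gt_atTop 0)))
    have hgi : IntegrableOn g (Ioi (max N 1)) :=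
      hg.integrable.mono_set (Ioi_subset_Ioi (by simp))
    have hci : IntegrableOn (fun _ : ℝ => L / 2) (Ioi (max N 1)) := by
      refine hgi.mono' aestronglyMeasurable_const ?_
      rw [ae_restrict_iff' measurableSet_Ioi]
      filter_upwards with s hs
      rw [Real.norm_of_nonneg (by positivity)]
      exact (hN s ((le_max_left _ _).trans (le_of_lt hs))).1.le
    rw [integrableOn_const_iff] at hci
    rcases hci with h | h
    · simp at h; exact hne h
    · simp at h
  rw [integral_neg]
  linarith

/-- From `g' ≤ -ζ g`. It dominates the memory integral by the history norm, and it shows that `g`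
vanishes wherever `g'` does, so values not seen by the history measure never contribute. -/
lemma IsMemoryKernel.le_deriv (hg : IsMemoryKernel c g dg) :
    ∃ K : ℝ, 0 ≤ K ∧ ∀ s, 0 < s → g s ≤ K * (-dg s) := by
  obtain ⟨ζ, hζ, h⟩ := hg.decay
  refine ⟨ζ⁻¹, by positivity, fun s hs => ?_⟩
  rw [← div_eq_inv_mul, le_div_iff₀ hζ]
  linarith [h s hs]

/-- Lebesgue measure on `(0,r]` is dominated by the measure `-g'(s) ds`. -/
lemma IsMemoryKernel.smul_restrict_le (hg : IsMemoryKernel c g dg) {r : ℝ} (hr : 0 < r) :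
    ENNReal.ofReal (-dg r) • (volume.restrict (Ioc 0 r)) ≤ histMeasure dg := by
  refine Measure.le_iff.2 fun A hA => ?_
  rw [histMeasure, withDensity_apply _ hA, Measure.smul_apply, Measure.restrict_apply hA,
    Measure.restrict_restrict hA, smul_eq_mul]
  calc ENNReal.ofReal (-dg r) * volume (A ∩ Ioc 0 r)
      = ∫⁻ _ in A ∩ Ioc 0 r, ENNReal.ofReal (-dg r) := by simp
    _ ≤ ∫⁻ s in A ∩ Ioc 0 r, ENNReal.ofReal (-dg s) := by
        refine setLIntegral_mono' (hA.inter measurableSet_Ioc) fun s hs => ?_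
        refine ENNReal.ofReal_le_ofReal (neg_le_neg ?_)
        exact hg.convex (mem_Ioi.2 hs.2.1) (mem_Ioi.2 hr) hs.2.2
    _ ≤ ∫⁻ s in A ∩ Ioi 0, ENNReal.ofReal (-dg s) :=
        lintegral_mono_set (inter_subset_inter_right A Ioc_subset_Ioi_self)

variable {E : Type*} [NormedAddCommGroup E]

lemma IsMemoryKernel.integrable_hist (hg : IsMemoryKernel c g dg) (ξ : Lp E 2 (histMeasure dg)) :
    Integrable ξ (histMeasure dg) := by
  have := hg.isFiniteMeasure
  exact (Lp.memLp ξ).integrable one_le_two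

lemma IsMemoryKernel.integrableOn_of_integrable (hg : IsMemoryKernel c g dg) {ξ : ℝ → E}
    (hξ : Integrable ξ (histMeasure dg)) {r : ℝ} (hr : 0 < r) (hd : dg r < 0) :
    IntegrableOn ξ (Ioc 0 r) := by
  have h := hξ.mono_measure (hg.smul_restrict_le hr)
  rwa [integrable_smul_measure (by simpa using hd) ENNReal.ofReal_ne_top] at h

lemma IsMemoryKernel.intervalIntegrable (hg : IsMemoryKernel c g dg) {ξ : ℝ → E}
    (hξ : Integrable ξ (histMeasure dg)) {r : ℝ} (hr : 0 < r) (hd : dg r < 0) :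
    IntervalIntegrable ξ volume 0 r :=
  (intervalIntegrable_iff_integrableOn_Ioc_of_le hr.le).2 (hg.integrableOn_of_integrable hξ hr hd)

/-- Cauchy–Schwarz for a finite measure. -/
lemma IsMemoryKernel.integral_norm_le (hg : IsMemoryKernel c g dg)
    (ξ : Lp E 2 (histMeasure dg)) :
    ∫ s, ‖ξ s‖ ∂(histMeasure dg) ≤ √((histMeasure dg).real univ) * ‖ξ‖ := by
  have := hg.isFiniteMeasure
  refine le_of_sq_le_sq ?_ (by positivity)
  rw [mul_pow, Real.sq_sqrt measureReal_nonneg, Lp.norm_sq_eq_integral]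
  have h := lintegral_mul_sq_le (histMeasure dg) (a := fun _ => 1) (b := fun s => ‖ξ s‖ₑ)
    aemeasurable_const (Lp.stronglyMeasurable ξ).enorm.aemeasurable
  simp only [one_mul, lintegral_const] at h
  have e1 : ∫⁻ s, ‖ξ s‖ₑ ∂(histMeasure dg) =
      ENNReal.ofReal (∫ s, ‖ξ s‖ ∂(histMeasure dg)) := by
    rw [ofReal_integral_norm_eq_lintegral_enorm (hg.integrable_hist ξ)]
  have e2 : ∫⁻ s, ‖ξ s‖ₑ ^ 2 ∂(histMeasure dg) =
      ENNReal.ofReal (∫ s, ‖ξ s‖ ^ 2 ∂(histMeasure dg)) := by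
    rw [ofReal_integral_eq_lintegral_ofReal (Lp.integrable_norm_sq ξ)
      (Eventually.of_forall fun s => by positivity)]
    refine lintegral_congr fun s => ?_
    rw [ENNReal.ofReal_pow (norm_nonneg _), ofReal_norm]
  have e3 : histMeasure dg univ = ENNReal.ofReal ((histMeasure dg).real univ) :=
    (ofReal_measureReal).symm
  rw [e1, e2, e3, ← ENNReal.ofReal_pow (integral_nonneg fun s => norm_nonneg _),
    ← ENNReal.ofReal_mul measureReal_nonneg] at h
  exact (ENNReal.ofReal_le_ofReal_iff (mul_nonneg measureReal_nonneg
    (integral_nonneg fun s => by positivity))).1 h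

variable [NormedSpace ℝ E]

lemma IsMemoryKernel.integrable_hist_iff (hg : IsMemoryKernel c g dg) {ξ : ℝ → E} :
    Integrable ξ (histMeasure dg) ↔ IntegrableOn (fun s => (-dg s) • ξ s) (Ioi 0) := by
  rw [histMeasure, integrable_withDensity_iff_integrable_smul₀' hg.aemeasurable
    (Eventually.of_forall fun s => ENNReal.ofReal_lt_top), IntegrableOn]
  refine integrable_congr ?_
  rw [EventuallyEq, ae_restrict_iff' measurableSet_Ioi]
  filter_upwards with s hs
  rw [ENNReal.toReal_ofReal (by linarith [hg.deriv_nonpos hs])]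

lemma IsMemoryKernel.integral_hist (hg : IsMemoryKernel c g dg) (ξ : ℝ → E) :
    ∫ s, ξ s ∂(histMeasure dg) = ∫ s in Ioi 0, (-dg s) • ξ s := by
  rw [histMeasure, integral_withDensity_eq_integral_toReal_smul₀ hg.aemeasurable
    (Eventually.of_forall fun s => ENNReal.ofReal_lt_top)]
  refine setIntegral_congr_fun measurableSet_Ioi fun s hs => ?_
  rw [ENNReal.toReal_ofReal (by linarith [hg.deriv_nonpos hs])]

lemma IsMemoryKernel.integrable_memory (hg : IsMemoryKernel c g dg) {ξ : ℝ → E}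
    (hξ : StronglyMeasurable ξ) (hi : Integrable ξ (histMeasure dg)) :
    IntegrableOn (fun s => g s • ξ s) (Ioi 0) := by
  obtain ⟨K, hK, h⟩ := hg.le_deriv
  refine ((hg.integrable_hist_iff.1 hi).norm.const_mul K).mono'
    (hg.integrable.aestronglyMeasurable.smul hξ.aestronglyMeasurable) ?_
  rw [ae_restrict_iff' measurableSet_Ioi]
  filter_upwards with s hs
  rw [norm_smul, norm_smul, Real.norm_of_nonneg (hg.nonneg s hs),
    Real.norm_of_nonneg (by linarith [hg.deriv_nonpos hs]), ← mul_assoc]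
  exact mul_le_mul_of_nonneg_right (h s hs) (norm_nonneg _)

/-! ### Integrals of the memory -/

/-- `∫₀^∞ g(s) ξ(s) ds` as a bounded operator. -/
def memL (hg : IsMemoryKernel c g dg) (E : Type*) [NormedAddCommGroup E] [NormedSpace ℝ E] :
    Lp E 2 (histMeasure dg) →L[ℝ] E :=
  LinearMap.mkContinuous
    { toFun := fun ξ => ∫ r in Ioi 0, g r • ξ r
      map_add' := fun ξ η => by
        rw [← integral_add (hg.integrable_memory (Lp.stronglyMeasurable ξ) (hg.integrable_hist ξ))
          (hg.integrable_memory (Lp.stronglyMeasurable η) (hg.integrable_hist η))]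
        refine integral_congr_ae ?_
        rw [EventuallyEq, ae_restrict_iff' measurableSet_Ioi]
        filter_upwards [hg.ae_hist_iff.1 (Lp.coeFn_add ξ η)] with r hr h0
        rcases (hg.deriv_nonpos h0).lt_or_eq with hd | hd
        · rw [hr h0 hd, Pi.add_apply, smul_add]
        -- The representative of the sum is unknown where `g' = 0`, but `g = 0` there and both
        -- integrands vanish.
        · obtain ⟨K, hK, h⟩ := hg.le_deriv
          have : g r = 0 := le_antisymm (by simpa [hd] using h r h0) (hg.nonneg r h0)
          simp [this]
      map_smul' := fun a ξ => by
        rw [RingHom.id_apply, ← integral_smul]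
        refine integral_congr_ae ?_
        rw [EventuallyEq, ae_restrict_iff' measurableSet_Ioi]
        filter_upwards [hg.ae_hist_iff.1 (Lp.coeFn_smul a ξ)] with r hr h0
        rcases (hg.deriv_nonpos h0).lt_or_eq with hd | hd
        · rw [hr h0 hd, Pi.smul_apply, smul_comm]
        · obtain ⟨K, hK, h⟩ := hg.le_deriv
          have : g r = 0 := le_antisymm (by simpa [hd] using h r h0) (hg.nonneg r h0)
          simp [this] }
    (hg.le_deriv.choose * √((histMeasure dg).real univ)) fun ξ => by
      obtain ⟨hK, h⟩ := hg.le_deriv.choose_spec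
      set K := hg.le_deriv.choose
      have hi := hg.integrable_hist_iff.1 (hg.integrable_hist ξ).norm
      calc ‖∫ r in Ioi 0, g r • ξ r‖ ≤ ∫ r in Ioi 0, K * ((-dg r) • ‖ξ r‖) := by
            refine norm_integral_le_of_norm_le (hi.const_mul K) ?_
            rw [ae_restrict_iff' measurableSet_Ioi]
            filter_upwards with r hr
            rw [norm_smul, Real.norm_of_nonneg (hg.nonneg r hr), smul_eq_mul, ← mul_assoc]
            exact mul_le_mul_of_nonneg_right (h r hr) (norm_nonneg _)
        _ = K * ∫ r, ‖ξ r‖ ∂(histMeasure dg) := by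
            rw [integral_const_mul, hg.integral_hist]
        _ ≤ K * (√((histMeasure dg).real univ) * ‖ξ‖) :=
            mul_le_mul_of_nonneg_left (hg.integral_norm_le ξ) hK
        _ = _ := by ring

lemma memL_apply (hg : IsMemoryKernel c g dg) (ξ : Lp E 2 (histMeasure dg)) :
    memL hg E ξ = ∫ r in Ioi 0, g r • ξ r := rfl

/-- The memory integral depends only on the values almost everywhere. -/
lemma IsMemoryKernel.memory_congr (hg : IsMemoryKernel c g dg) {ξ η : ℝ → E}
    (h : ξ =ᵐ[histMeasure dg] η) : ∫ r in Ioi 0, g r • ξ r = ∫ r in Ioi 0, g r • η r := by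
  refine integral_congr_ae ?_
  rw [EventuallyEq, ae_restrict_iff' measurableSet_Ioi]
  filter_upwards [hg.ae_hist_iff.1 h] with r hr h0
  rcases (hg.deriv_nonpos h0).lt_or_eq with hd | hd
  · rw [hr h0 hd]
  · obtain ⟨K, hK, h⟩ := hg.le_deriv
    have : g r = 0 := le_antisymm (by simpa [hd] using h r h0) (hg.nonneg r h0)
    simp [this]

/-- `∫₀^∞ g ∂ₛη = ∫₀^∞ (-g') η` for a history with `η(0) = 0`. -/
lemma IsMemoryKernel.memory_deriv [CompleteSpace E] (hg : IsMemoryKernel c g dg)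
    {η ξ : ℝ → E} (hξ : StronglyMeasurable ξ) (hi : Integrable ξ (histMeasure dg))
    (h : ∀ᵐ r ∂(histMeasure dg), η r = ∫ y in 0..r, ξ y) :
    ∫ r in Ioi 0, g r • ξ r = ∫ r, η r ∂(histMeasure dg) := by
  rw [integral_congr_ae h, hg.integral_hist]
  set ν := (volume : Measure ℝ).restrict (Ioi 0) with hν
  have hmρ : AEStronglyMeasurable dg ν := hg.integrable_deriv.aestronglyMeasurable
  -- Fubini's theorem on the triangle `y ≤ s`: integrating `-g'(s) ξ(y)` over `y` first gives the
  -- history integral, and over `s ≥ y` first gives `g(y) ξ(y)` by the tail formula.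
  set Φ : ℝ × ℝ → E := {p : ℝ × ℝ | p.2 ≤ p.1}.indicator fun p => (-dg p.1) • ξ p.2 with hΦ
  have mT : MeasurableSet {p : ℝ × ℝ | p.2 ≤ p.1} := measurableSet_le measurable_snd measurable_fst
  have mΦ : AEStronglyMeasurable Φ (ν.prod ν) :=
    (hmρ.neg.comp_fst.smul (hξ.comp_measurable measurable_snd).aestronglyMeasurable).indicator mT
  have e1 : ∀ y, (fun s => Φ (s, y)) = (Ici y).indicator fun s => (-dg s) • ξ y := fun y => by
    ext s
    simp [hΦ, indicator, mem_Ici]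
  have e2 : ∀ s, (fun y => Φ (s, y)) = (Iic s).indicator fun y => (-dg s) • ξ y := fun s => by
    ext y
    simp [hΦ, indicator, mem_Iic]
  have hy : ∀ y, 0 < y → ν.restrict (Ici y) = volume.restrict (Ici y) := fun y hy => by
    have : Ici y ∩ Ioi 0 = Ici y :=
      inter_eq_left.2 (fun x hx => mem_Ioi.2 (hy.trans_le (mem_Ici.1 hx)))
    rw [hν, Measure.restrict_restrict measurableSet_Ici, this]
  have hIci : ∀ y, 0 < y → IntegrableOn dg (Ici y) := fun y hy =>
    hg.integrable_deriv.mono_set fun x hx => mem_Ioi.2 (hy.trans_le hx)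
  have htail : ∀ y, 0 < y → ∫ s in Ici y, -dg s = g y := fun y hy => by
    rw [integral_Ici_eq_integral_Ioi, hg.tail hy]
  have iΦ : Integrable Φ (ν.prod ν) := by
    rw [integrable_prod_iff' mΦ]
    constructor
    · rw [hν, ae_restrict_iff' measurableSet_Ioi]
      filter_upwards with y hy0
      rw [e1, integrable_indicator_iff measurableSet_Ici, IntegrableOn, ← hν, hy y hy0]
      exact (hIci y hy0).neg.smul_const (ξ y)
    · refine (hg.integrable_memory hξ hi).norm.congr ?_
      rw [EventuallyEq, hν, ae_restrict_iff' measurableSet_Ioi]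
      filter_upwards with y hy0
      have : ∀ s, ‖Φ (s, y)‖ = (Ici y).indicator (fun s => (-dg s) * ‖ξ y‖) s := fun s => by
        rw [show Φ (s, y) = _ from congrFun (e1 y) s, norm_indicator_eq_indicator_norm]
        by_cases hs : s ∈ Ici y
        · rw [indicator_of_mem hs, indicator_of_mem hs, norm_smul, Real.norm_of_nonneg]
          linarith [hg.deriv_nonpos (lt_of_lt_of_le (mem_Ioi.1 hy0) hs)]
        · rw [indicator_of_notMem hs, indicator_of_notMem hs]
      simp_rw [this]
      rw [integral_indicator measurableSet_Ici, ← hν, hy y hy0, integral_mul_const, htail y hy0,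
        norm_smul, Real.norm_of_nonneg (hg.nonneg y hy0)]
  have swap := integral_integral_swap (f := fun s y => Φ (s, y)) iΦ
  have l1 : ∫ s, ∫ y, Φ (s, y) ∂ν ∂ν = ∫ s in Ioi 0, (-dg s) • ∫ y in 0..s, ξ y := by
    refine setIntegral_congr_fun measurableSet_Ioi fun s hs => ?_
    rw [e2, integral_indicator measurableSet_Iic, hν, Measure.restrict_restrict measurableSet_Iic,
      inter_comm, Ioi_inter_Iic, integral_smul, intervalIntegral.integral_of_le (le_of_lt hs)]
  have l2 : ∫ y, ∫ s, Φ (s, y) ∂ν ∂ν = ∫ y in Ioi 0, g y • ξ y := by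
    refine setIntegral_congr_fun measurableSet_Ioi fun y hy0 => ?_
    rw [e1, integral_indicator measurableSet_Ici, hy y hy0, integral_smul_const, htail y hy0]
  rw [← l2, ← swap, l1]

/-- A history with `η(0) = 0` and `∂ₛη = ξ` vanishes only if `ξ` does. -/
lemma IsMemoryKernel.deriv_eq_zero [CompleteSpace E] (hg : IsMemoryKernel c g dg) {ξ : ℝ → E}
    (hi : Integrable ξ (histMeasure dg))
    (h : ∀ᵐ r ∂(histMeasure dg), ∫ y in 0..r, ξ y = 0) : ξ =ᵐ[histMeasure dg] 0 := by
  -- Before a time `R` with `g'(R) < 0` the primitive is continuous and vanishes almost everywhere,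
  -- hence everywhere, and Lebesgue differentiation gives `ξ = 0`.
  have key : ∀ R : ℝ, 0 < R → dg R < 0 → ∀ᵐ r, r ∈ Ioo 0 R → ξ r = 0 := fun R hR hd => by
    have hInt := hg.intervalIntegrable hi hR hd
    have hF : ContinuousOn (fun x => ∫ y in 0..x, ξ y) (Icc 0 R) := by
      have := intervalIntegral.continuousOn_primitive_interval' hInt left_mem_uIcc
      rwa [uIcc_of_le hR.le] at this
    have h0 : ∀ x ∈ Ioo 0 R, ∫ y in 0..x, ξ y = 0 := by
      have hz : (fun x => ∫ y in 0..x, ξ y) =ᵐ[volume.restrict (Ioo 0 R)] 0 := by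
        rw [EventuallyEq, ae_restrict_iff' measurableSet_Ioo]
        filter_upwards [hg.ae_hist_iff.1 h] with r hr hmem
        exact hr hmem.1 (hg.deriv_neg_mono hd hmem.1 hmem.2.le)
      exact Measure.eqOn_open_of_ae_eq hz isOpen_Ioo (hF.mono Ioo_subset_Icc_self)
        continuousOn_const
    filter_upwards [hInt.ae_hasDerivAt_integral] with x hx hmem
    have hd := hx (by rw [uIcc_of_le hR.le]; exact Ioo_subset_Icc_self hmem) 0
      (by rw [uIcc_of_le hR.le]; exact ⟨le_rfl, hR.le⟩)
    have : HasDerivAt (fun x => ∫ y in 0..x, ξ y) 0 x :=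
      (hasDerivAt_const x (0 : E)).congr_of_eventuallyEq (by
        filter_upwards [isOpen_Ioo.mem_nhds hmem] with y hy using h0 y hy)
    exact hd.unique this
  rw [EventuallyEq, hg.ae_hist_iff]
  -- Rational endpoints keep the union of exceptional sets null; only the right end of the interval
  -- `{g' < 0}` escapes them, and it is a single point.
  have hq : ∀ᵐ r, ∀ q : ℚ, 0 < (q : ℝ) → dg q < 0 → r ∈ Ioo 0 (q : ℝ) → ξ r = 0 := by
    rw [ae_all_iff]
    intro q
    by_cases hq : 0 < (q : ℝ) ∧ dg q < 0
    · filter_upwards [key q hq.1 hq.2] with r hr _ _ using hr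
    · filter_upwards with r h1 h2 using absurd ⟨h1, h2⟩ hq
  have hsup : ∀ᵐ r : ℝ, r ≠ sSup {s | 0 < s ∧ dg s < 0} := by
    rw [ae_iff]; simp
  filter_upwards [hq, hsup] with r hr hrs h0 hd
  set T : Set ℝ := {s | 0 < s ∧ dg s < 0} with hT
  by_cases hb : BddAbove T
  · have hlt : r < sSup T := lt_of_le_of_ne (le_csSup hb ⟨h0, hd⟩) hrs
    obtain ⟨a, ha, hra⟩ := exists_lt_of_lt_csSup (show T.Nonempty from ⟨r, h0, hd⟩) hlt
    obtain ⟨q, hq1, hq2⟩ := exists_rat_btwn hra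
    exact hr q (h0.trans hq1) (hg.deriv_neg_mono ha.2 (h0.trans hq1) hq2.le) ⟨h0, hq1⟩
  · rw [not_bddAbove_iff] at hb
    obtain ⟨a, ha, hra⟩ := hb r
    obtain ⟨q, hq1, hq2⟩ := exists_rat_btwn hra
    exact hr q (h0.trans hq1) (hg.deriv_neg_mono ha.2 (h0.trans hq1) hq2.le) ⟨h0, hq1⟩

end Kernel

/-! ### The resolvent of `-∂ₛ` on the history space -/

section HistoryResolvent

variable {c : ℝ} {g dg : ℝ → ℝ} {E : Type*} [NormedAddCommGroup E]

lemma lintegral_exp_neg {l : ℝ} (hl : 0 < l) :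
    ∫⁻ t, (Ici (0 : ℝ)).indicator (fun t => ENNReal.ofReal (Real.exp (-l * t))) t =
      ENNReal.ofReal l⁻¹ := by
  rw [lintegral_indicator measurableSet_Ici, Measure.restrict_congr_set Ioi_ae_eq_Ici.symm,
    ← ofReal_integral_eq_lintegral_ofReal (integrableOn_exp_mul_Ioi (by linarith) 0)
      (Eventually.of_forall fun t => (Real.exp_pos _).le),
    integral_exp_mul_Ioi (by linarith) 0]
  congr 1
  field_simp
  simp

lemma eLpNorm_two_sq {α : Type*} [MeasurableSpace α] (μ : Measure α) (f : α → E) :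
    eLpNorm f 2 μ ^ 2 = ∫⁻ x, ‖f x‖ₑ ^ 2 ∂μ := by
  rw [eLpNorm_eq_lintegral_rpow_enorm_toReal two_ne_zero ENNReal.ofNat_ne_top,
    ← ENNReal.rpow_natCast, ← ENNReal.rpow_mul]
  simp

variable [NormedSpace ℝ E]

/-- Fubini's theorem on the triangle `{0 < x ≤ y ≤ r}`. -/
lemma integral_smul_primitive [CompleteSpace E] {r : ℝ} (hr : 0 ≤ r) {a : ℝ → ℝ}
    (ha : Continuous a) {h : ℝ → E} (hh : IntervalIntegrable h volume 0 r) :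
    ∫ y in 0..r, a y • ∫ x in 0..y, h x = ∫ x in 0..r, (∫ y in x..r, a y) • h x := by
  set ν := (volume : Measure ℝ).restrict (Ioc 0 r) with hν
  rw [intervalIntegrable_iff_integrableOn_Ioc_of_le hr] at hh
  have hai : Integrable a ν := (ha.intervalIntegrable 0 r).1
  set Φ : ℝ × ℝ → E := {p : ℝ × ℝ | p.2 ≤ p.1}.indicator fun p => a p.1 • h p.2 with hΦ
  have mT : MeasurableSet {p : ℝ × ℝ | p.2 ≤ p.1} := measurableSet_le measurable_snd measurable_fst
  have iΦ : Integrable Φ (ν.prod ν) := (hai.smul_prod hh).indicator mT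
  have swap := integral_integral_swap (f := fun y x => Φ (y, x)) iΦ
  have l1 : ∫ y, ∫ x, Φ (y, x) ∂ν ∂ν = ∫ y in 0..r, a y • ∫ x in 0..y, h x := by
    rw [intervalIntegral.integral_of_le hr]
    refine setIntegral_congr_fun measurableSet_Ioc fun y hy => ?_
    have e : (fun x => Φ (y, x)) = (Iic y).indicator fun x => a y • h x := by
      ext x
      simp [hΦ, indicator, mem_Iic]
    rw [e, integral_indicator measurableSet_Iic, hν, Measure.restrict_restrict measurableSet_Iic,
      inter_comm, Ioc_inter_Iic, min_eq_right hy.2, integral_smul,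
      intervalIntegral.integral_of_le hy.1.le]
  have l2 : ∫ x, ∫ y, Φ (y, x) ∂ν ∂ν = ∫ x in 0..r, (∫ y in x..r, a y) • h x := by
    rw [intervalIntegral.integral_of_le hr]
    refine setIntegral_congr_fun measurableSet_Ioc fun x hx => ?_
    have e : (fun y => Φ (y, x)) = (Ici x).indicator fun y => a y • h x := by
      ext y
      simp [hΦ, indicator, mem_Ici]
    have e2 : Ici x ∩ Ioc 0 r = Icc x r := by
      ext y
      simp only [mem_inter_iff, mem_Ici, mem_Ioc, mem_Icc]
      exact ⟨fun h => ⟨h.1, h.2.2⟩, fun h => ⟨h.1, hx.1.trans_le h.1, h.2⟩⟩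
    rw [e, integral_indicator measurableSet_Ici, hν, Measure.restrict_restrict measurableSet_Ici,
      e2, integral_Icc_eq_integral_Ioc, integral_smul_const,
      intervalIntegral.integral_of_le hx.2]
  rw [← l1, swap, l2]

/-- `∫₀^s e^{-λ(s-y)} h(y) dy`. -/
def expConv (l : ℝ) (h : ℝ → E) (s : ℝ) : E :=
  ∫ y in Ioc 0 s, Real.exp (-l * (s - y)) • h y

lemma stronglyMeasurable_expConv (l : ℝ) {h : ℝ → E} (hh : StronglyMeasurable h) :
    StronglyMeasurable (expConv l h) := by
  have e : expConv l h = fun s => ∫ y, ({p : ℝ × ℝ | 0 < p.2 ∧ p.2 ≤ p.1}.indicator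
      fun p => Real.exp (-l * (p.1 - p.2)) • h p.2) (s, y) := by
    ext s
    rw [expConv, ← integral_indicator measurableSet_Ioc]
    rfl
  rw [e]
  refine StronglyMeasurable.integral_prod_right' ?_
  refine StronglyMeasurable.indicator ?_ ?_
  · refine StronglyMeasurable.smul ?_ (hh.comp_measurable measurable_snd)
    exact (by fun_prop : Continuous fun p : ℝ × ℝ =>
      Real.exp (-l * (p.1 - p.2))).stronglyMeasurable
  · exact (measurableSet_lt measurable_const measurable_snd).inter
      (measurableSet_le measurable_snd measurable_fst)

/-- Cauchy–Schwarz with the kernel `e^{-λ(s-y)}` costs one factor `λ⁻¹`. For `y ≤ s` monotonicity of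
`g'` gives `-g'(s) ≤ -g'(y)`, so the weight can be moved inside to the variable `y`; integrating the
kernel over `s` yields the second `λ⁻¹`. -/
lemma expConv_sq_le (hg : IsMemoryKernel c g dg) {l : ℝ} (hl : 0 < l) {h : ℝ → E}
    (hh : StronglyMeasurable h) :
    ∫⁻ s, ‖expConv l h s‖ₑ ^ 2 ∂(histMeasure dg) ≤
      ENNReal.ofReal l⁻¹ ^ 2 * ∫⁻ s, ‖h s‖ₑ ^ 2 ∂(histMeasure dg) := by
  set ν := (volume : Measure ℝ).restrict (Ioi 0) with hν
  set e : ℝ → ℝ≥0∞ := (Ici (0 : ℝ)).indicator fun t => ENNReal.ofReal (Real.exp (-l * t)) with he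
  have me : Measurable e :=
    (by fun_prop : Measurable fun t => ENNReal.ofReal (Real.exp (-l * t))).indicator
      measurableSet_Ici
  have mh : Measurable fun y => ‖h y‖ₑ := hh.enorm
  set ρ : ℝ → ℝ≥0∞ := fun s => ENNReal.ofReal (-dg s) with hρ
  have mρ : AEMeasurable ρ ν := hg.aemeasurable
  have point : ∀ s, ‖expConv l h s‖ₑ ^ 2 ≤
      ENNReal.ofReal l⁻¹ * ∫⁻ y, e (s - y) * ‖h y‖ₑ ^ 2 ∂ν := fun s => by
    have h1 : ‖expConv l h s‖ₑ ≤ ∫⁻ y, e (s - y) * ‖h y‖ₑ ∂ν := by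
      refine (enorm_integral_le_lintegral_enorm _).trans ?_
      rw [← lintegral_indicator measurableSet_Ioc, hν, ← lintegral_indicator measurableSet_Ioi]
      refine lintegral_mono fun y => ?_
      by_cases hy : y ∈ Ioc 0 s
      · rw [indicator_of_mem hy, indicator_of_mem (mem_Ioi.2 hy.1), he,
          indicator_of_mem (mem_Ici.2 (by linarith [hy.2])), enorm_smul,
          Real.enorm_eq_ofReal (Real.exp_pos _).le]
      · rw [indicator_of_notMem hy]; exact zero_le
    calc ‖expConv l h s‖ₑ ^ 2 ≤ (∫⁻ y, e (s - y) * ‖h y‖ₑ ∂ν) ^ 2 := by gcongr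
      _ ≤ (∫⁻ y, e (s - y) ∂ν) * ∫⁻ y, e (s - y) * ‖h y‖ₑ ^ 2 ∂ν :=
          lintegral_mul_sq_le ν (me.comp (measurable_const.sub measurable_id)).aemeasurable
            mh.aemeasurable
      _ ≤ _ := by
          gcongr
          calc ∫⁻ y, e (s - y) ∂ν ≤ ∫⁻ y, e (s - y) := setLIntegral_le_lintegral _ _
            _ = ENNReal.ofReal l⁻¹ := by
              rw [lintegral_sub_left_eq_self e s, lintegral_exp_neg hl]
  have mprod : AEMeasurable (Function.uncurry fun s y : ℝ => ρ y * (e (s - y) * ‖h y‖ₑ ^ 2))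
      (ν.prod ν) := by
    refine (mρ.comp_snd (μ := ν)).mul (Measurable.aemeasurable ?_)
    exact (me.comp (measurable_fst.sub measurable_snd)).mul
      ((mh.comp measurable_snd).pow_const 2)
  rw [histMeasure, lintegral_withDensity_eq_lintegral_mul₀ hg.aemeasurable
      ((stronglyMeasurable_expConv l hh).enorm.pow_const 2).aemeasurable,
    lintegral_withDensity_eq_lintegral_mul₀ hg.aemeasurable (mh.pow_const 2).aemeasurable]
  calc ∫⁻ s, ρ s * ‖expConv l h s‖ₑ ^ 2 ∂ν
      ≤ ∫⁻ s, ENNReal.ofReal l⁻¹ * ∫⁻ y, ρ y * (e (s - y) * ‖h y‖ₑ ^ 2) ∂ν ∂ν := by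
        refine setLIntegral_mono_ae' measurableSet_Ioi (Eventually.of_forall fun s hs => ?_)
        calc ρ s * ‖expConv l h s‖ₑ ^ 2
            ≤ ρ s * (ENNReal.ofReal l⁻¹ * ∫⁻ y, e (s - y) * ‖h y‖ₑ ^ 2 ∂ν) := by
              gcongr; exact point s
          _ = ENNReal.ofReal l⁻¹ * ∫⁻ y, ρ s * (e (s - y) * ‖h y‖ₑ ^ 2) ∂ν := by
              rw [lintegral_const_mul _ (show Measurable fun y => e (s - y) * ‖h y‖ₑ ^ 2 from
                (me.comp (measurable_const.sub measurable_id)).mul (mh.pow_const 2)),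
                mul_left_comm]
          _ ≤ _ := by
              refine mul_le_mul_right ?_ _
              refine setLIntegral_mono_ae' measurableSet_Ioi (Eventually.of_forall fun y hy => ?_)
              by_cases hys : y ≤ s
              · gcongr
                exact ENNReal.ofReal_le_ofReal (neg_le_neg (hg.convex hy hs hys))
              · have : e (s - y) = 0 := by
                  rw [he, indicator_of_notMem]
                  simpa using hys
                simp [this]
    _ = ENNReal.ofReal l⁻¹ * ∫⁻ s, ∫⁻ y, ρ y * (e (s - y) * ‖h y‖ₑ ^ 2) ∂ν ∂ν :=
        lintegral_const_mul' _ _ ENNReal.ofReal_ne_top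
    _ = ENNReal.ofReal l⁻¹ * ∫⁻ y, ∫⁻ s, ρ y * (e (s - y) * ‖h y‖ₑ ^ 2) ∂ν ∂ν := by
        rw [lintegral_lintegral_swap mprod]
    _ ≤ ENNReal.ofReal l⁻¹ * ∫⁻ y, ENNReal.ofReal l⁻¹ * (ρ y * ‖h y‖ₑ ^ 2) ∂ν := by
        gcongr with y
        calc ∫⁻ s, ρ y * (e (s - y) * ‖h y‖ₑ ^ 2) ∂ν
            = ∫⁻ s, (ρ y * ‖h y‖ₑ ^ 2) * e (s - y) ∂ν := by
              refine lintegral_congr fun s => ?_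
              ring
          _ = (ρ y * ‖h y‖ₑ ^ 2) * ∫⁻ s, e (s - y) ∂ν :=
              lintegral_const_mul _ (me.comp (measurable_id.sub measurable_const))
          _ ≤ (ρ y * ‖h y‖ₑ ^ 2) * ENNReal.ofReal l⁻¹ := by
              gcongr
              calc ∫⁻ s, e (s - y) ∂ν ≤ ∫⁻ s, e (s - y) := setLIntegral_le_lintegral _ _
                _ = ENNReal.ofReal l⁻¹ := by
                  rw [lintegral_sub_right_eq_self e y, lintegral_exp_neg hl]
          _ = _ := mul_comm _ _
    _ = ENNReal.ofReal l⁻¹ ^ 2 * ∫⁻ s, ρ s * ‖h s‖ₑ ^ 2 ∂ν := by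
        rw [lintegral_const_mul' _ _ ENNReal.ofReal_ne_top, ← mul_assoc, sq]

lemma eLpNorm_expConv_le (hg : IsMemoryKernel c g dg) {l : ℝ} (hl : 0 < l) {h : ℝ → E}
    (hh : StronglyMeasurable h) :
    eLpNorm (expConv l h) 2 (histMeasure dg) ≤
      ENNReal.ofReal l⁻¹ * eLpNorm h 2 (histMeasure dg) := by
  refine (ENNReal.pow_le_pow_left_iff two_ne_zero).1 ?_
  rw [mul_pow, eLpNorm_two_sq, eLpNorm_two_sq]
  exact expConv_sq_le hg hl hh

lemma memLp_expConv (hg : IsMemoryKernel c g dg) {l : ℝ} (hl : 0 < l)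
    (h : Lp E 2 (histMeasure dg)) : MemLp (expConv l h) 2 (histMeasure dg) :=
  ⟨(stronglyMeasurable_expConv l (Lp.stronglyMeasurable h)).aestronglyMeasurable,
    (eLpNorm_expConv_le hg hl (Lp.stronglyMeasurable h)).trans_lt
      (ENNReal.mul_lt_top ENNReal.ofReal_lt_top (Lp.memLp h).2)⟩

/-- The resolvent `(λ + ∂ₛ)⁻¹` with the boundary condition `η(0) = 0`. -/
def histRes (hg : IsMemoryKernel c g dg) {l : ℝ} (hl : 0 < l) (h : Lp E 2 (histMeasure dg)) :
    Lp E 2 (histMeasure dg) := (memLp_expConv hg hl h).toLp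

lemma histRes_coe (hg : IsMemoryKernel c g dg) {l : ℝ} (hl : 0 < l)
    (h : Lp E 2 (histMeasure dg)) : histRes hg hl h =ᵐ[histMeasure dg] expConv l h :=
  MemLp.coeFn_toLp _

lemma norm_histRes_le (hg : IsMemoryKernel c g dg) {l : ℝ} (hl : 0 < l)
    (h : Lp E 2 (histMeasure dg)) : ‖histRes hg hl h‖ ≤ l⁻¹ * ‖h‖ := by
  rw [histRes, Lp.norm_toLp, Lp.norm_def]
  have := ENNReal.toReal_mono (ENNReal.mul_ne_top ENNReal.ofReal_ne_top (Lp.memLp h).2.ne)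
    (eLpNorm_expConv_le hg hl (Lp.stronglyMeasurable h))
  rwa [ENNReal.toReal_mul, ENNReal.toReal_ofReal (by positivity)] at this

lemma integral_exp_neg_mul {l : ℝ} (hl : l ≠ 0) (x r : ℝ) :
    ∫ y in x..r, Real.exp (-l * y) = (Real.exp (-l * x) - Real.exp (-l * r)) / l := by
  have hd : ∀ y ∈ uIcc x r, HasDerivAt (fun y => -Real.exp (-l * y) / l) (Real.exp (-l * y)) y :=
    fun y _ => by
      have h := (((hasDerivAt_id' y).const_mul (-l)).exp.neg.div_const l)
      refine h.congr_deriv ?_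
      field_simp
  rw [intervalIntegral.integral_eq_sub_of_hasDerivAt hd
    ((by fun_prop : Continuous fun y => Real.exp (-l * y)).intervalIntegrable x r)]
  ring

/-- `η = (λ + ∂ₛ)⁻¹ h` satisfies `∂ₛη = h - λη`. -/
lemma expConv_eq_primitive [CompleteSpace E] {l r : ℝ} (hl : 0 < l) (hr : 0 ≤ r) {h : ℝ → E}
    (hh : IntervalIntegrable h volume 0 r) :
    IntervalIntegrable (expConv l h) volume 0 r ∧
      expConv l h r = ∫ y in 0..r, (h y - l • expConv l h y) := by
  have hk : IntervalIntegrable (fun x => Real.exp (l * x) • h x) volume 0 r :=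
    hh.continuousOn_smul (by fun_prop : Continuous fun x => Real.exp (l * x)).continuousOn
  -- Factoring the exponential exhibits the convolution as a smooth function times a primitive,
  -- which gives continuity and prepares for Fubini's theorem.
  have e : ∀ y ∈ uIcc 0 r, expConv l h y =
      Real.exp (-l * y) • ∫ x in 0..y, Real.exp (l * x) • h x := fun y hy => by
    rw [uIcc_of_le hr] at hy
    rw [expConv, ← intervalIntegral.integral_of_le hy.1, ← intervalIntegral.integral_smul]
    refine intervalIntegral.integral_congr fun x _ => ?_
    change _ = Real.exp (-l * y) • Real.exp (l * x) • h x
    rw [smul_smul, ← Real.exp_add]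
    congr 2
    ring
  have hcont : ContinuousOn (expConv l h) (uIcc 0 r) := by
    refine ContinuousOn.congr ?_ e
    exact (by fun_prop : Continuous fun y => Real.exp (-l * y)).continuousOn.smul
      (intervalIntegral.continuousOn_primitive_interval' hk left_mem_uIcc)
  refine ⟨hcont.intervalIntegrable, ?_⟩
  rw [intervalIntegral.integral_sub hh (show IntervalIntegrable (fun y => l • expConv l h y) volume 0 r from
      hcont.intervalIntegrable.smul l),
    intervalIntegral.integral_smul, intervalIntegral.integral_congr e,
    integral_smul_primitive hr (by fun_prop) hk, ← intervalIntegral.integral_smul]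
  simp_rw [integral_exp_neg_mul hl.ne']
  rw [e r right_mem_uIcc, ← intervalIntegral.integral_smul, ← intervalIntegral.integral_sub hh]
  · refine intervalIntegral.integral_congr fun x _ => ?_
    rw [smul_smul, smul_smul, smul_smul, ← sub_eq_zero]
    have h1 : Real.exp (-l * x) * Real.exp (l * x) = 1 := by
      rw [← Real.exp_add]; simp
    have : (1 : ℝ) • h x = h x := one_smul _ _
    rw [← this, smul_smul, smul_smul, ← sub_smul, ← sub_smul]
    convert zero_smul ℝ (h x)
    field_simp
    rw [neg_mul] at h1
    linear_combination h1
  · refine IntervalIntegrable.smul ?_ l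
    exact hk.continuousOn_smul (by fun_prop : Continuous fun x =>
      (Real.exp (-l * x) - Real.exp (-l * r)) / l).continuousOn

lemma histRes_deriv [CompleteSpace E] (hg : IsMemoryKernel c g dg) {l : ℝ} (hl : 0 < l)
    (h : Lp E 2 (histMeasure dg)) :
    ∀ᵐ r ∂(histMeasure dg), IntervalIntegrable (h - l • histRes hg hl h : Lp E 2 (histMeasure dg))
      volume 0 r ∧
      histRes hg hl h r = ∫ y in 0..r, (h - l • histRes hg hl h : Lp E 2 (histMeasure dg)) y := by
  filter_upwards [hg.ae_good, histRes_coe hg hl h] with r hr he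
  refine ⟨hg.intervalIntegrable (hg.integrable_hist _) hr.1 hr.2, ?_⟩
  rw [he, (expConv_eq_primitive hl hr.1.le
    (hg.intervalIntegrable (hg.integrable_hist h) hr.1 hr.2)).2]
  refine intervalIntegral.integral_congr_ae ?_
  filter_upwards [hg.ae_hist_iff.1 (Lp.coeFn_sub h (l • histRes hg hl h)),
    hg.ae_hist_iff.1 (Lp.coeFn_smul l (histRes hg hl h)), hg.ae_hist_iff.1 (histRes_coe hg hl h)]
    with y h1 h2 h3 hy
  rw [uIoc_of_le hr.1.le] at hy
  have hd := hg.deriv_neg_mono hr.2 hy.1 hy.2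
  rw [h1 hy.1 hd, Pi.sub_apply, h2 hy.1 hd, Pi.smul_apply, h3 hy.1 hd]

/-- The resolvent inverts `λ + ∂ₛ`. -/
lemma histRes_of_deriv [CompleteSpace E] (hg : IsMemoryKernel c g dg) {l : ℝ} (hl : 0 < l)
    {η ξ : Lp E 2 (histMeasure dg)} (h : ∀ᵐ r ∂(histMeasure dg), η r = ∫ y in 0..r, ξ y) :
    histRes hg hl (l • η + ξ) = η := by
  refine Lp.ext ?_
  filter_upwards [hg.ae_good, histRes_coe hg hl (l • η + ξ), h] with r hr he hη
  have hi := hg.intervalIntegrable (hg.integrable_hist ξ) hr.1 hr.2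
  have hcont : ContinuousOn (fun y => ∫ x in 0..y, ξ x) (uIcc 0 r) :=
    intervalIntegral.continuousOn_primitive_interval' hi left_mem_uIcc
  have ce : Continuous fun y => Real.exp (-l * (r - y)) := by fun_prop
  rw [he, hη, expConv, ← intervalIntegral.integral_of_le hr.1.le]
  have e1 : ∫ y in 0..r, Real.exp (-l * (r - y)) • (l • η + ξ : Lp E 2 (histMeasure dg)) y =
      ∫ y in 0..r, ((l * Real.exp (-l * (r - y))) • (∫ x in 0..y, ξ x) +
        Real.exp (-l * (r - y)) • ξ y) := by
    refine intervalIntegral.integral_congr_ae ?_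
    filter_upwards [hg.ae_hist_iff.1 (Lp.coeFn_add (l • η) ξ),
      hg.ae_hist_iff.1 (Lp.coeFn_smul l η), hg.ae_hist_iff.1 h] with y h1 h2 h3 hy
    rw [uIoc_of_le hr.1.le] at hy
    have hd := hg.deriv_neg_mono hr.2 hy.1 hy.2
    rw [h1 hy.1 hd, Pi.add_apply, h2 hy.1 hd, Pi.smul_apply, h3 hy.1 hd, smul_add, smul_smul,
      mul_comm]
  have e2 : ∀ x, ∫ y in x..r, l * Real.exp (-l * (r - y)) = 1 - Real.exp (-l * (r - x)) :=
    fun x => by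
      have hd : ∀ y ∈ uIcc x r, HasDerivAt (fun y => Real.exp (-l * (r - y)))
          (l * Real.exp (-l * (r - y))) y := fun y _ => by
        have h := ((((hasDerivAt_id' y).const_sub r)).const_mul (-l)).exp
        convert h using 1
        ring
      rw [intervalIntegral.integral_eq_sub_of_hasDerivAt hd
        ((by fun_prop : Continuous fun y => l * Real.exp (-l * (r - y))).intervalIntegrable x r)]
      simp
  have cl : Continuous fun y => l * Real.exp (-l * (r - y)) := by fun_prop
  rw [e1, intervalIntegral.integral_add
    (show IntervalIntegrable (fun y => (l * Real.exp (-l * (r - y))) • ∫ x in 0..y, ξ x)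
      volume 0 r from (cl.continuousOn.smul hcont).intervalIntegrable) (hi.continuousOn_smul ce.continuousOn),
    integral_smul_primitive hr.1.le cl hi, ← intervalIntegral.integral_add
      (hi.continuousOn_smul (by simp_rw [e2]; fun_prop)) (hi.continuousOn_smul ce.continuousOn)]
  refine intervalIntegral.integral_congr fun x _ => ?_
  simp only [e2]
  rw [← add_smul]
  simp

end HistoryResolvent

/-! ### Dissipativity of `-∂ₛ`, and constant histories. -/

section HistoryDissipative

variable {c : ℝ} {g dg : ℝ → ℝ} {E : Type*} [NormedAddCommGroup E] [InnerProductSpace ℝ E]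
  [CompleteSpace E]

/-- `-∂ₛ` with `η(0) = 0` is dissipative on the history space. -/
lemma inner_deriv_nonneg (hg : IsMemoryKernel c g dg) {η ξ : Lp E 2 (histMeasure dg)}
    (h : ∀ᵐ r ∂(histMeasure dg), η r = ∫ y in 0..r, ξ y) : 0 ≤ inner ℝ η ξ := by
  -- Squaring the resolvent bound `λ‖η‖ ≤ ‖λη + ξ‖` leaves `0 ≤ 2λ⟨η,ξ⟩ + ‖ξ‖²`. Letting `λ` be
  -- large then excludes a negative inner product.
  have key : ∀ l : ℝ, 0 < l → -(‖ξ‖ ^ 2 / 2) ≤ inner ℝ η ξ * l := fun l hl => by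
    have h1 := norm_histRes_le hg hl (l • η + ξ)
    rw [histRes_of_deriv hg hl h, inv_mul_eq_div, le_div_iff₀ hl] at h1
    have h2 : (‖η‖ * l) ^ 2 ≤ ‖l • η + ξ‖ ^ 2 := by gcongr
    rw [norm_add_sq_real, norm_smul, Real.norm_of_nonneg hl.le, real_inner_smul_left] at h2
    nlinarith
  by_contra hneg
  push Not at hneg
  -- With this `λ` the right-hand side equals `-(‖ξ‖²/2 + 1)`, which contradicts the bound.
  have h1 := key ((‖ξ‖ ^ 2 / 2 + 1) / (-inner ℝ η ξ)) (by
    have : 0 < -inner ℝ η ξ := by linarith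
    positivity)
  rw [mul_div_assoc', div_neg, mul_comm, mul_div_assoc, div_self hneg.ne] at h1
  linarith

/-- The resolvent of a constant history. -/
lemma memL_histRes_const (hg : IsMemoryKernel c g dg) {l : ℝ} (hl : 0 < l) (V : E)
    {h : Lp E 2 (histMeasure dg)} (hh : ∀ᵐ r ∂(histMeasure dg), h r = V) :
    memL hg E (histRes hg hl h) =
      (∫ r in Ioi 0, g r * ((1 - Real.exp (-l * r)) / l)) • V := by
  rw [memL_apply, hg.memory_congr (histRes_coe hg hl h),
    hg.memory_congr (η := fun r => ((1 - Real.exp (-l * r)) / l) • V)]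
  · simp_rw [smul_smul]
    rw [integral_smul_const]
  · filter_upwards [hg.ae_good] with r hr
    have e1 : expConv l h r = ∫ y in 0..r, Real.exp (-l * (r - y)) • V := by
      rw [expConv, ← intervalIntegral.integral_of_le hr.1.le]
      refine intervalIntegral.integral_congr_ae ?_
      filter_upwards [hg.ae_hist_iff.1 hh] with y h1 hy
      rw [uIoc_of_le hr.1.le] at hy
      rw [h1 hy.1 (hg.deriv_neg_mono hr.2 hy.1 hy.2)]
    rw [e1, intervalIntegral.integral_smul_const]
    congr 1
    have := intervalIntegral.integral_comp_sub_left (a := 0) (b := r)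
      (fun y => Real.exp (-l * y)) r
    rw [this, integral_exp_neg_mul hl.ne']
    simp

/-- This sign keeps the coefficient of the elliptic equation in `OpA.surjective` positive. -/
lemma memL_const_nonneg (hg : IsMemoryKernel c g dg) {l : ℝ} (hl : 0 < l) :
    0 ≤ ∫ r in Ioi 0, g r * ((1 - Real.exp (-l * r)) / l) := by
  refine setIntegral_nonneg measurableSet_Ioi fun r hr => ?_
  refine mul_nonneg (hg.nonneg r hr) (div_nonneg ?_ hl.le)
  have : Real.exp (-l * r) ≤ 1 := Real.exp_le_one_iff.2 (by nlinarith [mem_Ioi.1 hr])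
  linarith

end HistoryDissipative

/-! ### Generation of semigroups by maximal dissipative operators -/

section BoundedDissipative

variable {H : Type*} [NormedAddCommGroup H] [InnerProductSpace ℝ H]

/-- The group `e^{tY}` generated by a bounded operator. -/
def expOp (Y : H →L[ℝ] H) (t : ℝ) : H →L[ℝ] H := NormedSpace.exp (t • Y)

lemma expOp_zero (Y : H →L[ℝ] H) : expOp Y 0 = 1 := by
  rw [expOp, zero_smul, NormedSpace.exp_zero]

lemma expOp_add [CompleteSpace H] (Y : H →L[ℝ] H) (t r : ℝ) : expOp Y (t + r) = expOp Y t * expOp Y r := by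
  let _ : NormedAlgebra ℚ (H →L[ℝ] H) := NormedAlgebra.restrictScalars ℚ ℝ _
  rw [expOp, add_smul]
  exact NormedSpace.exp_add_of_commute (((Commute.refl Y).smul_left t).smul_right r)

lemma hasDerivAt_expOp [CompleteSpace H] (Y : H →L[ℝ] H) (t : ℝ) :
    HasDerivAt (expOp Y) (Y * expOp Y t) t :=
  hasDerivAt_exp_smul_const' Y t

lemma hasDerivAt_expOp_apply [CompleteSpace H] (Y : H →L[ℝ] H) (x : H) (t : ℝ) :
    HasDerivAt (fun t => expOp Y t x) (Y (expOp Y t x)) t := by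
  simpa using (hasDerivAt_expOp Y t).clm_apply (hasDerivAt_const t x)

lemma expOp_commute {Y Z : H →L[ℝ] H} (h : Commute Y Z) (t : ℝ) : Commute (expOp Y t) Z := by
  let _ : NormedAlgebra ℚ (H →L[ℝ] H) := NormedAlgebra.restrictScalars ℚ ℝ _
  exact Commute.exp_left (h.smul_left t)

/-- The derivative of `‖e^{tY}x‖²` is `2⟨e^{tY}x, Y e^{tY}x⟩ ≤ 0`. -/
lemma norm_expOp_le [CompleteSpace H] {Y : H →L[ℝ] H} (hY : ∀ x, inner ℝ x (Y x) ≤ 0) {t : ℝ} (ht : 0 ≤ t) (x : H) :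
    ‖expOp Y t x‖ ≤ ‖x‖ := by
  have hd : ∀ t, HasDerivAt (fun t => ‖expOp Y t x‖ ^ 2)
      (2 * inner ℝ (expOp Y t x) (Y (expOp Y t x))) t := fun t =>
    (hasDerivAt_expOp_apply Y x t).norm_sq
  have hanti := antitone_of_hasDerivAt_nonpos hd fun t => by
    have := hY (expOp Y t x)
    change _ ≤ (0 : ℝ)
    linarith
  have h := hanti ht
  simp only [expOp_zero, one_apply_eq_self] at h
  exact le_of_sq_le_sq h (norm_nonneg _)

/-- The path `r ↦ e^{(t-r)Z} e^{rY} x` joins the two vectors, and by commutativity its derivative is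
`e^{(t-r)Z} e^{rY} (Y - Z)x`, bounded by contractivity. -/
lemma norm_expOp_sub_le [CompleteSpace H] {Y Z : H →L[ℝ] H} (hY : ∀ x, inner ℝ x (Y x) ≤ 0)
    (hZ : ∀ x, inner ℝ x (Z x) ≤ 0) (hc : Commute Y Z) {t : ℝ} (ht : 0 ≤ t) (x : H) :
    ‖expOp Y t x - expOp Z t x‖ ≤ t * ‖Y x - Z x‖ := by
  have hd : ∀ r, HasDerivAt (fun r => expOp Z (t - r) (expOp Y r x))
      (expOp Z (t - r) (expOp Y r (Y x - Z x))) r := fun r => by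
    have h1 : HasDerivAt (fun r => expOp Z (t - r)) (-(Z * expOp Z (t - r))) r := by
      have h := (hasDerivAt_expOp Z (t - r)).scomp r ((hasDerivAt_id' r).const_sub t)
      rw [neg_one_smul] at h
      exact h
    refine (h1.clm_apply (hasDerivAt_expOp_apply Y x r)).congr_deriv ?_
    have c1 : Z (expOp Z (t - r) (expOp Y r x)) = expOp Z (t - r) (expOp Y r (Z x)) := by
      have e1 := DFunLike.congr_fun (expOp_commute (Commute.refl Z) (t - r)) (expOp Y r x)
      have e2 := DFunLike.congr_fun (expOp_commute hc r) x
      simp only [mul_apply_eq_comp] at e1 e2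
      rw [← e1, e2]
    have c2 : Y (expOp Y r x) = expOp Y r (Y x) :=
      (DFunLike.congr_fun (expOp_commute (Commute.refl Y) r) x).symm
    rw [neg_apply, mul_apply_eq_comp, c1, c2, map_sub, map_sub]
    abel
  have h := norm_image_sub_le_of_norm_deriv_le_segment' (a := 0) (b := t) (C := ‖Y x - Z x‖)
    (fun r _ => (hd r).hasDerivWithinAt) (fun r hr => ?_) t ⟨ht, le_rfl⟩
  · simpa [expOp_zero, mul_comm] using h
  · exact (norm_expOp_le hZ (by linarith [hr.2]) _).trans (norm_expOp_le hY hr.1 _)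

end BoundedDissipative

/-! ### Yosida approximation and the Lumer–Phillips theorem in a Hilbert space. -/

section Generation

variable {H : Type*} [NormedAddCommGroup H] [InnerProductSpace ℝ H]

/-- Uniformly bounded operators that tend to `0` on a dense set do so everywhere. -/
lemma tendsto_zero_of_dense {ι X Y : Type*} [NormedAddCommGroup X] [NormedSpace ℝ X]
    [NormedAddCommGroup Y] [NormedSpace ℝ Y] {l : Filter ι} {T : ι → X →L[ℝ] Y} {C : ℝ} (hC : 0 ≤ C)
    (hT : ∀ᶠ i in l, ∀ x, ‖T i x‖ ≤ C * ‖x‖) {D : Set X} (hD : Dense D)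
    (h : ∀ x ∈ D, Tendsto (fun i => T i x) l (𝓝 0)) (x : X) :
    Tendsto (fun i => T i x) l (𝓝 0) := by
  rw [Metric.tendsto_nhds]
  intro ε hε
  obtain ⟨z, hz, hxz⟩ := hD.exists_dist_lt x (ε := ε / (2 * (C + 1))) (by positivity)
  filter_upwards [hT, Metric.tendsto_nhds.1 (h z hz) (ε / 2) (by positivity)] with i h1 h2
  rw [dist_zero_right] at h2 ⊢
  have h3 : ‖T i (x - z)‖ ≤ ε / 2 := by
    refine (h1 _).trans ?_
    rw [dist_eq_norm, lt_div_iff₀ (by positivity)] at hxz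
    nlinarith [norm_nonneg (x - z)]
  calc ‖T i x‖ = ‖T i (x - z) + T i z‖ := by rw [map_sub, sub_add_cancel]
    _ ≤ ‖T i (x - z)‖ + ‖T i z‖ := norm_add_le _ _
    _ < ε := by linarith

/-- The data of a maximal dissipative operator with graph `A`: a linear single-valued dissipative
relation for which `λ - A` is onto for large `λ`. -/
structure IsMaxDissipative (A : H → H → Prop) : Prop where
  add : ∀ x y x' y', A x y → A x' y' → A (x + x') (y + y')
  smul : ∀ (a : ℝ) x y, A x y → A (a • x) (a • y)
  unique : ∀ y, A 0 y → y = 0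
  dissipative : ∀ x y, A x y → inner ℝ x y ≤ 0
  surjective : ∃ l₀ : ℝ, ∀ l, l₀ ≤ l → ∀ f, ∃ x y, A x y ∧ l • x - y = f

variable {A : H → H → Prop}

lemma IsMaxDissipative.sub (hA : IsMaxDissipative A) {x y x' y' : H} (h : A x y) (h' : A x' y') :
    A (x - x') (y - y') := by
  have := hA.add _ _ _ _ h (hA.smul (-1) _ _ h')
  simpa [sub_eq_add_neg] using this

/-- Pairing `λx - y` with `x` and using `⟨x,y⟩ ≤ 0`. -/
lemma IsMaxDissipative.norm_le (hA : IsMaxDissipative A) {l : ℝ} (hl : 0 < l) {x y : H}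
    (h : A x y) : ‖x‖ ≤ l⁻¹ * ‖l • x - y‖ := by
  have h1 := hA.dissipative x y h
  have h2 := real_inner_le_norm x (l • x - y)
  rw [inner_sub_right, real_inner_smul_right, real_inner_self_eq_norm_sq] at h2
  rw [inv_mul_eq_div, le_div_iff₀ hl]
  by_cases hx : ‖x‖ = 0
  · rw [hx, zero_mul]; exact norm_nonneg _
  · have : 0 < ‖x‖ := lt_of_le_of_ne (norm_nonneg _) (Ne.symm hx)
    nlinarith

lemma IsMaxDissipative.exists_resolvent (hA : IsMaxDissipative A) {l : ℝ} (hl : 0 < l)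
    (hs : ∀ f, ∃ x y, A x y ∧ l • x - y = f) :
    ∃ R : H →L[ℝ] H, (∀ f, A (R f) (l • R f - f)) ∧ (∀ f, ‖R f‖ ≤ l⁻¹ * ‖f‖) ∧
      ∀ x y, A x y → R (l • x - y) = x := by
  choose R y hR hf using hs
  have hy : ∀ f, y f = l • R f - f := fun f => by
    rw [eq_sub_iff_add_eq, ← eq_sub_iff_add_eq', hf f]
  have uniq : ∀ x z, A x z → R (l • x - z) = x := fun x z h => by
    have h1 := hA.norm_le hl (hA.sub (hR (l • x - z)) h)
    rw [hy] at h1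
    have e : l • (R (l • x - z) - x) - (l • R (l • x - z) - (l • x - z) - z) = 0 := by module
    rw [e, norm_zero, mul_zero] at h1
    exact sub_eq_zero.1 (norm_le_zero_iff.1 h1)
  have hR' : ∀ f, A (R f) (l • R f - f) := fun f => hy f ▸ hR f
  let R' : H →ₗ[ℝ] H :=
    { toFun := R
      map_add' := fun f h => by
        rw [← uniq _ _ (hA.add _ _ _ _ (hR' f) (hR' h))]
        congr 1
        module
      map_smul' := fun a f => by
        rw [RingHom.id_apply, ← uniq _ _ (hA.smul a _ _ (hR' f))]
        congr 1
        module }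
  have hb : ∀ f, ‖R f‖ ≤ l⁻¹ * ‖f‖ := fun f => by
    have := hA.norm_le hl (hR' f)
    rwa [sub_sub_cancel] at this
  exact ⟨R'.mkContinuous l⁻¹ hb, hR', hb, uniq⟩

/-- Let `f` be orthogonal to the domain and solve `λx - y = f`. Pairing with `x` gives `λ‖x‖² =
⟨x,y⟩ ≤ 0`, so `x = 0`; single-valuedness gives `y = 0` and `f = 0`. -/
lemma IsMaxDissipative.dense [CompleteSpace H] (hA : IsMaxDissipative A) : Dense {x | ∃ y, A x y} := by
  obtain ⟨l₀, h₀⟩ := hA.surjective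
  let D : Submodule ℝ H :=
    { carrier := {x | ∃ y, A x y}
      add_mem' := fun ⟨y, hy⟩ ⟨y', hy'⟩ => ⟨y + y', hA.add _ _ _ _ hy hy'⟩
      zero_mem' := by
        obtain ⟨x, y, h, -⟩ := h₀ l₀ le_rfl 0
        exact ⟨(0 : ℝ) • y, by simpa using hA.smul 0 _ _ h⟩
      smul_mem' := fun a x ⟨y, hy⟩ => ⟨a • y, hA.smul a _ _ hy⟩ }
  have hD : D.topologicalClosure = ⊤ := by
    rw [Submodule.topologicalClosure_eq_top_iff, Submodule.eq_bot_iff]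
    intro f hf
    obtain ⟨x, y, h, he⟩ := h₀ (max l₀ 1) (le_max_left _ _) f
    have hl : (0 : ℝ) < max l₀ 1 := lt_of_lt_of_le one_pos (le_max_right _ _)
    have h1 : inner ℝ x f = 0 := (Submodule.mem_orthogonal D f).1 hf x ⟨y, h⟩
    have h2 := hA.dissipative x y h
    rw [← he, inner_sub_right, real_inner_smul_right, real_inner_self_eq_norm_sq] at h1
    have h3 : ‖x‖ = 0 := by
      have : ‖x‖ ^ 2 ≤ 0 := by nlinarith
      nlinarith [norm_nonneg x]
    rw [norm_eq_zero] at h3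
    rw [h3] at h
    rw [← he, h3, hA.unique y h]
    simp
  have : (D : Set H) = {x | ∃ y, A x y} := rfl
  rw [← this]
  exact Submodule.dense_iff_topologicalClosure_eq_top.2 hD

/-- A maximal dissipative operator generates a contraction semigroup. -/
theorem IsMaxDissipative.exists_semigroup [CompleteSpace H] (hA : IsMaxDissipative A) :
    ∃ S : ℝ → H →L[ℝ] H, IsC0Semigroup S ∧ IsGenerator S A := by
  obtain ⟨l₀, h₀⟩ := hA.surjective
  set l : ℕ → ℝ := fun k => max l₀ 0 + k + 1 with hldef
  have hl : ∀ k, 0 < l k := fun k => by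
    have : (0 : ℝ) ≤ max l₀ 0 := le_max_right _ _
    positivity
  have hl0 : ∀ k, l₀ ≤ l k := fun k => by
    have : l₀ ≤ max l₀ 0 := le_max_left _ _
    have : (0 : ℝ) ≤ k := Nat.cast_nonneg k
    simp only [hldef]
    linarith
  have hlt : Tendsto (fun k => (l k)⁻¹) atTop (𝓝 0) := by
    refine tendsto_inv_atTop_zero.comp (tendsto_atTop_mono (fun k => ?_)
      tendsto_natCast_atTop_atTop)
    have : (0 : ℝ) ≤ max l₀ 0 := le_max_right _ _
    simp only [hldef]
    linarith
  choose R hR hb uniq using fun k => hA.exists_resolvent (hl k) (h₀ _ (hl0 k))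
  have hD := hA.dense
  -- the approximation of the identity
  have hid : ∀ y, Tendsto (fun k => l k • R k y) atTop (𝓝 y) := fun y => by
    have h := tendsto_zero_of_dense (l := atTop) (T := fun k => l k • R k - 1) (C := 2)
      (by norm_num) (Eventually.of_forall fun k x => ?_) hD ?_ y
    · simpa using h.add_const y
    · rw [sub_apply, one_apply_eq_self]
      refine (norm_sub_le _ _).trans ?_
      rw [smul_apply, norm_smul, Real.norm_of_nonneg (hl k).le]
      have := mul_le_mul_of_nonneg_left (hb k x) (hl k).le
      rw [mul_inv_cancel_left₀ (hl k).ne'] at this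
      linarith
    · rintro x ⟨z, hz⟩
      have e : ∀ k, (l k • R k - 1) x = R k z := fun k => by
        have := uniq k x z hz
        rw [map_sub, map_smul] at this
        rw [sub_apply, one_apply_eq_self,
          smul_apply]
        nth_rw 2 [← this]
        abel
      simp_rw [e]
      refine squeeze_zero_norm (fun k => hb k z) ?_
      simpa using hlt.mul_const ‖z‖
  -- the Yosida approximation
  set Y : ℕ → H →L[ℝ] H := fun k => l k • (l k • R k - 1) with hY
  -- With `z = A R x` the Yosida operator is `λz` and `x = λRx - z`, so `⟨x,z⟩ = λ⟨Rx,z⟩ - ‖z‖² ≤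
  -- 0`.
  have hYd : ∀ k x, inner ℝ x (Y k x) ≤ 0 := fun k x => by
    set z := l k • R k x - x with hz
    have e1 : Y k x = l k • z := by simp [hY, hz]
    have e2 : x = l k • R k x - z := by rw [hz]; abel
    have h1 := hA.dissipative _ _ (hR k x)
    rw [e1, real_inner_smul_right]
    refine mul_nonpos_of_nonneg_of_nonpos (hl k).le ?_
    nth_rw 1 [e2]
    rw [inner_sub_left, real_inner_smul_left, real_inner_self_eq_norm_sq]
    nlinarith [hl k, sq_nonneg ‖z‖]
  have hYc : ∀ j k, Commute (Y j) (Y k) := fun j k => by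
    have hc : Commute (R j) (R k) := by
      -- The resolvent identity; exchanging `j` and `k` gives commutativity.
      have key : ∀ j k f, (l k - l j) • R j (R k f) = R j f - R k f := fun j k f => by
        rw [← map_smul, ← uniq j _ _ (hA.sub (hR j f) (hR k f))]
        congr 1
        module
      by_cases hjk : l k - l j = 0
      · have : j = k := by
          simp only [hldef] at hjk
          have : (j : ℝ) = k := by linarith
          exact_mod_cast this
        rw [this]
      · ext f
        have h1 := key j k f
        have h2 := key k j f
        have : (l k - l j) • (R j (R k f) - R k (R j f)) = 0 := by
          rw [smul_sub, h1, ← neg_sub (l j), neg_smul, h2]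
          abel
        exact sub_eq_zero.1 ((smul_eq_zero.1 this).resolve_left hjk)
    exact ((((hc.smul_left _).smul_right _).sub_left ((Commute.one_left _))).sub_right
      (Commute.one_right _)).smul_left _ |>.smul_right _
  have hYt : ∀ x y, A x y → Tendsto (fun k => Y k x) atTop (𝓝 y) := fun x y h => by
    refine (hid y).congr fun k => ?_
    have := uniq k x y h
    rw [map_sub, map_smul] at this
    simp only [hY, smul_apply, sub_apply,
      one_apply_eq_self]
    congr 1
    rw [eq_sub_iff_add_eq, ← eq_sub_iff_add_eq', this]
  have hcon : ∀ k t, 0 ≤ t → ∀ x, ‖expOp (Y k) t x‖ ≤ ‖x‖ := fun k t ht x =>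
    norm_expOp_le (hYd k) ht x
  -- the limit
  have hlim : ∀ t, 0 ≤ t → ∀ x, ∃ y, Tendsto (fun k => expOp (Y k) t x) atTop (𝓝 y) :=
    fun t ht x => by
    refine cauchySeq_tendsto_of_complete ?_
    rw [cauchySeq_iff_tendsto_dist_atTop_0]
    have h := tendsto_zero_of_dense (l := atTop)
      (T := fun p : ℕ × ℕ => expOp (Y p.1) t - expOp (Y p.2) t) (C := 2) (by norm_num)
      (Eventually.of_forall fun p x => ?_) hD ?_ x
    · simpa [dist_eq_norm] using h.norm
    · rw [sub_apply]
      refine (norm_sub_le _ _).trans ?_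
      linarith [hcon p.1 t ht x, hcon p.2 t ht x]
    · rintro x ⟨y, hy⟩
      refine squeeze_zero_norm (fun p => norm_expOp_sub_le (hYd p.1) (hYd p.2) (hYc p.1 p.2) ht x) ?_
      have h1 : Tendsto (fun p : ℕ × ℕ => ‖Y p.1 x - Y p.2 x‖) atTop (𝓝 0) := by
        have := cauchySeq_iff_tendsto_dist_atTop_0.1 (hYt x y hy).cauchySeq
        simpa only [dist_eq_norm] using this
      simpa using h1.const_mul t
  choose! S₀ hS₀ using hlim
  -- The limit exists for `t ≥ 0` only; at negative times the value at `0` is used.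
  let S : ℝ → H →L[ℝ] H := fun t =>
    LinearMap.mkContinuous
      { toFun := S₀ (max t 0)
        map_add' := fun x y => tendsto_nhds_unique (hS₀ _ (le_max_right _ _) (x + y)) (by
          simpa only [map_add] using
            (hS₀ _ (le_max_right t 0) x).add (hS₀ _ (le_max_right t 0) y))
        map_smul' := fun a x => tendsto_nhds_unique (hS₀ _ (le_max_right _ _) (a • x)) (by
          simpa only [map_smul, RingHom.id_apply] using (hS₀ _ (le_max_right t 0) x).const_smul a) }
      1 fun x => by
        rw [one_mul]
        exact le_of_tendsto (hS₀ _ (le_max_right _ _) x).norm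
          (Eventually.of_forall fun k => hcon k _ (le_max_right _ _) x)
  have hS : ∀ t, 0 ≤ t → ∀ x, Tendsto (fun k => expOp (Y k) t x) atTop (𝓝 (S t x)) :=
    fun t ht x => by
      have e : S t x = S₀ (max t 0) x := rfl
      rw [e, max_eq_left ht]
      exact hS₀ t ht x
  have hSn : ∀ t, 0 ≤ t → ∀ x, ‖S t x‖ ≤ ‖x‖ := fun t ht x =>
    le_of_tendsto (hS t ht x).norm (Eventually.of_forall fun k => hcon k t ht x)
  have hYx : ∀ k t x, 0 ≤ t → ‖expOp (Y k) t x - x‖ ≤ t * ‖Y k x‖ := fun k t x ht => by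
    have h := norm_expOp_sub_le (hYd k) (Z := 0) (by simp) (Commute.zero_right _) ht x
    have e : expOp (0 : H →L[ℝ] H) t = 1 := by rw [expOp, smul_zero, NormedSpace.exp_zero]
    simpa [e] using h
  have hSx : ∀ t x y, 0 ≤ t → A x y → ‖S t x - x‖ ≤ t * ‖y‖ := fun t x y ht h =>
    le_of_tendsto_of_tendsto ((hS t ht x).sub_const x).norm ((hYt x y h).norm.const_mul t)
      (Eventually.of_forall fun k => hYx k t x ht)
  have hc0 : IsC0Semigroup S := by
    refine ⟨?_, fun t r ht hr => ?_, fun x => ?_⟩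
    · ext x
      refine tendsto_nhds_unique (hS 0 le_rfl x) ?_
      simp [expOp_zero]
    · ext x
      refine tendsto_nhds_unique (hS (t + r) (add_nonneg ht hr) x) ?_
      have h1 : Tendsto (fun k => expOp (Y k) t (expOp (Y k) r x - S r x)) atTop (𝓝 0) := by
        refine squeeze_zero_norm (fun k => hcon k t ht _) ?_
        simpa using ((hS r hr x).sub_const (S r x)).norm
      have h2 := h1.add (hS t ht (S r x))
      rw [zero_add] at h2
      refine h2.congr fun k => ?_
      rw [map_sub, sub_add_cancel, expOp_add]
      rfl
    · have h := tendsto_zero_of_dense (l := 𝓝[>] (0 : ℝ)) (T := fun t => S t - 1) (C := 2)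
        (by norm_num) ?_ hD ?_ x
      · simpa using h.add_const x
      · filter_upwards [self_mem_nhdsWithin] with t ht x
        rw [sub_apply, one_apply_eq_self]
        refine (norm_sub_le _ _).trans ?_
        linarith [hSn t (le_of_lt ht) x]
      · rintro x ⟨y, hy⟩
        have h1 : Tendsto (fun t : ℝ => t * ‖y‖) (𝓝[>] 0) (𝓝 0) := by
          have : Continuous fun t : ℝ => t * ‖y‖ := by fun_prop
          simpa using (this.tendsto 0).mono_left nhdsWithin_le_nhds
        refine squeeze_zero_norm' ?_ h1
        filter_upwards [self_mem_nhdsWithin] with t ht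
        exact hSx t x y (le_of_lt ht) hy
  refine ⟨S, hc0, ?_⟩
  -- A quantitative form of differentiability at `0`. The image `y` of `x` need not lie in the
  -- domain, so it is compared with a domain element `z`, for which `e^{rY}z - z` is of order `r`;
  -- density makes `‖y - z‖` small afterwards.
  have hquad : ∀ t x y z z', 0 ≤ t → A x y → A z z' →
      ‖S t x - x - t • y‖ ≤ t * (t * ‖z'‖ + 2 * ‖y - z‖) := fun t x y z z' ht hxy hz => by
    have hk : ∀ k, ‖expOp (Y k) t x - x - t • Y k x‖ ≤
        t * (t * ‖Y k z‖ + 2 * ‖Y k x - z‖) := fun k => by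
      have hd : ∀ r, HasDerivAt (fun r => expOp (Y k) r x - r • Y k x)
          (expOp (Y k) r (Y k x) - Y k x) r := fun r => by
        have h1 := (hasDerivAt_expOp_apply (Y k) x r).sub
          ((hasDerivAt_id' r).smul_const (Y k x))
        refine h1.congr_deriv ?_
        rw [one_smul]
        congr 1
        exact (DFunLike.congr_fun (expOp_commute (Commute.refl (Y k)) r) x).symm
      have h := norm_image_sub_le_of_norm_deriv_le_segment' (a := 0) (b := t)
        (C := t * ‖Y k z‖ + 2 * ‖Y k x - z‖)
        (fun r _ => (hd r).hasDerivWithinAt) (fun r hr => ?_) t ⟨ht, le_rfl⟩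
      · simp only [expOp_zero, one_apply_eq_self, zero_smul, sub_zero] at h
        rw [sub_right_comm, mul_comm]
        exact h
      · have e : expOp (Y k) r (Y k x) - Y k x = expOp (Y k) r (Y k x - z) +
            (expOp (Y k) r z - z) - (Y k x - z) := by rw [map_sub]; abel
        rw [e]
        refine (norm_sub_le _ _).trans ?_
        have h1 := norm_add_le (expOp (Y k) r (Y k x - z)) (expOp (Y k) r z - z)
        have h2 := hcon k r hr.1 (Y k x - z)
        have h3 := hYx k r z hr.1
        have h4 := mul_le_mul_of_nonneg_right hr.2.le (norm_nonneg (Y k z))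
        linarith
    refine le_of_tendsto_of_tendsto (((hS t ht x).sub_const x).sub
      ((hYt x y hxy).const_smul t)).norm ?_ (Eventually.of_forall hk)
    exact ((((hYt z z' hz).norm.const_mul t).add
      (((hYt x y hxy).sub_const z).norm.const_mul 2)).const_mul t)
  have hgen : ∀ x y, A x y → Tendsto (fun t : ℝ => t⁻¹ • (S t x - x)) (𝓝[>] 0) (𝓝 y) :=
    fun x y hxy => by
    rw [Metric.tendsto_nhds]
    intro ε hε
    obtain ⟨z, ⟨z', hz⟩, hyz⟩ := hD.exists_dist_lt y (ε := ε / 4) (by positivity)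
    rw [dist_eq_norm] at hyz
    have h1 : Tendsto (fun t : ℝ => t * ‖z'‖) (𝓝[>] 0) (𝓝 0) := by
      have : Continuous fun t : ℝ => t * ‖z'‖ := by fun_prop
      simpa using (this.tendsto 0).mono_left nhdsWithin_le_nhds
    filter_upwards [self_mem_nhdsWithin, h1.eventually (gt_mem_nhds (half_pos hε))] with t ht h2
    have ht' : (0 : ℝ) < t := ht
    rw [dist_eq_norm]
    have e : t⁻¹ • (S t x - x) - y = t⁻¹ • (S t x - x - t • y) := by
      rw [smul_sub _ _ (t • y), smul_smul, inv_mul_cancel₀ ht'.ne', one_smul]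
    rw [e, norm_smul, norm_inv, Real.norm_of_nonneg ht'.le, inv_mul_eq_div, div_lt_iff₀ ht']
    calc _ ≤ t * (t * ‖z'‖ + 2 * ‖y - z‖) := hquad t x y z z' ht'.le hxy hz
      _ < ε * t := by rw [mul_comm]; gcongr; linarith
  intro x y
  refine ⟨hgen x y, fun h => ?_⟩
  -- The generator is no larger than `A`: if `S` is differentiable at `x` with derivative `y`, let
  -- `x'` be the domain element solving the resolvent equation with right-hand side `λx - y`. Then
  -- `u = x - x'` has derivative `λu`, while contractivity gives `⟨u, λu⟩ ≤ 0`, so `u = 0`.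
  have hx' := hR 0 (l 0 • x - y)
  set x' := R 0 (l 0 • x - y)
  have hd := h.sub (hgen _ _ hx')
  have hin : inner ℝ (x - x') (y - (l 0 • x' - (l 0 • x - y))) ≤ 0 := by
    refine le_of_tendsto ((tendsto_const_nhds (x := x - x')).inner hd) ?_
    filter_upwards [self_mem_nhdsWithin] with t ht
    have ht' : (0 : ℝ) < t := ht
    rw [← smul_sub, real_inner_smul_right]
    refine mul_nonpos_of_nonneg_of_nonpos (inv_nonneg.2 ht'.le) ?_
    have e : S t x - x - (S t x' - x') = S t (x - x') - (x - x') := by rw [map_sub]; abel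
    rw [e, inner_sub_right, real_inner_self_eq_norm_sq]
    have h1 := real_inner_le_norm (x - x') (S t (x - x'))
    have h2 := hSn t ht'.le (x - x')
    nlinarith [norm_nonneg (x - x')]
  have e : y - (l 0 • x' - (l 0 • x - y)) = l 0 • (x - x') := by module
  rw [e, real_inner_smul_right, real_inner_self_eq_norm_sq] at hin
  have h0 : ‖x - x'‖ = 0 := by
    have : ‖x - x'‖ ^ 2 ≤ 0 := by nlinarith [hl 0]
    nlinarith [norm_nonneg (x - x')]
  have hxx : x = x' := sub_eq_zero.1 (norm_eq_zero.1 h0)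
  rw [← hxx, sub_sub_cancel] at hx'
  exact hx'

/-- The product rule at `0`. It serves with `β` and with `-β`, to pass between the generators of the
original and the rescaled semigroup. -/
lemma tendsto_exp_smul {X : Type*} [NormedAddCommGroup X] [NormedSpace ℝ X] {u : ℝ → X} {x y : X}
    (β : ℝ) (h : Tendsto (fun t : ℝ => t⁻¹ • (u t - x)) (𝓝[>] 0) (𝓝 y)) :
    Tendsto (fun t : ℝ => t⁻¹ • (Real.exp (β * t) • u t - x)) (𝓝[>] 0) (𝓝 (y + β • x)) := by
  have h1 : Tendsto (fun t : ℝ => Real.exp (β * t)) (𝓝[>] 0) (𝓝 1) := by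
    have : Continuous fun t : ℝ => Real.exp (β * t) := by fun_prop
    simpa using (this.tendsto 0).mono_left nhdsWithin_le_nhds
  have h2 : Tendsto (fun t : ℝ => t⁻¹ * (Real.exp (β * t) - 1)) (𝓝[>] 0) (𝓝 β) := by
    have hd : HasDerivAt (fun t : ℝ => Real.exp (β * t)) β 0 := by
      simpa using (((hasDerivAt_id' (0 : ℝ)).const_mul β).exp)
    have := (hasDerivAt_iff_tendsto_slope.1 hd).mono_left
      (nhdsWithin_mono 0 (fun t (ht : 0 < t) => ht.ne') : 𝓝[>] (0 : ℝ) ≤ 𝓝[≠] 0)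
    refine this.congr fun t => ?_
    simp [slope_def_field, div_eq_inv_mul]
  have h3 := (h1.smul h).add (h2.smul_const x)
  rw [one_smul] at h3
  refine h3.congr fun t => ?_
  module

/-- An equivalence with a Hilbert space for whose inner product the operator `A - β` is maximal
dissipative makes `A` a generator. -/
theorem exists_semigroup_of_equiv [CompleteSpace H] {X : Type*} [NormedAddCommGroup X] [NormedSpace ℝ X]
    (e : X ≃L[ℝ] H) {A : X → X → Prop} {β : ℝ}
    (h_add : ∀ x y x' y', A x y → A x' y' → A (x + x') (y + y'))
    (smul : ∀ (a : ℝ) x y, A x y → A (a • x) (a • y))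
    (unique : ∀ y, A 0 y → y = 0)
    (dissipative : ∀ x y, A x y → inner ℝ (e x) (e y) ≤ β * ‖e x‖ ^ 2)
    (surjective : ∃ l₀ : ℝ, ∀ l, l₀ ≤ l → ∀ f, ∃ x y, A x y ∧ l • x - y = f) :
    ∃ S : ℝ → X →L[ℝ] X, IsC0Semigroup S ∧ IsGenerator S A := by
  have hB : IsMaxDissipative fun p q : H => A (e.symm p) (e.symm q + β • e.symm p) := by
    refine ⟨fun p q p' q' h h' => ?_, fun a p q h => ?_, fun q h => ?_, fun p q h => ?_, ?_⟩
    · convert h_add _ _ _ _ h h' using 1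
      · simp
      · simp only [map_add]; module
    · convert smul a _ _ h using 1
      · simp
      · simp only [map_smul]; module
    · have := unique _ (by simpa using h)
      simpa using this
    · have := dissipative _ _ h
      simp only [map_add, map_smul, ContinuousLinearEquiv.apply_symm_apply, inner_add_right,
        real_inner_smul_right, real_inner_self_eq_norm_sq] at this
      linarith
    · obtain ⟨l₀, h⟩ := surjective
      refine ⟨l₀ - β, fun l hl f => ?_⟩
      obtain ⟨x, y, hxy, hf⟩ := h (l + β) (by linarith) (e.symm f)
      refine ⟨e x, e (y - β • x), by simpa using hxy, ?_⟩
      have : f = e ((l + β) • x - y) := by rw [hf]; simp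
      rw [this]
      simp only [map_sub, map_smul]
      module
  obtain ⟨S, hS, hG⟩ := hB.exists_semigroup
  let T : ℝ → X →L[ℝ] X := fun t => Real.exp (β * t) •
    ((e.symm : H →L[ℝ] X).comp ((S t).comp (e : X →L[ℝ] H)))
  have hT : ∀ t x, T t x = Real.exp (β * t) • e.symm (S t (e x)) := fun t x => rfl
  refine ⟨T, ⟨?_, fun t r ht hr => ?_, fun x => ?_⟩, fun x y => ?_⟩
  · ext x
    rw [hT, hS.zero]
    simp
  · ext x
    rw [ContinuousLinearMap.comp_apply, hT, hT, hT, hS.add t r ht hr, mul_add, Real.exp_add]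
    simp [smul_smul]
  · simp_rw [hT]
    have h1 : Tendsto (fun t : ℝ => Real.exp (β * t)) (𝓝[>] 0) (𝓝 1) := by
      have : Continuous fun t : ℝ => Real.exp (β * t) := by fun_prop
      simpa using (this.tendsto 0).mono_left nhdsWithin_le_nhds
    have h2 := h1.smul ((e.symm.continuous.tendsto _).comp (hS.tendsto (e x)))
    simpa using h2
  · have hBA : A x y ↔ Tendsto (fun t : ℝ => t⁻¹ • (S t (e x) - e x)) (𝓝[>] 0)
        (𝓝 (e (y - β • x))) := by
      rw [← hG]
      simp
    have h2 : Tendsto (fun t : ℝ => t⁻¹ • (S t (e x) - e x)) (𝓝[>] 0) (𝓝 (e (y - β • x))) ↔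
        Tendsto (fun t : ℝ => t⁻¹ • (e.symm (S t (e x)) - x)) (𝓝[>] 0) (𝓝 (y - β • x)) := by
      constructor
      · intro h
        have := (e.symm.continuous.tendsto _).comp h
        simpa [Function.comp_def] using this
      · intro h
        have := (e.continuous.tendsto _).comp h
        simpa [Function.comp_def] using this
    rw [hBA, h2]
    constructor
    · intro h
      have := tendsto_exp_smul β h
      rw [sub_add_cancel] at this
      exact this
    · intro h
      have := tendsto_exp_smul (-β) h
      rw [neg_smul, ← sub_eq_add_neg] at this
      refine this.congr fun t => ?_
      rw [hT, smul_smul, ← Real.exp_add]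
      simp

end Generation

/-! ### The operator `𝒜` -/

section Pair

variable {X E F : Type*} [NormedAddCommGroup X] [NormedSpace ℝ X] [NormedAddCommGroup E]
  [InnerProductSpace ℝ E] [NormedAddCommGroup F] [InnerProductSpace ℝ F]

/-- The pair of two operators, with values in the Hilbert sum. -/
def pairL (A : X →L[ℝ] E) (B : X →L[ℝ] F) : X →L[ℝ] WithLp 2 (E × F) :=
  ((WithLp.prodContinuousLinearEquiv 2 ℝ E F).symm : E × F →L[ℝ] WithLp 2 (E × F)).comp (A.prod B)

lemma inner_pairL (A : X →L[ℝ] E) (B : X →L[ℝ] F) (x y : X) :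
    inner ℝ (pairL A B x) (pairL A B y) = inner ℝ (A x) (A y) + inner ℝ (B x) (B y) :=
  WithLp.prod_inner_apply _ _

end Pair

/-! ### Components of the phase space. -/

section Phase

variable {n s : ℕ} {dg : ℝ → ℝ}

/-- The components of the phase space as bounded operators. -/
def Phase.psiL : Phase n s dg →L[ℝ] Hom n s := WithLp.fstL 2 ℝ _ _

/-- The component `v`. -/
def Phase.vL : Phase n s dg →L[ℝ] Sob n (s + 1) :=
  (WithLp.fstL 2 ℝ _ _).comp (WithLp.sndL 2 ℝ _ _)

/-- The component `w`. -/
def Phase.wL : Phase n s dg →L[ℝ] Sob n s :=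
  (WithLp.fstL 2 ℝ _ _).comp ((WithLp.sndL 2 ℝ _ _).comp (WithLp.sndL 2 ℝ _ _))

/-- The component `η`. -/
def Phase.etaL : Phase n s dg →L[ℝ] Hist n s dg :=
  (WithLp.sndL 2 ℝ _ _).comp ((WithLp.sndL 2 ℝ _ _).comp (WithLp.sndL 2 ℝ _ _))

lemma Phase.psiL_apply (Ψ : Phase n s dg) : Phase.psiL Ψ = Ψ.psi := rfl
lemma Phase.vL_apply (Ψ : Phase n s dg) : Phase.vL Ψ = Ψ.v := rfl
lemma Phase.wL_apply (Ψ : Phase n s dg) : Phase.wL Ψ = Ψ.w := rfl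
lemma Phase.etaL_apply (Ψ : Phase n s dg) : Phase.etaL Ψ = Ψ.eta := rfl

/-- The vector `(ψ, v, w, η)`. -/
def Phase.mk (ψ : Hom n s) (v : Sob n (s + 1)) (w : Sob n s) (η : Hist n s dg) : Phase n s dg :=
  WithLp.toLp 2 (ψ, WithLp.toLp 2 (v, WithLp.toLp 2 (w, η)))

lemma Phase.ext {Ψ Φ : Phase n s dg} (h1 : Ψ.psi = Φ.psi) (h2 : Ψ.v = Φ.v) (h3 : Ψ.w = Φ.w)
    (h4 : Ψ.eta = Φ.eta) : Ψ = Φ := by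
  have e : ∀ Ψ : Phase n s dg, Ψ = Phase.mk Ψ.psi Ψ.v Ψ.w Ψ.eta := fun _ => rfl
  rw [e Ψ, e Φ, h1, h2, h3, h4]

lemma Phase.norm_sq_eq (Ψ : Phase n s dg) :
    ‖Ψ‖ ^ 2 = ‖Ψ.psi‖ ^ 2 + (‖Ψ.v‖ ^ 2 + (‖Ψ.w‖ ^ 2 + ‖Ψ.eta‖ ^ 2)) := by
  rw [WithLp.prod_norm_sq_eq_of_L2, WithLp.prod_norm_sq_eq_of_L2, WithLp.prod_norm_sq_eq_of_L2]
  rfl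

lemma Phase.norm_psi_le (Ψ : Phase n s dg) : ‖Ψ.psi‖ ≤ ‖Ψ‖ :=
  le_of_sq_le_sq (by
    rw [Ψ.norm_sq_eq]
    nlinarith [sq_nonneg ‖Ψ.v‖, sq_nonneg ‖Ψ.w‖, sq_nonneg ‖Ψ.eta‖]) (norm_nonneg _)

lemma Phase.norm_v_le (Ψ : Phase n s dg) : ‖Ψ.v‖ ≤ ‖Ψ‖ :=
  le_of_sq_le_sq (by
    rw [Ψ.norm_sq_eq]
    nlinarith [sq_nonneg ‖Ψ.psi‖, sq_nonneg ‖Ψ.w‖, sq_nonneg ‖Ψ.eta‖]) (norm_nonneg _)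

lemma Phase.norm_w_le (Ψ : Phase n s dg) : ‖Ψ.w‖ ≤ ‖Ψ‖ :=
  le_of_sq_le_sq (by
    rw [Ψ.norm_sq_eq]
    nlinarith [sq_nonneg ‖Ψ.v‖, sq_nonneg ‖Ψ.psi‖, sq_nonneg ‖Ψ.eta‖]) (norm_nonneg _)

lemma Phase.norm_eta_le (Ψ : Phase n s dg) : ‖Ψ.eta‖ ≤ ‖Ψ‖ :=
  le_of_sq_le_sq (by
    rw [Ψ.norm_sq_eq]
    nlinarith [sq_nonneg ‖Ψ.v‖, sq_nonneg ‖Ψ.w‖, sq_nonneg ‖Ψ.psi‖]) (norm_nonneg _)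

lemma norm_grad_le (hn : 3 ≤ n) (v : Sob n (s + 1)) : ‖grad hn s v‖ ≤ ‖v‖ :=
  le_of_sq_le_sq (by rw [norm_sq_grad hn v]; nlinarith [sq_nonneg ‖v.fn‖]) (norm_nonneg _)

end Phase

/-! ### Weak divergences and Laplacians as linear relations. -/

section Div

variable {n s : ℕ}

lemma HasWeakDiv.add {q q' : Fin n → RN n → ℝ} {h h' : RN n → ℝ} (H : HasWeakDiv q h)
    (H' : HasWeakDiv q' h') : HasWeakDiv (fun i => q i + q' i) (h + h') := by
  refine ⟨fun i => (H.1 i).add (H'.1 i), H.2.1.add H'.2.1, fun φ hs hc => ?_⟩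
  have I : ∀ i, Integrable (fun x => q i x * partialD i φ x) := fun i =>
    integrable_mul_test (H.1 i) (continuous_partialD i hs) (hasCompactSupport_partialD i hc)
  have I' : ∀ i, Integrable (fun x => q' i x * partialD i φ x) := fun i =>
    integrable_mul_test (H'.1 i) (continuous_partialD i hs) (hasCompactSupport_partialD i hc)
  simp only [Pi.add_apply, add_mul, Finset.sum_add_distrib]
  rw [integral_add (integrable_finsetSum _ fun i _ => I i)
    (integrable_finsetSum _ fun i _ => I' i), H.2.2 φ hs hc, H'.2.2 φ hs hc,
    integral_add (integrable_mul_test H.2.1 hs.continuous hc)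
      (integrable_mul_test H'.2.1 hs.continuous hc)]
  ring

lemma HasWeakDiv.smul {q : Fin n → RN n → ℝ} {h : RN n → ℝ} (a : ℝ) (H : HasWeakDiv q h) :
    HasWeakDiv (fun i => a • q i) (a • h) := by
  refine ⟨fun i => (H.1 i).smul a, H.2.1.smul a, fun φ hs hc => ?_⟩
  simp only [Pi.smul_apply, smul_eq_mul, mul_assoc, ← Finset.mul_sum]
  rw [integral_const_mul, integral_const_mul, H.2.2 φ hs hc]
  ring

/-- `h ∈ H^s` is the divergence of the gradient field of `q`. -/
def HasLap (q : Hom n s) (h : Sob n s) : Prop := HasWeakDiv (fun i => (q.d i : RN n → ℝ)) h.fn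

lemma HasLap.add {q q' : Hom n s} {h h' : Sob n s} (H : HasLap q h) (H' : HasLap q' h') :
    HasLap (q + q') (h + h') :=
  (HasWeakDiv.add H H').congr (fun i => (Lp.coeFn_add (q.d i) (q'.d i)).symm)
    (Lp.coeFn_add h.fn h'.fn).symm

lemma HasLap.smul {q : Hom n s} {h : Sob n s} (a : ℝ) (H : HasLap q h) :
    HasLap (a • q) (a • h) :=
  (HasWeakDiv.smul a H).congr (fun i => (Lp.coeFn_smul a (q.d i)).symm)
    (Lp.coeFn_smul a h.fn).symm

lemma HasLap.unique {q : Hom n s} {h h' : Sob n s} (H : HasLap q h) (H' : HasLap q h') : h = h' :=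
  Sob.ext_fn (Lp.ext (HasWeakDiv.unique H H'))

lemma HasLap.zero : HasLap (0 : Hom n s) 0 := by
  refine HasWeakDiv.congr (q := fun _ => 0) (h := 0)
    ⟨fun i => locallyIntegrable_zero, locallyIntegrable_zero, fun φ _ _ => by simp⟩
    (fun i => (Lp.coeFn_zero ℝ 2 volume).symm) (Lp.coeFn_zero ℝ 2 volume).symm

end Div

/-! ### Linear structure and bounds for the history derivative. -/

section Hist

variable {c : ℝ} {g dg : ℝ → ℝ}

/-- Constant histories. -/
def constHist (hg : IsMemoryKernel c g dg) (E : Type*) [NormedAddCommGroup E] [NormedSpace ℝ E] :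
    E →L[ℝ] Lp E 2 (histMeasure dg) :=
  haveI := hg.isFiniteMeasure
  Lp.constL 2 (histMeasure dg) ℝ

lemma constHist_coe (hg : IsMemoryKernel c g dg) {E : Type*} [NormedAddCommGroup E]
    [NormedSpace ℝ E] (V : E) : ∀ᵐ r ∂(histMeasure dg), constHist hg E V r = V := by
  have := hg.isFiniteMeasure
  exact Lp.coeFn_const (p := 2) (μ := histMeasure dg) V

variable {n s : ℕ}

lemma HasHistDeriv.add (hg : IsMemoryKernel c g dg) {η ξ η' ξ' : Hist n s dg}
    (h : HasHistDeriv η ξ) (h' : HasHistDeriv η' ξ') : HasHistDeriv (η + η') (ξ + ξ') := by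
  filter_upwards [hg.ae_good, h, h', Lp.coeFn_add η η'] with r hr h1 h2 h3
  refine ⟨hg.intervalIntegrable (hg.integrable_hist _) hr.1 hr.2, ?_⟩
  rw [h3, Pi.add_apply, h1.2, h2.2, ← intervalIntegral.integral_add h1.1 h2.1]
  refine intervalIntegral.integral_congr_ae ?_
  filter_upwards [hg.ae_hist_iff.1 (Lp.coeFn_add ξ ξ')] with y h4 hy
  rw [uIoc_of_le hr.1.le] at hy
  rw [h4 hy.1 (hg.deriv_neg_mono hr.2 hy.1 hy.2), Pi.add_apply]

lemma HasHistDeriv.smul (hg : IsMemoryKernel c g dg) (a : ℝ) {η ξ : Hist n s dg}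
    (h : HasHistDeriv η ξ) : HasHistDeriv (a • η) (a • ξ) := by
  filter_upwards [hg.ae_good, h, Lp.coeFn_smul a η] with r hr h1 h3
  refine ⟨hg.intervalIntegrable (hg.integrable_hist _) hr.1 hr.2, ?_⟩
  rw [h3, Pi.smul_apply, h1.2, ← intervalIntegral.integral_smul]
  refine intervalIntegral.integral_congr_ae ?_
  filter_upwards [hg.ae_hist_iff.1 (Lp.coeFn_smul a ξ)] with y h4 hy
  rw [uIoc_of_le hr.1.le] at hy
  rw [h4 hy.1 (hg.deriv_neg_mono hr.2 hy.1 hy.2), Pi.smul_apply]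

/-- Makes `∂ₛ`, and with it `𝒜`, single-valued. -/
lemma HasHistDeriv.eq_zero (hn : 3 ≤ n) (hg : IsMemoryKernel c g dg) {ξ : Hist n s dg}
    (h : HasHistDeriv 0 ξ) : ξ = 0 := by
  have := completeSpace_hom (s := s) hn
  refine Lp.ext ((hg.deriv_eq_zero (hg.integrable_hist ξ) ?_).trans (Lp.coeFn_zero _ _ _).symm)
  filter_upwards [h, Lp.coeFn_zero (Hom n s) 2 (histMeasure dg)] with r h1 h2
  rw [← h1.2, h2, Pi.zero_apply]

/-- Integration by parts moves the derivative onto `g`, so `∫ g ∂ₛη = ∫ (-g') η` is controlled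
without any bound on `∂ₛη`. -/
lemma HasHistDeriv.norm_memL_le (hn : 3 ≤ n) (hg : IsMemoryKernel c g dg) {η ξ : Hist n s dg}
    (h : HasHistDeriv η ξ) :
    ‖memL hg (Hom n s) ξ‖ ≤ √((histMeasure dg).real univ) * ‖η‖ := by
  have := completeSpace_hom (s := s) hn
  rw [memL_apply, hg.memory_deriv (Lp.stronglyMeasurable ξ) (hg.integrable_hist ξ)
    (h.mono fun r h => h.2)]
  exact (norm_integral_le_integral_norm _).trans (hg.integral_norm_le η)

end Hist

/-! ### Energy, dissipativity and the range condition for `𝒜`. -/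

section Operator

variable {n s : ℕ} {τ b c : ℝ} {g dg : ℝ → ℝ}

/-- The potential `c_g²ψ + bv + ∫₀^∞ g η` of the flux. -/
def fluxL (hn : 3 ≤ n) (hg : IsMemoryKernel c g dg) (b : ℝ) : Phase n s dg →L[ℝ] Hom n s :=
  cgSq c g • Phase.psiL + b • (grad hn s).comp Phase.vL + (memL hg (Hom n s)).comp Phase.etaL

lemma fluxL_apply (hn : 3 ≤ n) (hg : IsMemoryKernel c g dg) (b : ℝ) (Ψ : Phase n s dg) :
    fluxL hn hg b Ψ = cgSq c g • Ψ.psi + b • grad hn s Ψ.v + memL hg (Hom n s) Ψ.eta := rfl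

lemma fluxL_d (hn : 3 ≤ n) (hg : IsMemoryKernel c g dg) (b : ℝ) (Ψ : Phase n s dg) (i : Fin n) :
    (fluxL hn hg b Ψ).d i =ᵐ[volume] fun x =>
      cgSq c g * Ψ.psi.d i x + b * Ψ.v.d i x + (memory g Ψ.eta).d i x := by
  have e : (fluxL hn hg b Ψ).d i =
      cgSq c g • Ψ.psi.d i + b • Ψ.v.d i + (memory g Ψ.eta).d i := by
    rw [← sobD_fn i Ψ.v]
    rfl
  rw [e]
  filter_upwards [Lp.coeFn_add (cgSq c g • Ψ.psi.d i + b • Ψ.v.d i) ((memory g Ψ.eta).d i),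
    Lp.coeFn_add (cgSq c g • Ψ.psi.d i) (b • Ψ.v.d i), Lp.coeFn_smul (cgSq c g) (Ψ.psi.d i),
    Lp.coeFn_smul b (Ψ.v.d i)] with x h1 h2 h3 h4
  rw [h1, Pi.add_apply, h2, Pi.add_apply, h3, h4]
  rfl

/-- The operator `𝒜` in terms of bounded operators. -/
lemma opA_iff (hn : 3 ≤ n) (hg : IsMemoryKernel c g dg) {Ψ Φ : Phase n s dg} :
    OpA τ b c g Ψ Φ ↔ Φ.psi = grad hn s Ψ.v ∧ sobRes n s Φ.v = Ψ.w ∧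
      (∃ h, HasLap (fluxL hn hg b Ψ) h ∧ Φ.w = -(1 / τ) • Ψ.w + (1 / τ) • h) ∧
      ∃ ξ, HasHistDeriv Ψ.eta ξ ∧ Φ.eta = constHist hg (Hom n s) (grad hn s Ψ.v) - ξ := by
  refine and_congr ?_ (and_congr ?_ (and_congr ?_ ?_))
  · exact ⟨fun h => h.unique (grad_is hn Ψ.v), fun h => h ▸ grad_is hn Ψ.v⟩
  · exact ⟨fun h => Sob.ext_fn h, fun h => by rw [← h, sobRes_fn]⟩
  · refine exists_congr fun h => and_congr_left fun _ => ⟨fun H => ?_, fun H => ?_⟩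
    · exact HasWeakDiv.congr H (fun i => (fluxL_d hn hg b Ψ i).symm) EventuallyEq.rfl
    · exact HasWeakDiv.congr H (fun i => fluxL_d hn hg b Ψ i) EventuallyEq.rfl
  · constructor
    · rintro ⟨V, ξ, hV, hξ, h⟩
      refine ⟨ξ, hξ, Lp.ext ?_⟩
      rw [hV.unique (grad_is hn Ψ.v)] at h
      filter_upwards [h, Lp.coeFn_sub (constHist hg (Hom n s) (grad hn s Ψ.v)) ξ,
        constHist_coe hg (grad hn s Ψ.v)] with r h1 h2 h3
      rw [h1, h2, Pi.sub_apply, h3]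
    · rintro ⟨ξ, hξ, h⟩
      refine ⟨grad hn s Ψ.v, ξ, grad_is hn Ψ.v, hξ, ?_⟩
      rw [h]
      filter_upwards [Lp.coeFn_sub (constHist hg (Hom n s) (grad hn s Ψ.v)) ξ,
        constHist_coe hg (grad hn s Ψ.v)] with r h2 h3
      rw [h2, Pi.sub_apply, h3]

lemma OpA.add (hn : 3 ≤ n) (hg : IsMemoryKernel c g dg) {Ψ Φ Ψ' Φ' : Phase n s dg}
    (h : OpA τ b c g Ψ Φ) (h' : OpA τ b c g Ψ' Φ') : OpA τ b c g (Ψ + Ψ') (Φ + Φ') := by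
  rw [opA_iff hn hg] at h h' ⊢
  obtain ⟨h1, h2, ⟨k, h3, h4⟩, ξ, h5, h6⟩ := h
  obtain ⟨h1', h2', ⟨k', h3', h4'⟩, ξ', h5', h6'⟩ := h'
  simp only [← Phase.psiL_apply, ← Phase.vL_apply, ← Phase.wL_apply, ← Phase.etaL_apply,
    map_add] at *
  refine ⟨by rw [h1, h1'], by rw [h2, h2'], ⟨k + k', h3.add h3', ?_⟩, ξ + ξ', h5.add hg h5', ?_⟩
  · rw [h4, h4']; module
  · rw [h6, h6']; abel

lemma OpA.smul (hn : 3 ≤ n) (hg : IsMemoryKernel c g dg) (a : ℝ) {Ψ Φ : Phase n s dg}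
    (h : OpA τ b c g Ψ Φ) : OpA τ b c g (a • Ψ) (a • Φ) := by
  rw [opA_iff hn hg] at h ⊢
  obtain ⟨h1, h2, ⟨k, h3, h4⟩, ξ, h5, h6⟩ := h
  simp only [← Phase.psiL_apply, ← Phase.vL_apply, ← Phase.wL_apply, ← Phase.etaL_apply,
    map_smul] at *
  refine ⟨by rw [h1], by rw [h2], ⟨a • k, h3.smul a, ?_⟩, a • ξ, h5.smul hg a, ?_⟩
  · rw [h4]; module
  · rw [h6, smul_sub]

lemma OpA.eq_zero (hn : 3 ≤ n) (hg : IsMemoryKernel c g dg) {Φ : Phase n s dg}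
    (h : OpA τ b c g 0 Φ) : Φ = 0 := by
  rw [opA_iff hn hg] at h
  obtain ⟨h1, h2, ⟨k, h3, h4⟩, ξ, h5, h6⟩ := h
  simp only [← Phase.vL_apply 0, ← Phase.wL_apply 0, ← Phase.etaL_apply 0, map_zero] at *
  have hk : k = 0 := h3.unique HasLap.zero
  have hξ : ξ = 0 := h5.eq_zero hn hg
  refine Phase.ext h1 (Sob.ext_fn ?_) ?_ ?_
  · have := congrArg Sob.fn h2
    rwa [sobRes_fn] at this
  · rw [h4, hk, smul_zero, smul_zero, add_zero]; rfl
  · rw [h6, hξ, sub_zero]; rfl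

/-- The energy `(ψ, v, √(bτ) w, c_g²ψ + bv + ∫₀^∞ g η, η)`. -/
def energyL (hn : 3 ≤ n) (hg : IsMemoryKernel c g dg) (τ b : ℝ) :
    Phase n s dg →L[ℝ] WithLp 2 (Hom n s × WithLp 2 (Sob n s × WithLp 2 (Sob n s ×
      WithLp 2 (Hom n s × Hist n s dg)))) :=
  pairL Phase.psiL (pairL ((sobRes n s).comp Phase.vL) (pairL (√(b * τ) • Phase.wL)
    (pairL (fluxL hn hg b) Phase.etaL)))

lemma inner_energyL (hn : 3 ≤ n) (hg : IsMemoryKernel c g dg) (hτ : 0 < τ) (hb : 0 < b)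
    (Ψ Φ : Phase n s dg) : inner ℝ (energyL hn hg τ b Ψ) (energyL hn hg τ b Φ) =
      inner ℝ Ψ.psi Φ.psi + (inner ℝ (sobRes n s Ψ.v) (sobRes n s Φ.v) +
        (b * τ * inner ℝ Ψ.w Φ.w + (inner ℝ (fluxL hn hg b Ψ) (fluxL hn hg b Φ) +
          inner ℝ Ψ.eta Φ.eta))) := by
  rw [energyL, inner_pairL, inner_pairL, inner_pairL, inner_pairL, smul_apply, smul_apply,
    real_inner_smul_left, real_inner_smul_right, ← mul_assoc,
    Real.mul_self_sqrt (mul_pos hb hτ).le]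
  rfl

/-- The energy contains `v` only in `H^s`. The missing top derivatives are recovered from the flux:
`b∇v` is the flux minus terms controlled by `ψ` and `η`. -/
lemma exists_norm_le_energyL (hn : 3 ≤ n) (hg : IsMemoryKernel c g dg) (hτ : 0 < τ) (hb : 0 < b) :
    ∃ K : ℝ, 0 < K ∧ ∀ Ψ : Phase n s dg, ‖Ψ‖ ≤ K * ‖energyL hn hg τ b Ψ‖ := by
  set M := ‖memL hg (Hom n s)‖ with hM
  set L := b⁻¹ * (1 + |cgSq c g| + M) with hL
  have M0 : 0 ≤ M := norm_nonneg (memL hg (Hom n s))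
  have L0 : 0 ≤ L := by positivity
  have bτ : 0 < b * τ := mul_pos hb hτ
  -- The `3` accounts for `ψ`, the `L²` norm of `v` and `η`, the term `L²` for `∇v`, and `(bτ)⁻¹`
  -- for `w`.
  refine ⟨√(3 + L ^ 2 + (b * τ)⁻¹), by positivity, fun Ψ => ?_⟩
  set N := ‖energyL hn hg τ b Ψ‖ with hN
  have N0 : 0 ≤ N := norm_nonneg _
  have hE : N ^ 2 = ‖Ψ.psi‖ ^ 2 + (‖sobRes n s Ψ.v‖ ^ 2 + (b * τ * ‖Ψ.w‖ ^ 2 +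
      (‖fluxL hn hg b Ψ‖ ^ 2 + ‖Ψ.eta‖ ^ 2))) := by
    rw [hN, ← real_inner_self_eq_norm_sq, inner_energyL hn hg hτ hb]
    simp only [real_inner_self_eq_norm_sq]
  have p1 := sq_nonneg ‖Ψ.psi‖
  have p2 := sq_nonneg ‖sobRes n s Ψ.v‖
  have p3 := mul_nonneg bτ.le (sq_nonneg ‖Ψ.w‖)
  have p4 := sq_nonneg ‖fluxL hn hg b Ψ‖
  have p5 := sq_nonneg ‖Ψ.eta‖
  have q1 : ‖Ψ.psi‖ ≤ N := le_of_sq_le_sq (by linarith) N0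
  have q4 : ‖fluxL hn hg b Ψ‖ ≤ N := le_of_sq_le_sq (by linarith) N0
  have q5 : ‖Ψ.eta‖ ≤ N := le_of_sq_le_sq (by linarith) N0
  have hv : ‖grad hn s Ψ.v‖ ≤ L * N := by
    have e : grad hn s Ψ.v =
        b⁻¹ • (fluxL hn hg b Ψ - cgSq c g • Ψ.psi - memL hg (Hom n s) Ψ.eta) := by
      rw [fluxL_apply, eq_inv_smul_iff₀ hb.ne']
      abel
    rw [e, norm_smul, norm_inv, Real.norm_of_nonneg hb.le, hL, mul_assoc]
    refine mul_le_mul_of_nonneg_left ?_ (inv_nonneg.2 hb.le)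
    have h1 := norm_sub_le (fluxL hn hg b Ψ - cgSq c g • Ψ.psi) (memL hg (Hom n s) Ψ.eta)
    have h2 := norm_sub_le (fluxL hn hg b Ψ) (cgSq c g • Ψ.psi)
    have h3 : ‖cgSq c g • Ψ.psi‖ ≤ |cgSq c g| * N := by
      rw [norm_smul, Real.norm_eq_abs]; gcongr
    have h4 : ‖memL hg (Hom n s) Ψ.eta‖ ≤ M * N :=
      ((memL hg (Hom n s)).le_opNorm _).trans (by gcongr)
    linarith
  have hv2 : ‖grad hn s Ψ.v‖ ^ 2 ≤ (L * N) ^ 2 := by gcongr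
  have hvf : ‖Ψ.v.fn‖ ^ 2 ≤ N ^ 2 := by
    have := (sobRes n s Ψ.v).norm_fn_le
    rw [sobRes_fn] at this
    have : ‖Ψ.v.fn‖ ^ 2 ≤ ‖sobRes n s Ψ.v‖ ^ 2 := by gcongr
    linarith
  have hw : ‖Ψ.w‖ ^ 2 ≤ (b * τ)⁻¹ * N ^ 2 := by
    rw [inv_mul_eq_div, le_div_iff₀ bτ]
    linarith
  refine le_of_sq_le_sq ?_ (by positivity)
  rw [mul_pow, Real.sq_sqrt (by positivity), Ψ.norm_sq_eq, norm_sq_grad hn Ψ.v]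
  nlinarith

/-- The factor `bτ` in the energy is chosen so that the two top-order pairings of the flux with `∇w`
cancel. Every other term is a product of bounded quantities or has a favourable sign. -/
lemma OpA.inner_energyL_le (hn : 3 ≤ n) (hg : IsMemoryKernel c g dg) (hτ : 0 < τ) (hb : 0 < b) :
    ∃ C : ℝ, 0 ≤ C ∧ ∀ Ψ Φ : Phase n s dg, OpA τ b c g Ψ Φ →
      inner ℝ (energyL hn hg τ b Ψ) (energyL hn hg τ b Φ) ≤ C * ‖Ψ‖ ^ 2 := by
  have := completeSpace_hom (s := s) hn
  set Q := ‖fluxL (s := s) hn hg b‖ with hQ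
  set M := ‖(memL hg (Hom n s)).comp (constHist hg (Hom n s))‖ with hM
  set μ := √((histMeasure dg).real univ) with hμ
  set D := ‖constHist hg (Hom n s)‖ with hD
  have Q0 : 0 ≤ Q := norm_nonneg (fluxL (s := s) hn hg b)
  have M0 : 0 ≤ M := norm_nonneg ((memL hg (Hom n s)).comp (constHist hg (Hom n s)))
  have D0 : 0 ≤ D := norm_nonneg (constHist hg (Hom n s))
  have μ0 : 0 ≤ μ := Real.sqrt_nonneg _
  refine ⟨2 + Q * (|cgSq c g| + M + μ) + D, by positivity, fun Ψ Φ h => ?_⟩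
  rw [opA_iff hn hg] at h
  obtain ⟨h1, h2, ⟨k, h3, h4⟩, ξ, h5, h6⟩ := h
  set N := ‖Ψ‖ with hN
  have N0 : 0 ≤ N := norm_nonneg _
  set V := grad hn s Ψ.v with hV
  have nV : ‖V‖ ≤ N := (norm_grad_le hn _).trans Ψ.norm_v_le
  have nq : ‖fluxL hn hg b Ψ‖ ≤ Q * N := (fluxL hn hg b).le_opNorm Ψ
  have t1 : inner ℝ Ψ.psi Φ.psi ≤ N * N := by
    rw [h1]
    exact (real_inner_le_norm _ _).trans (by gcongr; exact Ψ.norm_psi_le)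
  have t2 : inner ℝ (sobRes n s Ψ.v) (sobRes n s Φ.v) ≤ N * N := by
    rw [h2]
    refine (real_inner_le_norm _ _).trans ?_
    gcongr
    · exact (norm_sobRes_le _).trans Ψ.norm_v_le
    · exact Ψ.norm_w_le
  -- Integration by parts turns `⟨w, Δq⟩` into `-⟨∇w,∇q⟩`; here `w` is the restriction of `Φ.v`. The
  -- last term is the one cancelled by `t4`.
  have t3 : b * τ * inner ℝ Ψ.w Φ.w = -b * ‖Ψ.w‖ ^ 2 -
      b * inner ℝ (fluxL hn hg b Ψ) (grad hn s Φ.v) := by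
    have hdiv := inner_div_eq Φ.v (fun i => (fluxL hn hg b Ψ).1 i) k h3
    rw [h2] at hdiv
    have e : ∑ i, inner ℝ (sobD i Φ.v) ((fluxL hn hg b Ψ).1 i) =
        inner ℝ (fluxL hn hg b Ψ) (grad hn s Φ.v) := by
      rw [real_inner_comm, Hom.inner_eq]
      rfl
    rw [e] at hdiv
    rw [h4, inner_add_right, real_inner_smul_right, real_inner_smul_right, hdiv,
      real_inner_self_eq_norm_sq]
    field_simp
    ring
  have t4 : inner ℝ (fluxL hn hg b Ψ) (fluxL hn hg b Φ) ≤
      Q * N * ((|cgSq c g| + M + μ) * N) +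
        b * inner ℝ (fluxL hn hg b Ψ) (grad hn s Φ.v) := by
    have e : fluxL hn hg b Φ = (cgSq c g • V + memL hg (Hom n s) (constHist hg (Hom n s) V) -
        memL hg (Hom n s) ξ) + b • grad hn s Φ.v := by
      rw [fluxL_apply, h1, h6, map_sub]
      abel
    rw [e, inner_add_right, real_inner_smul_right]
    gcongr
    refine (real_inner_le_norm _ _).trans ?_
    gcongr
    refine (norm_sub_le _ _).trans ?_
    have a1 := norm_add_le (cgSq c g • V) (memL hg (Hom n s) (constHist hg (Hom n s) V))
    have a2 : ‖cgSq c g • V‖ ≤ |cgSq c g| * N := by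
      rw [norm_smul, Real.norm_eq_abs]; gcongr
    have a3 : ‖memL hg (Hom n s) (constHist hg (Hom n s) V)‖ ≤ M * N :=
      (((memL hg (Hom n s)).comp (constHist hg (Hom n s))).le_opNorm V).trans (by gcongr)
    have a4 : ‖memL hg (Hom n s) ξ‖ ≤ μ * N :=
      (h5.norm_memL_le hn hg).trans (by gcongr; exact Ψ.norm_eta_le)
    linarith
  have t5 : inner ℝ Ψ.eta Φ.eta ≤ N * (D * N) := by
    have hd := inner_deriv_nonneg hg (h5.mono fun r h => h.2)
    rw [h6, inner_sub_right]
    have := real_inner_le_norm Ψ.eta (constHist hg (Hom n s) V)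
    have a1 : ‖Ψ.eta‖ * ‖constHist hg (Hom n s) V‖ ≤ N * (D * N) := by
      gcongr
      · exact Ψ.norm_eta_le
      · exact ((constHist hg (Hom n s)).le_opNorm V).trans (by gcongr)
    linarith
  rw [inner_energyL hn hg hτ hb, t3]
  have := mul_nonneg hb.le (sq_nonneg ‖Ψ.w‖)
  nlinarith

/-- The equations for `ψ`, `w` and `η` are solved explicitly in terms of `v`: `ψ = λ⁻¹(v + f_ψ)`, `w
= λv - f_v`, and `η = (λ + ∂ₛ)⁻¹(f_η + v)`. The part of `η` caused by `v` contributes the multiple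
`κ₀ v` to the memory integral, so the third equation becomes elliptic in `v`. -/
lemma OpA.surjective (hn : 3 ≤ n) (hg : IsMemoryKernel c g dg) (hτ : 0 < τ) (hb : 0 < b)
    {l : ℝ} (hl : 0 < l) (f : Phase n s dg) :
    ∃ Ψ Φ : Phase n s dg, OpA τ b c g Ψ Φ ∧ l • Ψ - Φ = f := by
  have := completeSpace_hom (s := s) hn
  have hcg : 0 < cgSq c g := sub_pos.2 hg.integral_lt
  set κ₀ := ∫ r in Ioi 0, g r * ((1 - Real.exp (-l * r)) / l) with hκ₀
  have κ₀0 : 0 ≤ κ₀ := memL_const_nonneg hg hl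
  set η₁ := histRes hg hl f.eta with hη₁
  set F : Hom n s := (cgSq c g * l⁻¹) • f.psi + memL hg (Hom n s) η₁ with hF
  set k : Sob n s := (τ * l + 1) • sobRes n s f.v + τ • f.w with hk
  -- The zeroth-order coefficient comes from `(τλ + 1)w` with `w = λv - f_v`; the flux coefficient
  -- collects the multiples of `v` in `c_g²ψ`, `bv` and the memory.
  obtain ⟨v, hv⟩ := exists_elliptic (α := (τ * l + 1) * l) (κ := cgSq c g * l⁻¹ + b + κ₀)
    (by positivity) (by positivity) (fun i => F.1 i) k
  set V := grad hn s v with hV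
  set η₂ := histRes hg hl (constHist hg (Hom n s) V) with hη₂
  have d1 : HasHistDeriv η₁ (f.eta - l • η₁) := histRes_deriv hg hl f.eta
  have d2 : HasHistDeriv η₂ (constHist hg (Hom n s) V - l • η₂) := histRes_deriv hg hl _
  set w := sobRes n s (l • v - f.v) with hw
  set h := ((τ * l + 1) * l) • sobRes n s v - k with hh
  refine ⟨Phase.mk (l⁻¹ • (V + f.psi)) v w (η₁ + η₂),
    Phase.mk V (l • v - f.v) (l • w - f.w) (l • (η₁ + η₂) - f.eta), ?_, ?_⟩
  · rw [opA_iff hn hg]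
    refine ⟨rfl, rfl, ⟨h, ?_, ?_⟩, _, d1.add hg d2, ?_⟩
    · have e : fluxL hn hg b (Phase.mk (l⁻¹ • (V + f.psi)) v w (η₁ + η₂)) =
          (cgSq c g * l⁻¹ + b + κ₀) • V + F := by
        change cgSq c g • l⁻¹ • (V + f.psi) + b • V + memL hg (Hom n s) (η₁ + η₂) = _
        rw [map_add, hη₂, memL_histRes_const hg hl V (constHist_coe hg V), hF]
        module
      rw [e]
      refine HasWeakDiv.congr hv (fun i => ?_) (EventuallyEq.of_eq rfl)
      have e2 : ((cgSq c g * l⁻¹ + b + κ₀) • V + F).d i =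
          (cgSq c g * l⁻¹ + b + κ₀) • v.d i + (F.1 i).fn := by
        rw [← sobD_fn i v]
        rfl
      rw [e2]
      filter_upwards [Lp.coeFn_add ((cgSq c g * l⁻¹ + b + κ₀) • v.d i) (F.1 i).fn,
        Lp.coeFn_smul (cgSq c g * l⁻¹ + b + κ₀) (v.d i)] with x h1 h2
      rw [h1, Pi.add_apply, h2]
      rfl
    · change l • w - f.w = -(1 / τ) • w + (1 / τ) • h
      rw [hh, hw, hk, map_sub, map_smul]
      match_scalars <;> field_simp <;> ring
    · change l • (η₁ + η₂) - f.eta = constHist hg (Hom n s) V -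
        (f.eta - l • η₁ + (constHist hg (Hom n s) V - l • η₂))
      rw [smul_add]
      abel
  · refine Phase.ext ?_ ?_ ?_ ?_
    · change l • l⁻¹ • (V + f.psi) - V = f.psi
      rw [smul_smul, mul_inv_cancel₀ hl.ne', one_smul, add_sub_cancel_left]
    · exact sub_sub_cancel _ _
    · exact sub_sub_cancel _ _
    · exact sub_sub_cancel _ _

/-- The operator `𝒜` generates a `C₀`-semigroup. -/
theorem exists_semigroup (hn : 3 ≤ n) (hg : IsMemoryKernel c g dg) (hτ : 0 < τ) (hb : 0 < b) :
    ∃ S : ℝ → Phase n s dg →L[ℝ] Phase n s dg, IsC0Semigroup S ∧ IsGenerator S (OpA τ b c g) := by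
  have := completeSpace_hom (s := s) hn
  obtain ⟨K, hK, hKn⟩ := exists_norm_le_energyL (s := s) hn hg hτ hb
  obtain ⟨C, hC, hCn⟩ := OpA.inner_energyL_le (s := s) hn hg hτ hb
  set Θ := energyL (s := s) hn hg τ b with hΘ
  have hanti : AntilipschitzWith K.toNNReal Θ :=
    ContinuousLinearMap.antilipschitz_of_bound Θ fun Ψ => by
      rw [Real.coe_toNNReal K hK.le]
      exact hKn Ψ
  -- Bounded below, the energy map is an isomorphism onto a closed subspace, which serves as the
  -- Hilbert space with the equivalent inner product.
  have hclo : IsClosed (range Θ) := hanti.isClosed_range Θ.uniformContinuous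
  have : CompleteSpace Θ.range := hclo.completeSpace_coe
  let e := Θ.equivRange hanti.injective hclo
  have he : ∀ Ψ, (e Ψ : WithLp 2 _) = Θ Ψ := fun _ => rfl
  refine exists_semigroup_of_equiv (H := Θ.range) e (β := C * K ^ 2) (fun _ _ _ _ h h' => h.add hn hg h')
    (fun a _ _ h => h.smul hn hg a) (fun _ h => h.eq_zero hn hg) (fun Ψ Φ h => ?_)
    ⟨1, fun l hl f => OpA.surjective hn hg hτ hb (by linarith) f⟩
  refine (hCn Ψ Φ h).trans ?_
  rw [mul_assoc, ← mul_pow]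
  gcongr
  exact hKn Ψ

end Operator

/-! ### Mild solutions of semilinear equations -/

section Semigroup

variable {X : Type*} [NormedAddCommGroup X] [NormedSpace ℝ X] {S : ℝ → X →L[ℝ] X}

lemma IsC0Semigroup.tendsto_ge (hS : IsC0Semigroup S) (x : X) :
    Tendsto (fun t => S t x) (𝓝[≥] 0) (𝓝 x) := by
  have h0 : S 0 x = x := by rw [hS.zero]; rfl
  have h : ContinuousWithinAt (fun t => S t x) (Ioi 0) 0 := by
    rw [ContinuousWithinAt, h0]; exact hS.tendsto x
  have := continuousWithinAt_Ioi_iff_Ici.1 h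
  rwa [ContinuousWithinAt, h0] at this

/-- Otherwise there are times `t_j → 0` with `‖S(t_j)‖` unbounded, although `S(t_j)y → y` for every
`y`; this contradicts the uniform boundedness principle. -/
lemma IsC0Semigroup.exists_bound [CompleteSpace X] (hS : IsC0Semigroup S) :
    ∃ δ : ℝ, 0 < δ ∧ ∃ M : ℝ, 1 ≤ M ∧ ∀ t ∈ Icc 0 δ, ∀ x, ‖S t x‖ ≤ M * ‖x‖ := by
  by_contra hcon
  push Not at hcon
  have h : ∀ j : ℕ, ∃ t ∈ Icc (0 : ℝ) (1 / ((j : ℝ) + 1)), ∃ x, ((j : ℝ) + 1) * ‖x‖ < ‖S t x‖ :=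
    fun j => hcon _ (by positivity) _ (by
      have : (0 : ℝ) ≤ j := Nat.cast_nonneg j
      linarith)
  choose t ht x hx using h
  have ht0 : Tendsto t atTop (𝓝[≥] 0) := by
    refine tendsto_nhdsWithin_iff.2 ⟨?_, Eventually.of_forall fun j => (ht j).1⟩
    exact squeeze_zero (fun j => (ht j).1) (fun j => (ht j).2)
      tendsto_one_div_add_atTop_nhds_zero_nat
  obtain ⟨C, hC⟩ := banach_steinhaus (g := fun j => S (t j)) fun y => by
    have hb := Metric.isBounded_range_of_tendsto _ ((hS.tendsto_ge y).comp ht0)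
    obtain ⟨C, hC⟩ := hb.exists_norm_le
    exact ⟨C, fun j => hC _ (mem_range_self j)⟩
  obtain ⟨j, hj⟩ := exists_nat_gt C
  have h1 := (S (t j)).le_of_opNorm_le (hC j) (x j)
  have h2 := hx j
  have : C * ‖x j‖ ≤ ((j : ℝ) + 1) * ‖x j‖ := by gcongr; linarith
  linarith

/-- For `a ≤ b` one has `S(b)x - S(a)x = S(a)(S(b-a)x - x)`, so left and right continuity both
reduce to continuity at `0` and the local bound. -/
lemma IsC0Semigroup.continuousOn (hS : IsC0Semigroup S) {δ M : ℝ}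
    (hb : ∀ t ∈ Icc 0 δ, ∀ x, ‖S t x‖ ≤ M * ‖x‖) (x : X) :
    ContinuousOn (fun t => S t x) (Icc 0 δ) := by
  intro t₀ h₀
  have h1 : Tendsto (fun t => |t - t₀|) (𝓝[Icc 0 δ] t₀) (𝓝[≥] 0) := by
    refine tendsto_nhdsWithin_iff.2 ⟨?_, Eventually.of_forall fun t => mem_Ici.2 (abs_nonneg _)⟩
    have : Continuous fun t => |t - t₀| := by fun_prop
    simpa using (this.tendsto t₀).mono_left nhdsWithin_le_nhds
  have h2 := (((hS.tendsto_ge x).comp h1).sub_const x).norm.const_mul M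
  rw [sub_self, norm_zero, mul_zero] at h2
  rw [ContinuousWithinAt, tendsto_iff_norm_sub_tendsto_zero]
  have key : ∀ a b : ℝ, a ∈ Icc 0 δ → a ≤ b → ‖S b x - S a x‖ ≤ M * ‖S (b - a) x - x‖ :=
    fun a b ha hab => by
      have e : S b x = S a (S (b - a) x) := by
        have := hS.add a (b - a) ha.1 (by linarith)
        rw [add_sub_cancel] at this
        rw [this]; rfl
      rw [e, ← map_sub]
      exact hb a ha _
  refine squeeze_zero' (Eventually.of_forall fun t => norm_nonneg _) ?_ h2
  filter_upwards [self_mem_nhdsWithin] with t ht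
  rcases le_total t t₀ with h | h
  · have := key t t₀ ht h
    rwa [norm_sub_rev, ← neg_sub t t₀, ← abs_of_nonpos (by linarith : t - t₀ ≤ 0)] at this
  · have := key t₀ t h₀ h
    rwa [← abs_of_nonneg (by linarith : 0 ≤ t - t₀)] at this

lemma continuous_uncurry_of_bound {U : ℝ → X →L[ℝ] X} {M : ℝ} (hU : ∀ t x, ‖U t x‖ ≤ M * ‖x‖)
    (hc : ∀ x, Continuous fun t => U t x) : Continuous fun p : ℝ × X => U p.1 p.2 := by
  rw [continuous_iff_continuousAt]
  rintro ⟨t₀, x₀⟩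
  rw [ContinuousAt, tendsto_iff_norm_sub_tendsto_zero]
  have h1 : Continuous fun p : ℝ × X => M * ‖p.2 - x₀‖ + ‖U p.1 x₀ - U t₀ x₀‖ := by
    have := (hc x₀).comp continuous_fst (X := ℝ × X)
    exact (by fun_prop : Continuous fun p : ℝ × X => M * ‖p.2 - x₀‖).add
      (this.sub continuous_const).norm
  have h2 := h1.tendsto (t₀, x₀)
  simp only [sub_self, norm_zero, mul_zero, add_zero] at h2
  refine squeeze_zero (fun p => norm_nonneg _) (fun p => ?_) h2
  calc ‖U p.1 p.2 - U t₀ x₀‖ = ‖U p.1 (p.2 - x₀) + (U p.1 x₀ - U t₀ x₀)‖ := by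
        rw [map_sub]; congr 1; abel
    _ ≤ _ := (norm_add_le _ _).trans (by gcongr; exact hU _ _)

end Semigroup

/-! ### Fixed points of Duhamel's formula. -/

section LocalExistence

variable {X : Type*} [NormedAddCommGroup X]

/-- A locally Lipschitz nonlinearity of quadratic growth. -/
structure IsQuadratic (K : ℝ) (G : X → X) : Prop where
  nonneg : 0 ≤ K
  zero : G 0 = 0
  lip : ∀ x y, ‖G x - G y‖ ≤ K * (‖x‖ + ‖y‖) * ‖x - y‖

lemma IsQuadratic.continuous {K : ℝ} {G : X → X} (hG : IsQuadratic K G) : Continuous G := by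
  rw [continuous_iff_continuousAt]
  intro x
  rw [ContinuousAt, tendsto_iff_norm_sub_tendsto_zero]
  have h1 : Continuous fun y : X => K * (‖y‖ + ‖x‖) * ‖y - x‖ := by fun_prop
  have h2 := h1.tendsto x
  simp only [sub_self, norm_zero, mul_zero] at h2
  exact squeeze_zero (fun p => norm_nonneg _) (fun p => hG.lip _ _) h2

lemma IsQuadratic.norm_le {K : ℝ} {G : X → X} (hG : IsQuadratic K G) (x : X) :
    ‖G x‖ ≤ K * ‖x‖ * ‖x‖ := by
  simpa [hG.zero] using hG.lip x 0

variable [NormedSpace ℝ X] [CompleteSpace X] {U : ℝ → X →L[ℝ] X} {M K : ℝ} {G : X → X}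

/-- Local existence and uniqueness for `u(t) = U(t)x₀ + ∫₀ᵗ U(t-r) G(u(r)) dr`. -/
theorem existsUnique_duhamel (hM : 0 ≤ M) (hU : ∀ t x, ‖U t x‖ ≤ M * ‖x‖)
    (hc : ∀ x, Continuous fun t => U t x) (hG : IsQuadratic K G) {T ρ : ℝ} (hT : 0 ≤ T) (x₀ : X)
    (hρ : 2 * M * ‖x₀‖ + 1 ≤ ρ) (hTρ : T * (M * K * ρ) ≤ 1 / 4) :
    ∃! u : C(Icc (0 : ℝ) T, X), ∀ t : Icc (0 : ℝ) T,
      u t = U t x₀ + ∫ r in (0 : ℝ)..t, U (t - r) (G (u (projIcc 0 T hT r))) := by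
  have hUc := continuous_uncurry_of_bound hU hc
  have hK := hG.nonneg
  have ρ0 : 0 < ρ := by
    have : 0 ≤ 2 * M * ‖x₀‖ := by positivity
    linarith
  have hcont : ∀ u : C(Icc (0 : ℝ) T, X), Continuous fun p : ℝ × ℝ =>
      U (p.1 - p.2) (G (u (projIcc 0 T hT p.2))) := fun u =>
    hUc.comp ((continuous_fst.sub continuous_snd).prodMk
      (hG.continuous.comp (u.continuous.comp (continuous_projIcc.comp continuous_snd))))
  have hcr : ∀ (u : C(Icc (0 : ℝ) T, X)) (t : ℝ), Continuous fun r =>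
      U (t - r) (G (u (projIcc 0 T hT r))) := fun u t =>
    (hcont u).comp (continuous_const.prodMk continuous_id)
  let F : C(Icc (0 : ℝ) T, X) → C(Icc (0 : ℝ) T, X) := fun u =>
    ⟨fun t => U t x₀ + ∫ r in (0 : ℝ)..t, U (t - r) (G (u (projIcc 0 T hT r))),
      ((hc x₀).comp continuous_subtype_val).add
        (intervalIntegral.continuous_parametric_intervalIntegral_of_continuous
          (f := fun (t : Icc (0 : ℝ) T) r => U (t - r) (G (u (projIcc 0 T hT r))))
          ((hcont u).comp ((continuous_subtype_val.comp continuous_fst).prodMk continuous_snd))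
          continuous_subtype_val)⟩
  have hF : ∀ u (t : Icc (0 : ℝ) T), F u t =
      U t x₀ + ∫ r in (0 : ℝ)..t, U (t - r) (G (u (projIcc 0 T hT r))) := fun _ _ => rfl
  have hdiff : ∀ (u v : C(Icc (0 : ℝ) T, X)) (R : ℝ), ‖u‖ ≤ R → ‖v‖ ≤ R →
      ∀ r, ∀ t, ‖U (t - r) (G (u (projIcc 0 T hT r))) - U (t - r) (G (v (projIcc 0 T hT r)))‖ ≤
        M * (K * (R + R)) * ‖u (projIcc 0 T hT r) - v (projIcc 0 T hT r)‖ :=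
    fun u v R hu hv r t => by
      rw [← map_sub, mul_assoc]
      refine (hU _ _).trans ?_
      gcongr
      refine (hG.lip _ _).trans ?_
      gcongr
      · exact (u.norm_coe_le_norm _).trans hu
      · exact (v.norm_coe_le_norm _).trans hv
  -- The linear part is at most `ρ/2` and the integral at most `ρ/4`.
  have hmaps : MapsTo F (Metric.closedBall 0 ρ) (Metric.closedBall 0 ρ) := fun u hu => by
    rw [mem_closedBall_zero_iff] at hu ⊢
    refine (ContinuousMap.norm_le _ ρ0.le).2 fun t => ?_
    rw [hF]
    have h1 : ‖U t x₀‖ ≤ M * ‖x₀‖ := hU _ _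
    have h2 : ‖∫ r in (0 : ℝ)..t, U (t - r) (G (u (projIcc 0 T hT r)))‖ ≤
        (M * (K * ρ * ρ)) * |(t : ℝ) - 0| := by
      refine intervalIntegral.norm_integral_le_of_norm_le_const fun r _ => ?_
      refine (hU _ _).trans ?_
      gcongr
      refine (hG.norm_le _).trans ?_
      have := (u.norm_coe_le_norm (projIcc 0 T hT r)).trans hu
      gcongr
    rw [sub_zero, abs_of_nonneg t.2.1] at h2
    have h3 : (M * (K * ρ * ρ)) * (t : ℝ) ≤ 1 / 4 * ρ := by
      calc (M * (K * ρ * ρ)) * (t : ℝ) ≤ (M * (K * ρ * ρ)) * T := by gcongr; exact t.2.2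
        _ = T * (M * K * ρ) * ρ := by ring
        _ ≤ _ := by gcongr
    refine (norm_add_le _ _).trans ?_
    linarith
  have hlip : LipschitzWith (1 / 2) (hmaps.restrict F _ _) := by
    refine LipschitzWith.of_dist_le_mul fun u v => ?_
    have hu := mem_closedBall_zero_iff.1 u.2
    have hv := mem_closedBall_zero_iff.1 v.2
    change dist (F u.1) (F v.1) ≤ _ * dist u.1 v.1
    rw [ContinuousMap.dist_le (by positivity)]
    intro t
    rw [dist_eq_norm, hF, hF, add_sub_add_left_eq_sub, ← intervalIntegral.integral_sub
      ((hcr u.1 t).intervalIntegrable _ _) ((hcr v.1 t).intervalIntegrable _ _)]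
    have h2 := intervalIntegral.norm_integral_le_of_norm_le_const (a := 0) (b := (t : ℝ))
      (C := M * (K * (ρ + ρ)) * dist u.1 v.1) (f := fun r =>
        U (t - r) (G (u.1 (projIcc 0 T hT r))) - U (t - r) (G (v.1 (projIcc 0 T hT r))))
      fun r _ => (hdiff u.1 v.1 ρ hu hv r t).trans (by
        gcongr
        rw [← dist_eq_norm]
        exact ContinuousMap.dist_apply_le_dist _)
    refine h2.trans ?_
    rw [sub_zero, abs_of_nonneg t.2.1]
    calc M * (K * (ρ + ρ)) * dist u.1 v.1 * (t : ℝ) ≤ M * (K * (ρ + ρ)) * dist u.1 v.1 * T := by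
          gcongr; exact t.2.2
      _ = 2 * (T * (M * K * ρ)) * dist u.1 v.1 := by ring
      _ ≤ 2 * (1 / 4) * dist u.1 v.1 := by gcongr
      _ = _ := by norm_num
  have hcw : ContractingWith (1 / 2) (hmaps.restrict F _ _) :=
    ⟨by rw [← NNReal.coe_lt_coe]; norm_num, hlip⟩
  obtain ⟨u, -, hfix, -⟩ := hcw.exists_fixedPoint' Metric.isClosed_closedBall.isComplete hmaps
    (Metric.mem_closedBall_self ρ0.le) (edist_ne_top _ _)
  refine ⟨u, fun t => ?_, fun v hv => ?_⟩
  · nth_rw 1 [← hfix.eq]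
    exact hF u t
  have hu : ∀ t, u t = U t x₀ + ∫ r in (0 : ℝ)..t, U (t - r) (G (u (projIcc 0 T hT r))) :=
    fun t => by
      nth_rw 1 [← hfix.eq]
      exact hF u t
  set R := max ‖u‖ ‖v‖ with hR
  set L := M * (K * (R + R)) with hL
  set d : ℝ → ℝ := fun r => ‖u (projIcc 0 T hT r) - v (projIcc 0 T hT r)‖ with hd
  have cd : Continuous d :=
    ((u.continuous.comp continuous_projIcc).sub (v.continuous.comp continuous_projIcc)).norm
  -- Uniqueness is claimed among all continuous solutions, not only those in the ball, so the
  -- Lipschitz constant `L` is taken on a ball containing both solutions and Grönwall's argument is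
  -- applied to the primitive of their distance.
  have hle : ∀ t ∈ Icc 0 T, d t ≤ L * ∫ r in (0 : ℝ)..t, d r := fun t ht => by
    have e : projIcc 0 T hT t = ⟨t, ht⟩ := projIcc_of_mem hT ht
    simp only [hd]
    rw [e, hu ⟨t, ht⟩, hv ⟨t, ht⟩, add_sub_add_left_eq_sub, ← intervalIntegral.integral_sub
      ((hcr u t).intervalIntegrable _ _) ((hcr v t).intervalIntegrable _ _),
      ← intervalIntegral.integral_const_mul]
    exact intervalIntegral.norm_integral_le_of_norm_le ht.1
      (Eventually.of_forall fun r _ => hdiff u v R (le_max_left _ _) (le_max_right _ _) r t)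
      ((cd.intervalIntegrable _ _).const_mul L)
  have hD : ∀ t, HasDerivAt (fun t => ∫ r in (0 : ℝ)..t, d r) (d t) t := fun t =>
    intervalIntegral.integral_hasDerivAt_right (cd.intervalIntegrable _ _)
      cd.aestronglyMeasurable.stronglyMeasurableAtFilter cd.continuousAt
  have hz : ∀ t ∈ Icc 0 T, ∫ r in (0 : ℝ)..t, d r = 0 := by
    refine eq_zero_of_abs_deriv_le_mul_abs_self_of_eq_zero_right (K := L) (f' := d)
      (fun t _ => (hD t).continuousAt.continuousWithinAt) (fun t _ => (hD t).hasDerivWithinAt)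
      (by simp) fun t ht => ?_
    have ht' : t ∈ Icc 0 T := Ico_subset_Icc_self ht
    rw [Real.norm_of_nonneg (norm_nonneg _), Real.norm_of_nonneg
      (intervalIntegral.integral_nonneg ht.1 fun r _ => norm_nonneg _)]
    exact hle t ht'
  ext t
  have h1 := hle t t.2
  rw [hz t t.2, mul_zero] at h1
  simp only [hd, projIcc_val] at h1
  exact (sub_eq_zero.1 (norm_le_zero_iff.1 h1)).symm

end LocalExistence

/-! ### The quadratic nonlinearity on the phase space. -/

section Nonlinearity

variable {n s : ℕ} {dg : ℝ → ℝ}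

/-- The nonlinearity is well defined and of quadratic growth. -/
theorem exists_nonlinearity (hs : n < 2 * s) (τ k : ℝ) :
    ∃ (N : Phase n s dg → Sob n s) (K : ℝ), (∀ Ψ f, IsNonlinearity τ k Ψ f ↔ f = N Ψ) ∧
      IsQuadratic K fun Ψ => (Phase.ofW (N Ψ) : Phase n s dg) := by
  obtain ⟨C, hC⟩ := Sob.exists_mul n s hs
  choose P hP hPn using hC
  have hPn' : ∀ f h, ‖P f h‖ ≤ |C| * ‖f‖ * ‖h‖ := fun f h => (hPn f h).trans (by
    gcongr
    exact le_abs_self C)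
  -- Chosen products are bilinear because an element of `H^s` is determined by its function.
  have hPsub : ∀ f h f' h', P f h - P f' h' = P (f - f') h + P f' (h - h') := fun f h f' h' => by
    refine Sob.ext_fn (Lp.ext ?_)
    rw [Sob.fn_sub, Sob.fn_add]
    filter_upwards [Lp.coeFn_sub (P f h).fn (P f' h').fn,
      Lp.coeFn_add (P (f - f') h).fn (P f' (h - h')).fn, hP f h, hP f' h', hP (f - f') h,
      hP f' (h - h'), Lp.coeFn_sub f.fn f'.fn, Lp.coeFn_sub h.fn h'.fn]
      with x h1 h2 h3 h4 h5 h6 h7 h8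
    rw [h1, h2, Pi.sub_apply, Pi.add_apply, h3, h4, h5, h6, Sob.fn_sub, Sob.fn_sub, h7, h8,
      Pi.sub_apply, Pi.sub_apply]
    ring
  have hPd : ∀ f h f' h' : Sob n s, ∀ a a' d : ℝ, ‖h‖ ≤ a → ‖f'‖ ≤ a' → ‖f - f'‖ ≤ d →
      ‖h - h'‖ ≤ d → ‖P f h - P f' h'‖ ≤ |C| * (a + a') * d :=
    fun f h f' h' a a' d h1 h2 h3 h4 => by
      have a0 := (norm_nonneg _).trans h1
      have a0' := (norm_nonneg _).trans h2
      have d0 := (norm_nonneg _).trans h3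
      rw [hPsub]
      refine (norm_add_le _ _).trans ?_
      have e1 : ‖P (f - f') h‖ ≤ |C| * d * a := (hPn' _ _).trans (by gcongr)
      have e2 : ‖P f' (h - h')‖ ≤ |C| * a' * d := (hPn' _ _).trans (by gcongr)
      linarith
  -- All four factors are in `H^s`: `v` after restriction, `w`, and the first derivatives of `ψ` and
  -- `v`.
  let N : Phase n s dg → Sob n s := fun Ψ =>
    (1 / τ) • ((2 * k) • P (sobRes n s Ψ.v) Ψ.w + (2 : ℝ) • ∑ i, P (Ψ.psi.1 i) (sobD i Ψ.v))
  have hN : ∀ Ψ, IsNonlinearity τ k Ψ (N Ψ) := fun Ψ => by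
    have hsum : (∑ i, P (Ψ.psi.1 i) (sobD i Ψ.v)).fn = ∑ i, (P (Ψ.psi.1 i) (sobD i Ψ.v)).fn :=
      map_sum (Sob.fnL n s) _ _
    have e : (N Ψ).fn = (1 / τ) • ((2 * k) • (P (sobRes n s Ψ.v) Ψ.w).fn +
        (2 : ℝ) • ∑ i, (P (Ψ.psi.1 i) (sobD i Ψ.v)).fn) := by
      rw [← hsum]
      rfl
    rw [IsNonlinearity, e]
    set p := (P (sobRes n s Ψ.v) Ψ.w).fn
    filter_upwards [Lp.coeFn_smul (1 / τ) ((2 * k) • p +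
        (2 : ℝ) • ∑ i, (P (Ψ.psi.1 i) (sobD i Ψ.v)).fn),
      Lp.coeFn_add ((2 * k) • p) ((2 : ℝ) • ∑ i, (P (Ψ.psi.1 i) (sobD i Ψ.v)).fn),
      Lp.coeFn_smul (2 * k) p, Lp.coeFn_smul (2 : ℝ) (∑ i, (P (Ψ.psi.1 i) (sobD i Ψ.v)).fn),
      Lp.coeFn_finsetSum Finset.univ (fun i => (P (Ψ.psi.1 i) (sobD i Ψ.v)).fn),
      hP (sobRes n s Ψ.v) Ψ.w, ae_all_iff.2 fun i => hP (Ψ.psi.1 i) (sobD i Ψ.v)]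
      with x h1 h2 h3 h4 h5 h6 h7
    rw [h1, Pi.smul_apply, h2, Pi.add_apply, h3, h4, Pi.smul_apply, Pi.smul_apply, h5, h6]
    simp only [Finset.sum_apply, h7, smul_eq_mul, sobRes_fn, sobD_fn, Hom.d, mul_assoc]
  set K := |1 / τ| * (|2 * k| * |C| + 2 * (n * |C|)) with hK
  refine ⟨N, K, fun Ψ f => ⟨fun h => Sob.ext_fn (Lp.ext ?_), fun h => h ▸ hN Ψ⟩, ?_⟩
  · exact EventuallyEq.trans h (EventuallyEq.symm (hN Ψ))
  have hofW : ∀ f : Sob n s, ‖(Phase.ofW f : Phase n s dg)‖ = ‖f‖ := fun f => by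
    have h := Phase.norm_sq_eq (Phase.ofW f : Phase n s dg)
    have e : ‖(0 : Hom n s)‖ ^ 2 + (‖(0 : Sob n (s + 1))‖ ^ 2 + (‖f‖ ^ 2 +
        ‖(0 : Hist n s dg)‖ ^ 2)) = ‖f‖ ^ 2 := by simp
    rw [← sq_eq_sq₀ (norm_nonneg _) (norm_nonneg _), ← e]
    exact h
  have hsub : ∀ f f' : Sob n s, (Phase.ofW f : Phase n s dg) - Phase.ofW f' =
      Phase.ofW (f - f') := fun f f' =>
    Phase.ext (sub_zero _) (sub_zero _) rfl (sub_zero _)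
  have hlip : ∀ Ψ Φ, ‖N Ψ - N Φ‖ ≤ K * (‖Ψ‖ + ‖Φ‖) * ‖Ψ - Φ‖ := fun Ψ Φ => by
    set A := ‖Ψ‖ + ‖Φ‖ with hA
    set d := ‖Ψ - Φ‖ with hd
    have dv : ‖Ψ.v - Φ.v‖ ≤ d := (Ψ - Φ).norm_v_le
    have dw : ‖Ψ.w - Φ.w‖ ≤ d := (Ψ - Φ).norm_w_le
    have dpsi : ‖Ψ.psi - Φ.psi‖ ≤ d := (Ψ - Φ).norm_psi_le
    have hproj : ∀ (ψ : Hom n s) i, ‖ψ.1 i‖ ≤ ‖ψ‖ := fun ψ i => PiLp.norm_apply_le ψ.1 i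
    have e1 : ‖P (sobRes n s Ψ.v) Ψ.w - P (sobRes n s Φ.v) Φ.w‖ ≤ |C| * A * d :=
      hPd _ _ _ _ _ _ _ Ψ.norm_w_le ((norm_sobRes_le _).trans Φ.norm_v_le)
        (by rw [← map_sub]; exact (norm_sobRes_le _).trans dv) dw
    have e2 : ∀ i, ‖P (Ψ.psi.1 i) (sobD i Ψ.v) - P (Φ.psi.1 i) (sobD i Φ.v)‖ ≤ |C| * A * d :=
      fun i => hPd _ _ _ _ _ _ _ ((norm_sobD_le _ _).trans Ψ.norm_v_le)
        ((hproj _ _).trans Φ.norm_psi_le) ((hproj (Ψ.psi - Φ.psi) i).trans dpsi)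
        (by rw [← map_sub]; exact (norm_sobD_le _ _).trans dv)
    have e3 : ‖∑ i, (P (Ψ.psi.1 i) (sobD i Ψ.v) - P (Φ.psi.1 i) (sobD i Φ.v))‖ ≤
        n * (|C| * A * d) := by
      refine (norm_sum_le_of_le _ fun i _ => e2 i).trans (le_of_eq ?_)
      simp
    have e : N Ψ - N Φ = (1 / τ) • ((2 * k) • (P (sobRes n s Ψ.v) Ψ.w -
        P (sobRes n s Φ.v) Φ.w) + (2 : ℝ) •
          ∑ i, (P (Ψ.psi.1 i) (sobD i Ψ.v) - P (Φ.psi.1 i) (sobD i Φ.v))) := by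
      simp only [N]
      rw [Finset.sum_sub_distrib]
      module
    rw [e, norm_smul, Real.norm_eq_abs, hK, mul_assoc, mul_assoc]
    gcongr
    refine (norm_add_le _ _).trans ?_
    rw [norm_smul, norm_smul, Real.norm_eq_abs, Real.norm_of_nonneg (by norm_num : (0 : ℝ) ≤ 2)]
    have e4 := mul_le_mul_of_nonneg_left e1 (abs_nonneg (2 * k))
    linarith
  refine ⟨by positivity, ?_, fun Ψ Φ => ?_⟩
  · have h0 : N 0 = 0 := by
      refine Sob.ext_fn (Lp.ext ?_)
      refine EventuallyEq.trans (hN 0) ?_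
      filter_upwards [Lp.coeFn_zero ℝ 2 (volume : Measure (RN n))] with x hx
      have e0 : ((0 : Phase n s dg).v.fn : RN n → ℝ) x = 0 := hx
      have ed : ∀ i, ((0 : Phase n s dg).v.d i : RN n → ℝ) x = 0 := fun i => hx
      rw [Sob.fn_zero, hx, e0]
      simp [ed]
    rw [h0]
    rfl
  · rw [hsub, hofW]
    exact hlip Ψ Φ

end Nonlinearity

/-! ### Local well-posedness in the phase space. -/

section MildSolutions

variable {n s : ℕ} {dg : ℝ → ℝ}

/-- Local well-posedness of the mild equation. -/
theorem exists_time (hn : 3 ≤ n) (hs : n < 2 * s) (τ k : ℝ)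
    {S : ℝ → Phase n s dg →L[ℝ] Phase n s dg} (hS : IsC0Semigroup S) :
    ∃ T : ℝ → ℝ, (∀ r, 0 < T r) ∧ ∀ Ψ₀ : Phase n s dg,
      ∃! Ψ : C(Icc (0 : ℝ) (T ‖Ψ₀‖), Phase n s dg), IsMildSolution τ k S Ψ₀ Ψ := by
  have := completeSpace_hom (s := s) hn
  obtain ⟨δ, hδ, M, hM, hb⟩ := hS.exists_bound
  obtain ⟨N, K, hN, hG⟩ := exists_nonlinearity (dg := dg) hs τ k
  have hK := hG.nonneg
  have M0 : 0 ≤ M := by linarith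
  -- The absolute value keeps `ρ`, and with it the existence time, positive for every real argument.
  set ρ : ℝ → ℝ := fun r => 2 * M * |r| + 1 with hρ
  have ρ0 : ∀ r, 0 < ρ r := fun r => by positivity
  -- The semigroup is frozen outside `[0,δ]`, which gives a uniformly bounded, strongly continuous
  -- family on the whole line. Only `t - r ∈ [0,δ]` matters, since `T ≤ δ`.
  set U : ℝ → Phase n s dg →L[ℝ] Phase n s dg := fun t => S (projIcc 0 δ hδ.le t) with hU
  have hUS : ∀ t ∈ Icc 0 δ, U t = S t := fun t ht => by simp only [hU, projIcc_of_mem hδ.le ht]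
  have hUb : ∀ t x, ‖U t x‖ ≤ M * ‖x‖ := fun t x => hb _ (projIcc 0 δ hδ.le t).2 x
  have hUc : ∀ x, Continuous fun t => U t x := fun x =>
    (continuousOn_iff_continuous_domRestrict.1 (hS.continuousOn hb x)).comp continuous_projIcc
  refine ⟨fun r => min δ (1 / (4 * (M * K * ρ r + 1))), fun r => ?_, fun Ψ₀ => ?_⟩
  · have := ρ0 r
    exact lt_min hδ (by positivity)
  -- The summand `1` prevents division by zero when `K = 0`.
  set T := min δ (1 / (4 * (M * K * ρ ‖Ψ₀‖ + 1))) with hT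
  have hρ0 := ρ0 ‖Ψ₀‖
  have T0 : 0 ≤ T := le_min hδ.le (by positivity)
  have hTδ : T ≤ δ := min_le_left _ _
  have hTρ : T * (M * K * ρ ‖Ψ₀‖) ≤ 1 / 4 := by
    have h1 : T ≤ 1 / (4 * (M * K * ρ ‖Ψ₀‖ + 1)) := min_le_right _ _
    rw [le_div_iff₀ (by positivity)] at h1
    nlinarith
  have hmain := existsUnique_duhamel M0 hUb hUc hG T0 Ψ₀
    (by simp only [hρ, abs_norm]; exact le_rfl) hTρ
  refine (existsUnique_congr fun Ψ => ?_).1 hmain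
  have hcr : ∀ t : ℝ, Continuous fun r => U (t - r) (Phase.ofW (N (Ψ (projIcc 0 T T0 r)))) :=
    fun t => (continuous_uncurry_of_bound hUb hUc).comp ((continuous_const.sub continuous_id).prodMk
      (hG.continuous.comp (Ψ.continuous.comp continuous_projIcc)))
  have hmem : ∀ t : Icc (0 : ℝ) T, ∀ r ∈ uIcc (0 : ℝ) t, ∃ hr : r ∈ Icc 0 T,
      (t - r : ℝ) ∈ Icc 0 δ ∧ projIcc 0 T T0 r = ⟨r, hr⟩ := fun t r hr => by
    rw [uIcc_of_le t.2.1] at hr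
    have h1 : r ∈ Icc 0 T := ⟨hr.1, hr.2.trans t.2.2⟩
    exact ⟨h1, ⟨by linarith [hr.2], by linarith [t.2.2, hr.1]⟩, projIcc_of_mem T0 h1⟩
  have hSt : ∀ t : Icc (0 : ℝ) T, U t = S t := fun t => hUS t ⟨t.2.1, t.2.2.trans hTδ⟩
  constructor
  · intro h
    refine ⟨fun r => N (Ψ (projIcc 0 T T0 r)), fun r => ?_, fun t => ?_⟩
    · rw [hN]
      exact congrArg (fun q => N (Ψ q)) (projIcc_val T0 r)
    have heq : EqOn (fun r => U (t - r) (Phase.ofW (N (Ψ (projIcc 0 T T0 r)))))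
        (fun r => S (t - r) (Phase.ofW (N (Ψ (projIcc 0 T T0 r))))) (uIcc 0 t) := fun r hr => by
      obtain ⟨h1, h2, h3⟩ := hmem t r hr
      simp only [hUS _ h2]
    refine ⟨IntervalIntegrable.congr (heq.mono uIoc_subset_uIcc) ((hcr t).intervalIntegrable 0 t), ?_⟩
    rw [← intervalIntegral.integral_congr heq, ← hSt]
    exact h t
  -- On `[0,T]` the function `f` is forced to be the nonlinearity; its values elsewhere do not enter
  -- the integrals.
  · rintro ⟨f, hf, h⟩ t
    have heq : EqOn (fun r => U (t - r) (Phase.ofW (N (Ψ (projIcc 0 T T0 r)))))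
        (fun r => S (t - r) (Phase.ofW (f r))) (uIcc 0 t) := fun r hr => by
      obtain ⟨h1, h2, h3⟩ := hmem t r hr
      have := (hN _ _).1 (hf ⟨r, h1⟩)
      simp only [hUS _ h2, h3, this]
    rw [(h t).2, intervalIntegral.integral_congr heq, hSt]

end MildSolutions

end JMGT

end

theorem mainTheorem2 (n m : ℕ) (hn : 3 ≤ n) (hm : (n : ℝ) / 2 + 1 < m)
    (τ b c k : ℝ) (g dg : ℝ → ℝ) (hg : JMGT.IsMemoryKernel c g dg)
    (hb : τ * c ^ 2 ≤ b) (hc : τ * JMGT.cgSq c g < τ * c ^ 2) :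
    ∃ S : ℝ → JMGT.Phase n (m - 1) dg →L[ℝ] JMGT.Phase n (m - 1) dg,
      JMGT.IsC0Semigroup S ∧ JMGT.IsGenerator S (JMGT.OpA τ b c g) ∧
      ∃ T : ℝ → ℝ, (∀ r, 0 < T r) ∧
        ∀ Ψ₀ : JMGT.Phase n (m - 1) dg,
          ∃! Ψ : C(Set.Icc (0 : ℝ) (T ‖Ψ₀‖), JMGT.Phase n (m - 1) dg),
            JMGT.IsMildSolution τ k S Ψ₀ Ψ := by
  -- Since `c² - c_g² = ∫ g > 0`, the inequality `τ c_g² < τ c²` fixes the sign of `τ`.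
  have hτ : 0 < τ := by
    have h : 0 < τ * ∫ s in Ioi 0, g s := by
      rw [JMGT.cgSq] at hc
      linarith
    exact pos_of_mul_pos_left h hg.integral_pos.le
  have hb0 : 0 < b := (mul_pos hτ (hg.integral_pos.trans hg.integral_lt)).trans_le hb
  -- The truncated subtraction is harmless, since `n + 2 < 2m` forces `m > 1`.
  have hs : n < 2 * (m - 1) := by
    have h : n + 2 < 2 * m := by
      have : (n : ℝ) + 2 < 2 * m := by linarith
      exact_mod_cast this
    omega
  obtain ⟨S, hS, hG⟩ := JMGT.exists_semigroup (s := m - 1) hn hg hτ hb0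
  exact ⟨S, hS, hG, JMGT.exists_time hn hs τ k hS⟩
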